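/- **Conventions.** $\lambda$ is the security parameter; all lengths and message-space sizes are functions of $\lambda$, alphabets are fixed. $[M]$ has $M=M(\lambda)$ elements, written in binary. "Polynomial time" for a family of maps means: computed, from $1^\lambda$ and the argument, by one deterministic algorithm in time polynomial in the size of its input. A PPT adversary is one uniform randomized algorithm that always halts in time polynomial in $\lambda$. A function is negligible if it is eventually smaller than every $\lambda^{-c}$. $\Delta_E(x,y)=|x|+|y|-2\,\mathrm{LCS}(x,y)$ is the edit (insertion–deletion) distance. *Half-error code.* $\mathrm{ECC}_{\mathrm{msg}}:[M]\to\Sigma_{\mathrm{msg}}^n$ is robust to any $p_{\mathrm{msg}}$ fraction of half-errors if it is polynomial-time computable and has a polynomial-time decoder that maps each $z\in(\Sigma_{\mathrm{msg}}\cup\{\bot\})^n$ to $m$ whenever $2e+s\le p_{\mathrm{msg}}n$, where $e$ and $s$ are the numbers of substitutions and erasures in $z$ relative to $\mathrm{ECC}_{\mathrm{msg}}(m)$. *Pseudorandom generator.* $\mathrm{PRG}:\{0,1\}^{d}\to S^n$ is polynomial-time computable, its seed length (as $1^{d(\lambda)}$) is computable in polynomial time, and no PPT adversary, given $1^\lambda$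 and a word of $S^n$, distinguishes its output on a uniform seed from a uniform word of $S^n$ with non-negligible advantage. *Seeded payload code.* Let $A$ be a finite alphabet (for instance $A=\{0,1\}$). A polynomial-time map $\mathrm{ECC}_{\mathrm{load}}:[M]\times\{0,1\}^d\times A^r\to\Sigma^n$ is a seeded payload code robust to any $p$ fraction of edit errors if: 1. (Robustness) there are a polynomial-time decoder $\mathrm{ECC}_{\mathrm{load}}^{-1}:\Sigma^*\times\{0,1\}^d\times A^r\to[M]\cup\{\bot\}$ and a negligible function $\mu$ such that, for every $\lambda$ and every $m\in[M]$, with probability at least $1-\mu(\lambda)$ over uniform $s\in\{0,1\}^d$ and $\mathsf{shift}\in A^r$, every $y'\in\Sigma^*$ with $\Delta_E(y',\mathrm{ECC}_{\mathrm{load}}(m,s,\mathsf{shift}))\le pn$ satisfies $\mathrm{ECC}_{\mathrm{load}}^{-1}(y',s,\mathsf{shift})=m$; 2. (Uniformity) for every fixed $m$ and $s$, and uniform $\mathsf{shift}\in A^r$, the word $\mathrm{ECC}_{\mathrm{load}}(m,s,\mathsf{shift})$ is uniform on $\Sigma^n$; 3. (Pseudorandomness) no PPT adversary that is given $1^\lambda$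 and a uniform $\mathsf{shift}\in A^r$ and makes adaptive queries in $[M]$ distinguishes with non-negligible advantage the oracle that answers $m$ by $\mathrm{ECC}_{\mathrm{load}}(m,s,\mathsf{shift})$, with a new uniform $s$ at each query, from the oracle that answers each query by a new uniform word of $\Sigma^n$. **Theorem.** There is an absolute constant $C>0$ such that the following holds. Let $\Sigma_{\mathrm{msg}}$ and $\Sigma_{\mathrm{syn}}$ be finite abelian groups (for instance finite fields), and let $\Sigma=\Sigma_{\mathrm{msg}}\times\Sigma_{\mathrm{syn}}$. Let $\mathrm{ECC}_{\mathrm{msg}}:[M]\to\Sigma_{\mathrm{msg}}^n$ be robust to any $p_{\mathrm{msg}}$ fraction of half-errors, and let $\mathrm{PRG}_{\mathrm{syn}}:\{0,1\}^{d_1}\to\Sigma_{\mathrm{syn}}^n$ and $\mathrm{PRG}_{\mathrm{msg}}:\{0,1\}^{d_2}\to\Sigma_{\mathrm{msg}}^n$ be pseudorandom generators. Let $\mathsf{shift}\in A^r$ be parsed into $(\mathsf{shift}_{\mathrm{msg}},\mathsf{shift}_{\mathrm{syn}})\in\Sigma_{\mathrm{msg}}^n\times\Sigma_{\mathrm{syn}}^n$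 by a polynomial-time map that sends the uniform distribution on $A^r$ to the uniform distribution on $\Sigma^n$, with $1^{r(\lambda)}$ computable in polynomial time (for instance $A=\Sigma$, $r=n$ and the identity; or $A=\{0,1\}$ and blocks of $b$ bits, if $|\Sigma|=2^b$). Let $\delta>0$ be a constant, and suppose that $$n=\Omega(\lambda),\qquad p_{\mathrm{load}}\le p_{\mathrm{msg}}-\delta,\qquad |\Sigma|\ge|\Sigma_{\mathrm{msg}}|\cdot C\,\delta^{-4}.$$ For $m\in[M]$ and $s=(s_1,s_2)\in\{0,1\}^{d_1}\times\{0,1\}^{d_2}$ put $$\sigma=\mathrm{PRG}_{\mathrm{syn}}(s_1)+\mathsf{shift}_{\mathrm{syn}},\qquad x=\mathrm{ECC}_{\mathrm{msg}}(m)+\mathrm{PRG}_{\mathrm{msg}}(s_2)+\mathsf{shift}_{\mathrm{msg}},$$ $$\mathrm{ECC}_{\mathrm{load}}(m,s,\mathsf{shift})=\bigl((x_1,\sigma_1),\dots,(x_n,\sigma_n)\bigr)\in\Sigma^n.$$ Then $\mathrm{ECC}_{\mathrm{load}}$, with seed length $d=d_1+d_2$, is a seeded payload code robust to any $p_{\mathrm{load}}$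 fraction of edit errors. -/

import Mathlib

namespace PayloadCode

/-! ## Data, programs and their running time

One computation model serves for all algorithms: a small first-order language on binary trees
(S-expressions) with an explicit cost.  Every executed instruction costs the number of nodes of
the tree it reads, plus the number of nodes of a tree that it receives from outside, so a
computation of cost `t` only builds trees with `O(t)` nodes and the model is polynomially
equivalent to (probabilistic, oracle) Turing machines. -/

/-- Binary trees. -/
inductive Data : Type
  | nil : Data
  | cons : Data → Data → Data

namespace Data

/-- Number of nodes, leaves included. -/
def size : Data → ℕ
  | nil => 1
  | cons a b => 1 + a.size + b.size

def fst : Data → Data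
  | nil => nil
  | cons a _ => a

def snd : Data → Data
  | nil => nil
  | cons _ b => b

def isNil : Data → Bool
  | nil => true
  | cons _ _ => false

/-- Unary numerals; `num k` is the usual `1^k`. -/
def num : ℕ → Data
  | 0 => nil
  | k + 1 => cons nil (num k)

def ofList : List Data → Data
  | [] => nil
  | a :: l => cons a (ofList l)

end Data

/-- Programs; each denotes a (partial, randomized) map from trees to trees. -/
inductive Prog : Type
  /-- the input itself -/
  | id : Prog
  /-- the constant `nil` -/
  | nil : Prog
  /-- left subtree -/
  | fst : Prog
  /-- right subtree -/
  | snd : Prog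
  /-- run `p` and then `q` on the input, and return the pair of the results -/
  | pair (p q : Prog) : Prog
  /-- run `q` on the input, and then `p` on the result -/
  | comp (p q : Prog) : Prog
  /-- run `c` on the input; if the result is not `nil` run `p` on the input, otherwise `q` -/
  | cond (c p q : Prog) : Prog
  /-- as long as the left subtree of the current value is not `nil`, apply `p` -/
  | loop (p : Prog) : Prog
  /-- a uniformly random element of `{0, …, k}`, as a numeral (for `k = 1` a fair coin) -/
  | rand (k : ℕ) : Prog
  /-- send the input to the oracle and return its answer -/
  | query : Prog

/-- Computations with a clock (the state is the time that is left) that may fail. -/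
abbrev Exec (m : Type → Type) : Type → Type := StateT ℕ (OptionT m)

/-- Spend `c` units of time; fail if fewer are left. -/
def tick {m : Type → Type} [Monad m] (c : ℕ) : Exec m Unit := fun t =>
  if c ≤ t then pure ((), t - c) else OptionT.fail

/-- At most `N` rounds of the loop with body `f`. -/
def loopRounds {m : Type → Type} [Monad m] (f : Data → Exec m Data) : ℕ → Data → Exec m Data
  | 0, _ => fun _ => OptionT.fail
  | N + 1, x => do
      tick x.size
      if x.fst.isNil then pure x else do
        let y ← f x
        loopRounds f N y

/-- Execution of a program, for a source `rnd` of random numbers and an oracle `orc`. A loop that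
starts with time `t` left runs out of time before it can exceed `t + 1` rounds, so that the bound
on the rounds only serves the recursion. -/
def Prog.run {m : Type → Type} [Monad m] (rnd : ℕ → OptionT m ℕ) (orc : Data → OptionT m Data) :
    Prog → Data → Exec m Data
  | .id, x => do tick x.size; pure x
  | .nil, x => do tick x.size; pure Data.nil
  | .fst, x => do tick x.size; pure x.fst
  | .snd, x => do tick x.size; pure x.snd
  | .pair p q, x => do
      tick x.size
      let a ← Prog.run rnd orc p x
      let b ← Prog.run rnd orc q x
      pure (Data.cons a b)
  | .comp p q, x => do
      tick x.size
      let y ← Prog.run rnd orc q x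
      Prog.run rnd orc p y
  | .cond c p q, x => do
      tick x.size
      let b ← Prog.run rnd orc c x
      if b.isNil then Prog.run rnd orc q x else Prog.run rnd orc p x
  | .loop p, x => do
      let t ← get
      loopRounds (Prog.run rnd orc p) (t + 1) x
  | .rand k, x => do
      tick x.size
      let i ← (StateT.lift (rnd k) : Exec m ℕ)
      tick (Data.num i).size
      pure (Data.num i)
  | .query, x => do
      tick x.size
      let y ← (StateT.lift (orc x) : Exec m Data)
      tick y.size
      pure y

/-- Deterministic execution with time limit `t`: the result and the time that is left, or `none`
if the limit is exceeded or the program uses randomness or an oracle. -/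
def Prog.evalDet (p : Prog) (x : Data) (t : ℕ) : Option (Data × ℕ) :=
  Id.run (Prog.run (m := Id) (fun _ => OptionT.fail) (fun _ => OptionT.fail) p x t).run

/-- Randomized execution with oracle `orc` and time limit `t`: the distribution of the result and
the time that is left; `none` if the limit is exceeded or the oracle refuses a query. -/
noncomputable def Prog.evalProb (p : Prog) (orc : Data → OptionT PMF Data) (x : Data) (t : ℕ) :
    PMF (Option (Data × ℕ)) :=
  (Prog.run (m := PMF)
    (fun k => OptionT.lift ((PMF.uniformOfFintype (Fin (k + 1))).map Fin.val))
    orc p x t).run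

/-- The oracle of a program that has no oracle: it refuses every query. -/
noncomputable def noOracle : Data → OptionT PMF Data := fun _ => OptionT.fail

/-- Probability of an event. -/
noncomputable def prob {α : Type} (P : PMF α) (E : Set α) : ℝ := (P.toOuterMeasure E).toReal

/-- The event that a run halts with output `1`. -/
def accepts : Set (Option (Data × ℕ)) := {o | o.map Prod.fst = some (Data.num 1)}

/-- Negligible functions of the security parameter. -/
def Negligible (μ : ℕ → ℝ) : Prop :=
  Asymptotics.SuperpolynomialDecay Filter.atTop (fun k : ℕ => (k : ℝ)) μ

/-! ## Encodings of inputs and outputs, and polynomial time -/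

/-- A symbol of a fixed finite alphabet, encoded by its number in a fixed enumeration. -/
noncomputable def encSym {S : Type} [Fintype S] (a : S) : Data :=
  Data.num (Fintype.equivFin S a : ℕ)

noncomputable def encList {S : Type} [Fintype S] (w : List S) : Data :=
  Data.ofList (w.map encSym)

noncomputable def encVec {S : Type} [Fintype S] {n : ℕ} (w : Fin n → S) : Data :=
  encList (List.ofFn w)

/-- A message of `[M]`, encoded in binary. -/
noncomputable def encMsg {M : ℕ} (a : Fin M) : Data := encList (Nat.bits a)

/-- The result of a decoder; `none` is the failure symbol. -/
noncomputable def encOptMsg {M : ℕ} : Option (Fin M) → Data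
  | none => Data.nil
  | some a => Data.cons Data.nil (encMsg a)

/-- The family `f`, indexed by the security parameter `k`, is computed from `1^k` and the argument
by one deterministic program in time polynomial in the size of its input. -/
def PolyTime {α β : ℕ → Type} (ein : ∀ k, α k → Data) (eout : ∀ k, β k → Data)
    (f : ∀ k, α k → β k) : Prop :=
  ∃ (p : Prog) (q : Polynomial ℕ), ∀ k (x : α k), ∃ rest : ℕ,
    p.evalDet (Data.cons (Data.num k) (ein k x))
      (q.eval (Data.cons (Data.num k) (ein k x)).size) = some (eout k (f k x), rest)

/-- The length `d` is computable from `1^k` in polynomial time (in unary, hence `d` is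
polynomially bounded). -/
def PolyTimeLength (d : ℕ → ℕ) : Prop :=
  PolyTime (α := fun _ => Unit) (β := fun _ => ℕ) (fun _ _ => Data.nil) (fun _ => Data.num)
    (fun k _ => d k)

/-! ## Distances and Hamming codes -/

/-- Length of a longest common subsequence. -/
noncomputable def lcsLength {S : Type} (x y : List S) : ℕ :=
  sSup {l | ∃ z : List S, z.Sublist x ∧ z.Sublist y ∧ z.length = l}

/-- Edit distance: number of insertions and deletions. -/
noncomputable def editDist {S : Type} (x y : List S) : ℕ :=
  x.length + y.length - 2 * lcsLength x y

open Classical in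
/-- Number of half-errors of `z` relative to `c`: a substitution counts twice, an erasure
(`none`) once. -/
noncomputable def halfErrors {S : Type} {n : ℕ} (c : Fin n → S) (z : Fin n → Option S) : ℕ :=
  2 * (Finset.univ.filter fun i => z i ≠ none ∧ z i ≠ some (c i)).card +
    (Finset.univ.filter fun i => z i = none).card

/-- `enc` is a polynomial-time encodable code with a polynomial-time decoder that corrects every
pattern with at most a fraction `p` of half-errors. -/
structure IsHalfErrorCode {S : Type} [Fintype S] {M n : ℕ → ℕ}
    (enc : ∀ k, Fin (M k) → Fin (n k) → S) (p : ℝ) : Prop where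
  polyTime_enc : PolyTime (fun _ => encMsg) (fun _ => encVec) enc
  exists_dec : ∃ dec : ∀ k, (Fin (n k) → Option S) → Option (Fin (M k)),
    PolyTime (fun _ => encVec) (fun _ => encOptMsg) dec ∧
    ∀ k a (z : Fin (n k) → Option S), (halfErrors (enc k a) z : ℝ) ≤ p * n k → dec k z = some a

/-! ## Pseudorandom generators -/

/-- `G` is a pseudorandom generator with seeds of `d` bits and output in `S ^ n`: seed length and
output are computable in polynomial time, and no probabilistic polynomial-time distinguisher has
a non-negligible advantage. A distinguisher is a program that, for every input, halts within a
polynomial number `q` of steps whatever its random choices are. -/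
structure IsPRG {S : Type} [Fintype S] [Nonempty S] {d n : ℕ → ℕ}
    (G : ∀ k, (Fin (d k) → Bool) → Fin (n k) → S) : Prop where
  polyTime_length : PolyTimeLength d
  polyTime_gen : PolyTime (fun _ => encVec) (fun _ => encVec) G
  secure : ∀ (D : Prog) (q : Polynomial ℕ),
    (∀ k (z : Fin (n k) → S),
      none ∉ (D.evalProb noOracle (Data.cons (Data.num k) (encVec z)) (q.eval k)).support) →
    Negligible fun k =>
      |prob ((PMF.uniformOfFintype (Fin (d k) → Bool)).bind fun s =>
          D.evalProb noOracle (Data.cons (Data.num k) (encVec (G k s))) (q.eval k)) accepts -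
        prob ((PMF.uniformOfFintype (Fin (n k) → S)).bind fun z =>
          D.evalProb noOracle (Data.cons (Data.num k) (encVec z)) (q.eval k)) accepts|

/-! ## Seeded payload codes

The public string `shift` is a string of length `r` over a finite alphabet `A`. -/

section Oracles

open Classical in
/-- The oracle that answers each query `a ∈ [M]` by an independent sample from `P a`, and accepts
no other queries. -/
noncomputable def msgOracle {S : Type} [Fintype S] {M n : ℕ} (P : Fin M → PMF (Fin n → S)) :
    Data → OptionT PMF Data := fun x =>
  if h : ∃ a : Fin M, x = encMsg a then OptionT.lift ((P h.choose).map encVec)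
  else OptionT.fail

/-- The oracle `ecc(·, U_d, shift)`, which samples a new seed at each query. -/
noncomputable def realOracle {S A : Type} [Fintype S] {M d r n : ℕ}
    (ecc : Fin M → (Fin d → Bool) → (Fin r → A) → Fin n → S) (shift : Fin r → A) :
    Data → OptionT PMF Data :=
  msgOracle fun a => (PMF.uniformOfFintype (Fin d → Bool)).map fun s => ecc a s shift

/-- The oracle that answers each query by a new uniform word. -/
noncomputable def uniformOracle (S : Type) [Fintype S] [Nonempty S] (M n : ℕ) :
    Data → OptionT PMF Data :=
  msgOracle fun _ : Fin M => PMF.uniformOfFintype (Fin n → S)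

end Oracles

/-- Encoding of the arguments `(a, s, shift)` of the encoder. -/
noncomputable def encArgs {A : Type} [Fintype A] {M d r : ℕ}
    (x : Fin M × (Fin d → Bool) × (Fin r → A)) : Data :=
  Data.cons (encMsg x.1) (Data.cons (encVec x.2.1) (encVec x.2.2))

/-- Encoding of the arguments `(y, s, shift)` of the decoder. -/
noncomputable def encDecArgs {S A : Type} [Fintype S] [Fintype A] {d r : ℕ}
    (x : List S × (Fin d → Bool) × (Fin r → A)) : Data :=
  Data.cons (encList x.1) (Data.cons (encVec x.2.1) (encVec x.2.2))

/-- `ecc` is a seeded payload code that is robust to a fraction `p` of edit errors. In the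
pseudorandomness game an adversary is a program that makes only queries in `[M]` and halts within
a polynomial number `q` of steps, whatever its input, its random choices and the words that it
receives as answers. -/
structure IsSeededPayloadCode {S A : Type} [Fintype S] [Nonempty S] [Fintype A] [Nonempty A]
    {M d r n : ℕ → ℕ}
    (ecc : ∀ k, Fin (M k) → (Fin (d k) → Bool) → (Fin (r k) → A) → Fin (n k) → S)
    (p : ℝ) : Prop where
  polyTime_enc : PolyTime (α := fun k => Fin (M k) × (Fin (d k) → Bool) × (Fin (r k) → A))
    (fun _ => encArgs) (fun _ => encVec) (fun k x => ecc k x.1 x.2.1 x.2.2)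
  robust : ∃ dec : ∀ k, List S × (Fin (d k) → Bool) × (Fin (r k) → A) → Option (Fin (M k)),
    PolyTime (fun _ => encDecArgs) (fun _ => encOptMsg) dec ∧
    ∃ μ : ℕ → ℝ, Negligible μ ∧ ∀ k (a : Fin (M k)),
      1 - μ k ≤ prob (PMF.uniformOfFintype ((Fin (d k) → Bool) × (Fin (r k) → A)))
        {x | ∀ y : List S, (editDist y (List.ofFn (ecc k a x.1 x.2)) : ℝ) ≤ p * n k →
          dec k (y, x.1, x.2) = some a}
  uniform : ∀ k (a : Fin (M k)) (s : Fin (d k) → Bool),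
    (PMF.uniformOfFintype (Fin (r k) → A)).map (fun shift => ecc k a s shift) =
      PMF.uniformOfFintype (Fin (n k) → S)
  pseudorandom : ∀ (D : Prog) (q : Polynomial ℕ),
    (∀ k (shift : Fin (r k) → A),
      none ∉ (D.evalProb (uniformOracle S (M k) (n k))
        (Data.cons (Data.num k) (encVec shift)) (q.eval k)).support) →
    Negligible fun k =>
      |prob ((PMF.uniformOfFintype (Fin (r k) → A)).bind fun shift =>
          D.evalProb (realOracle (ecc k) shift)
            (Data.cons (Data.num k) (encVec shift)) (q.eval k)) accepts -
        prob ((PMF.uniformOfFintype (Fin (r k) → A)).bind fun shift =>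
          D.evalProb (uniformOracle S (M k) (n k))
            (Data.cons (Data.num k) (encVec shift)) (q.eval k)) accepts|

/-! ## The construction -/

/-- `parse` reads the public string, a string of length `r` over `A`, as a word of `S ^ n`: length
and map are computable in polynomial time, and a uniform string gives a uniform word. For `A = S`,
`r = n` the identity is an example; if `|S| = 2 ^ b`, another one is `A = {0,1}`, `r = b n` with
blocks of `b` bits read as symbols. -/
structure IsShiftParser {S A : Type} [Fintype S] [Nonempty S] [Fintype A] [Nonempty A]
    {r n : ℕ → ℕ} (parse : ∀ k, (Fin (r k) → A) → Fin (n k) → S) : Prop where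
  polyTime_length : PolyTimeLength r
  polyTime_parse : PolyTime (fun _ => encVec) (fun _ => encVec) parse
  uniform : ∀ k, (PMF.uniformOfFintype (Fin (r k) → A)).map (parse k) =
    PMF.uniformOfFintype (Fin (n k) → S)

/-- The encoder. The seed is `s = (s₁, s₂)`, the public string is parsed into
`(shift_msg, shift_syn)`, and the `i`-th symbol is the pair of the `i`-th symbols of
`enc a + Gmsg s₂ + shift_msg` and of `Gsyn s₁ + shift_syn`. -/
def loadCode {Smsg Ssyn A : Type} [AddCommGroup Smsg] [AddCommGroup Ssyn] {M d₁ d₂ r n : ℕ → ℕ}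
    (enc : ∀ k, Fin (M k) → Fin (n k) → Smsg)
    (Gsyn : ∀ k, (Fin (d₁ k) → Bool) → Fin (n k) → Ssyn)
    (Gmsg : ∀ k, (Fin (d₂ k) → Bool) → Fin (n k) → Smsg)
    (parse : ∀ k, (Fin (r k) → A) → Fin (n k) → Smsg × Ssyn)
    (k : ℕ) (a : Fin (M k)) (s : Fin (d₁ k + d₂ k) → Bool) (shift : Fin (r k) → A) :
    Fin (n k) → Smsg × Ssyn := fun i =>
  (enc k a i + Gmsg k (fun j => s (Fin.natAdd (d₁ k) j)) i + (parse k shift i).1,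
    Gsyn k (fun j => s (Fin.castAdd (d₂ k) j)) i + (parse k shift i).2)

end PayloadCode

/-! Robustness. The seed and the public string are known to the decoder, so the word `σ` serves as a
list of synchronization marks. For every fixed seed `σ` is uniform, because the shift is. If `σ` has
a self-matching of size `k`, there are order embeddings `a`, `b` of `Fin k` into the positions with
`a t ≠ b t` and `σ (a t) = σ (b t)`. For fixed `a`, `b` these equations determine `k` symbols from
earlier ones (`card_agree_le`). A union bound over at most `(n choose k)² ≤ (e/ε)^(2k)` pairs, for
`k ≥ ε n`, leaves probability at most `2^(-k)` as soon as the alphabet has `16/ε²` symbols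
(`card_selfMatching_le_two_pow`). With `ε = δ²/20` this is `6400/δ⁴`, and `n = Ω(λ)` makes the
failure probability negligible.

The decoder performs `R = ⌈4/δ⌉` rounds. Each round takes a longest common subsequence of `σ` and
the marks of the received symbols that are still unassigned, and assigns the matched symbols to
positions of `σ`. A position with exactly one symbol is unmasked; every other position is an
erasure. Compare this with an optimal alignment of the received word `y` and the code word. The
transmitted symbols that are never assigned form a common subsequence in every round, so there are
at most `|y|/R` of them. The transmitted symbols that one round assigns to wrong positions yield a
self-matching of `σ`, so there are fewer than `⌈ε n⌉` per round. A charging argument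
(`halfErrors_decodedWord_le`) bounds the half-errors by the edit distance plus the first number plus
twice the second, hence by `(p + δ) n`, and the half-error decoder finishes.

Uniformity. For a fixed message and seed the encoder translates the parsed shift by a fixed group
element.

Pseudorandomness. In the answers, `Gmsg s₂` is replaced by a uniform word, which hides the message,
and then `Gsyn s₁` by a uniform word. Each replacement is a hybrid argument over the queries
(`negligible_of_isPRG`). Its distinguisher has to be a program without an oracle, so the adversary
is compiled into a program that carries a query counter and the challenge as a state
(`isSimulation_withState`).

Running time. Programs are unfolded into trees of computations. The predicates `Runs` and `PTF` for
deterministic programs, and `Samples` and `SampleableFrom` for randomized ones, are closed under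
composition, branching, loops or folds as needed, and so no program for the encoder, the decoder or
the distinguisher has to be analysed as a whole. -/

namespace PayloadCode

/-! ## Computation trees -/

/-- The tree of all computations of a program from a given clock value. -/
inductive Tree : Type
  | fail : Tree
  | ret (y : Data) (t : ℕ) : Tree
  | rand (k : ℕ) (f : Fin (k + 1) → Tree) : Tree
  | query (x : Data) (f : Data → Tree) : Tree

namespace Tree

def bind : Tree → (Data → ℕ → Tree) → Tree
  | fail, _ => fail
  | ret y t, g => g y t
  | rand k f, g => rand k fun i => (f i).bind g
  | query x f, g => query x fun y => (f y).bind g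

/-- Spend `c` of `t` units of time. -/
def tick (c t : ℕ) (f : ℕ → Tree) : Tree := if c ≤ t then f (t - c) else fail

def loop (f : Data → ℕ → Tree) : ℕ → Data → ℕ → Tree
  | 0, _, _ => fail
  | N + 1, x, t => tick x.size t fun t =>
      if x.fst.isNil then ret x t else (f x t).bind fun y t => loop f N y t

/-- The distribution of the outcome with oracle `orc`. -/
noncomputable def eval (orc : Data → OptionT PMF Data) : Tree → PMF (Option (Data × ℕ))
  | fail => PMF.pure none
  | ret y t => PMF.pure (some (y, t))
  | rand k f => (PMF.uniformOfFintype (Fin (k + 1))).bind fun i => (f i).eval orc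
  | query x f => (orc x).run.bind fun o => o.elim (PMF.pure none) fun y => (f y).eval orc

def evalDet : Tree → Option (Data × ℕ)
  | ret y t => some (y, t)
  | _ => none

end Tree

/-- Random choices and oracle answers stay open as branches. Deterministic runs, randomized runs and
runs with a stateful oracle are then three evaluations of one tree. -/
def Prog.tree : Prog → Data → ℕ → Tree
  | .id, x, t => Tree.tick x.size t fun t => .ret x t
  | .nil, x, t => Tree.tick x.size t fun t => .ret Data.nil t
  | .fst, x, t => Tree.tick x.size t fun t => .ret x.fst t
  | .snd, x, t => Tree.tick x.size t fun t => .ret x.snd t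
  | .pair p q, x, t => Tree.tick x.size t fun t => (p.tree x t).bind fun a t =>
      (q.tree x t).bind fun b t => .ret (Data.cons a b) t
  | .comp p q, x, t => Tree.tick x.size t fun t => (q.tree x t).bind p.tree
  | .cond c p q, x, t => Tree.tick x.size t fun t => (c.tree x t).bind fun b t =>
      if b.isNil then q.tree x t else p.tree x t
  | .loop p, x, t => Tree.loop p.tree (t + 1) x t
  | .rand k, x, t => Tree.tick x.size t fun t => .rand k fun i =>
      Tree.tick (Data.num i).size t fun t => .ret (Data.num i) t
  | .query, x, t => Tree.tick x.size t fun t => .query x fun y =>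
      Tree.tick y.size t fun t => .ret y t

/-! ### Relation to the monadic semantics -/

theorem Tree.eval_bind (orc : Data → OptionT PMF Data) (T : Tree) (g : Data → ℕ → Tree) :
    (T.bind g).eval orc = (T.eval orc).bind fun o =>
      o.elim (PMF.pure none) fun y => (g y.1 y.2).eval orc := by
  induction T with
  | fail => simp [Tree.bind, Tree.eval]
  | ret y t => simp [Tree.bind, Tree.eval]
  | rand k f ih => simp [Tree.bind, Tree.eval, ih, PMF.bind_bind]
  | query x f ih =>
    simp only [Tree.bind, Tree.eval, PMF.bind_bind]
    congr 1; funext o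
    cases o <;> simp [ih]

section Exec

variable {m : Type → Type} [Monad m]

theorem run_exec_bind {α β : Type} (a : Exec m α) (f : α → Exec m β) (t : ℕ) :
    ((a >>= f) t).run = (a t).run >>= fun o =>
      o.elim (pure none) fun y => (f y.1 y.2).run := by
  simp only [bind, StateT.bind, OptionT.bind, OptionT.run, OptionT.mk]
  congr 1; funext o
  cases o <;> rfl

theorem run_exec_pure {α : Type} (a : α) (t : ℕ) :
    ((pure a : Exec m α) t).run = pure (some (a, t)) := rfl

theorem run_exec_tick (c t : ℕ) :
    (tick (m := m) c t).run = if c ≤ t then pure (some ((), t - c)) else pure none := by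
  unfold tick
  split <;> rfl

theorem run_exec_get (t : ℕ) :
    ((get : Exec m ℕ) t).run = pure (some (t, t)) := rfl

theorem run_exec_lift {α : Type} (a : OptionT m α) (t : ℕ) :
    ((StateT.lift a : Exec m α) t).run =
      a.run >>= fun o => o.elim (pure none) fun y => pure (some (y, t)) := by
  simp only [StateT.lift, bind, OptionT.bind, OptionT.run, OptionT.mk]
  congr 1; funext o
  cases o <;> rfl

end Exec

theorem Tree.eval_tick (orc : Data → OptionT PMF Data) (c t : ℕ) (f : ℕ → Tree) :
    (Tree.tick c t f).eval orc = if c ≤ t then (f (t - c)).eval orc else PMF.pure none := by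
  unfold Tree.tick
  split <;> rfl

theorem run_loopRounds (orc : Data → OptionT PMF Data) (g : Data → Exec PMF Data)
    (f : Data → ℕ → Tree) (h : ∀ x t, (g x t).run = (f x t).eval orc) :
    ∀ N x t, (loopRounds g N x t).run = (Tree.loop f N x t).eval orc := by
  intro N
  induction N with
  | zero => intro x t; rfl
  | succ N ih =>
    intro x t
    simp only [loopRounds, Tree.loop, run_exec_bind, run_exec_tick, Tree.eval_tick]
    split_ifs with h1 h2
    · simp [run_exec_pure, Tree.eval]; rfl
    · simp only [pure_bind, Option.elim, run_exec_bind, h, ih, Tree.eval_bind]; rfl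
    all_goals
      change PMF.bind (PMF.pure _) _ = _
      rw [PMF.pure_bind]; rfl

/-- The monadic semantics is left behind here: from now on distributions of outcomes are computed on
trees. -/
theorem Prog.run_eq_eval (orc : Data → OptionT PMF Data) (p : Prog) : ∀ x t,
    (Prog.run (m := PMF)
      (fun k => OptionT.lift ((PMF.uniformOfFintype (Fin (k + 1))).map Fin.val)) orc p x t).run =
      (p.tree x t).eval orc := by
  have bp : ∀ {α β : Type} (a : α) (f : α → PMF β), (pure a >>= f) = f a :=
    fun a f => PMF.pure_bind a f
  induction p with
  | id | nil | fst | snd =>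
    intro x t
    simp only [Prog.run, Prog.tree, run_exec_bind, run_exec_tick, Tree.eval_tick]
    split_ifs <;> simp only [bp] <;> rfl
  | pair p q ihp ihq =>
    intro x t
    simp only [Prog.run, Prog.tree, run_exec_bind, run_exec_tick, Tree.eval_tick]
    split_ifs
    · simp only [bp, Option.elim, ihp, ihq, Tree.eval_bind]; rfl
    · simp only [bp]; rfl
  | comp p q ihp ihq =>
    intro x t
    simp only [Prog.run, Prog.tree, run_exec_bind, run_exec_tick, Tree.eval_tick]
    split_ifs
    · simp only [bp, Option.elim, ihp, ihq, Tree.eval_bind]; rfl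
    · simp only [bp]; rfl
  | cond c p q ihc ihp ihq =>
    intro x t
    simp only [Prog.run, Prog.tree, run_exec_bind, run_exec_tick, Tree.eval_tick]
    split_ifs
    · simp only [bp, Option.elim, ihc, Tree.eval_bind]
      refine congrArg (PMF.bind _) (funext fun o => ?_)
      cases o with
      | none => rfl
      | some y => dsimp only; split_ifs <;> simp only [ihp, ihq]
    · simp only [bp]; rfl
  | loop p ih =>
    intro x t
    simp only [Prog.run, Prog.tree, run_exec_bind, run_exec_get, bp, Option.elim]
    exact run_loopRounds orc _ _ ih _ _ _
  | rand k =>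
    intro x t
    simp only [Prog.run, Prog.tree, run_exec_bind, run_exec_tick, Tree.eval_tick]
    split_ifs
    · simp only [bp, Option.elim, run_exec_lift, OptionT.run_lift]
      change PMF.bind _ _ = _
      simp only [Tree.eval, Tree.eval_tick]
      change PMF.bind (PMF.bind (PMF.bind (PMF.map _ _) _) _) _ = _
      simp only [PMF.map, PMF.bind_bind, PMF.pure_bind, Function.comp]
      refine congrArg (PMF.bind _) (funext fun i => ?_)
      change PMF.bind (PMF.pure _) _ = _
      rw [PMF.pure_bind]
      change PMF.bind (PMF.pure _) _ = _
      rw [PMF.pure_bind]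
      by_cases hc : (Data.num i).size ≤ t - x.size
      · rw [if_pos hc]
        dsimp only
        rw [if_pos hc]
        change PMF.bind (PMF.pure _) _ = _
        rw [PMF.pure_bind]; rfl
      · rw [if_neg hc]
        dsimp only
        rw [if_neg hc]
        change PMF.bind (PMF.pure _) _ = _
        rw [PMF.pure_bind]; rfl
    · simp only [bp]; rfl
  | query =>
    intro x t
    simp only [Prog.run, Prog.tree, run_exec_bind, run_exec_tick, Tree.eval_tick]
    split_ifs
    · simp only [bp, Option.elim, run_exec_lift]
      change PMF.bind (PMF.bind _ _) _ = _
      simp only [Tree.eval, Tree.eval_tick, PMF.bind_bind]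
      refine congrArg (PMF.bind _) (funext fun o => ?_)
      cases o with
      | none => change PMF.bind (PMF.pure _) _ = _; rw [PMF.pure_bind]; rfl
      | some y =>
        change PMF.bind (PMF.pure _) _ = _
        rw [PMF.pure_bind]
        simp only [Option.elim, run_exec_bind, run_exec_tick]
        split_ifs <;> simp only [bp] <;> rfl
    · simp only [bp]; rfl

theorem Prog.evalProb_eq (p : Prog) (orc : Data → OptionT PMF Data) (x : Data) (t : ℕ) :
    p.evalProb orc x t = (p.tree x t).eval orc := p.run_eq_eval orc x t

theorem Tree.evalDet_bind (T : Tree) (g : Data → ℕ → Tree) :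
    (T.bind g).evalDet = T.evalDet.elim (none) fun y => (g y.1 y.2).evalDet := by
  cases T <;> rfl

theorem Tree.evalDet_tick (c t : ℕ) (f : ℕ → Tree) :
    (Tree.tick c t f).evalDet = if c ≤ t then (f (t - c)).evalDet else none := by
  unfold Tree.tick
  split <;> rfl

theorem loopRounds_eq_evalDet (g : Data → Exec Id Data)
    (f : Data → ℕ → Tree) (h : ∀ x t, (g x t).run = (f x t).evalDet) :
    ∀ N x t, (loopRounds g N x t).run = (Tree.loop f N x t).evalDet := by
  intro N
  induction N with
  | zero => intro x t; rfl
  | succ N ih =>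
    intro x t
    simp only [loopRounds, Tree.loop, run_exec_bind, run_exec_tick, Tree.evalDet_tick]
    split_ifs with h1 h2
    · rfl
    · simp only [pure_bind, Option.elim, run_exec_bind, h, ih, Tree.evalDet_bind]; rfl
    all_goals rfl

theorem Prog.run_eq_evalDet (p : Prog) : ∀ x t,
    (Prog.run (m := Id) (fun _ => OptionT.fail) (fun _ => OptionT.fail) p x t).run =
      (p.tree x t).evalDet := by
  induction p with
  | id | nil | fst | snd =>
    intro x t
    simp only [Prog.run, Prog.tree, run_exec_bind, run_exec_tick, Tree.evalDet_tick]
    split_ifs <;> rfl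
  | pair p q ihp ihq =>
    intro x t
    simp only [Prog.run, Prog.tree, run_exec_bind, run_exec_tick, Tree.evalDet_tick]
    split_ifs
    · simp only [pure_bind, Option.elim, ihp, ihq, Tree.evalDet_bind]; rfl
    · rfl
  | comp p q ihp ihq =>
    intro x t
    simp only [Prog.run, Prog.tree, run_exec_bind, run_exec_tick, Tree.evalDet_tick]
    split_ifs
    · simp only [pure_bind, Option.elim, ihp, ihq, Tree.evalDet_bind]; rfl
    · rfl
  | cond c p q ihc ihp ihq =>
    intro x t
    simp only [Prog.run, Prog.tree, run_exec_bind, run_exec_tick, Tree.evalDet_tick]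
    split_ifs
    · simp only [pure_bind, Option.elim, ihc, Tree.evalDet_bind]
      cases (c.tree x (t - x.size)).evalDet with
      | none => rfl
      | some y =>
        change (if y.1.isNil then _ else _ : Exec Id Data) _ = _
        dsimp only
        split_ifs
        · exact ihq _ _
        · exact ihp _ _
    · rfl
  | loop p ih =>
    intro x t
    simp only [Prog.run, Prog.tree, run_exec_bind, run_exec_get, pure_bind, Option.elim]
    exact loopRounds_eq_evalDet _ _ ih _ _ _
  | rand k =>
    intro x t
    simp only [Prog.run, Prog.tree, run_exec_bind, run_exec_tick, Tree.evalDet_tick]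
    split_ifs <;> rfl
  | query =>
    intro x t
    simp only [Prog.run, Prog.tree, run_exec_bind, run_exec_tick, Tree.evalDet_tick]
    split_ifs <;> rfl

/-- Deterministic evaluation succeeds at leaves only. A successful run therefore has no random
choice or query, and the same tree describes it inside randomized programs. -/
theorem Prog.tree_of_evalDet {p : Prog} {x : Data} {t : ℕ} {y : Data} {t' : ℕ}
    (h : p.evalDet x t = some (y, t')) : p.tree x t = .ret y t' := by
  have h1 : (p.tree x t).evalDet = some (y, t') := by
    rw [← Prog.run_eq_evalDet]; exact h
  generalize p.tree x t = T at h1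
  cases T <;> simp_all [Tree.evalDet]

theorem Prog.evalDet_of_tree {p : Prog} {x : Data} {t : ℕ} {y : Data} {t' : ℕ}
    (h : p.tree x t = .ret y t') : p.evalDet x t = some (y, t') := by
  have h1 : (p.tree x t).evalDet = some (y, t') := by rw [h]; rfl
  rw [← Prog.run_eq_evalDet] at h1; exact h1

/-! ### Clock monotonicity -/

theorem Tree.bind_eq_ret {T : Tree} {g : Data → ℕ → Tree} {y : Data} {t : ℕ}
    (h : T.bind g = .ret y t) : ∃ a s, T = .ret a s ∧ g a s = .ret y t := by
  cases T with
  | ret a s => exact ⟨a, s, rfl, h⟩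
  | _ => simp [Tree.bind] at h

theorem Tree.tick_eq_ret {c t : ℕ} {f : ℕ → Tree} {y : Data} {s : ℕ}
    (h : Tree.tick c t f = .ret y s) : c ≤ t ∧ f (t - c) = .ret y s := by
  unfold Tree.tick at h
  split_ifs at h with h1
  exact ⟨h1, h⟩

theorem Tree.tick_of_le {c t : ℕ} {f : ℕ → Tree} (h : c ≤ t) :
    Tree.tick c t f = f (t - c) := if_pos h

/-- A deterministic outcome and its cost do not depend on the clock. -/
def ClockMono (f : Data → ℕ → Tree) : Prop :=
  ∀ x t y t', f x t = .ret y t' → t' + y.size ≤ t ∧ ∀ s, f x (t + s) = .ret y (t' + s)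

theorem Data.size_pos (x : Data) : 0 < x.size := by cases x <;> simp [Data.size]

theorem Data.size_fst_le (x : Data) : x.fst.size ≤ x.size := by
  cases x <;> simp [Data.size, Data.fst]; omega

theorem Data.size_snd_le (x : Data) : x.snd.size ≤ x.size := by
  cases x <;> simp [Data.size, Data.snd]

/-- The number of rounds allowed to a loop is its clock plus one, so it grows with the clock; hence
the free `N'`. -/
theorem ClockMono.loop {f : Data → ℕ → Tree} (hf : ClockMono f) :
    ∀ N x t y t', Tree.loop f N x t = .ret y t' → t' + y.size ≤ t ∧
      ∀ s N', N ≤ N' → Tree.loop f N' x (t + s) = .ret y (t' + s) := by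
  intro N
  induction N with
  | zero => intro x t y t' h; simp [Tree.loop] at h
  | succ N ih =>
    intro x t y t' h
    simp only [Tree.loop] at h
    obtain ⟨h1, h2⟩ := Tree.tick_eq_ret h
    split_ifs at h2 with h3
    · injection h2 with h4 h5
      subst h4
      refine ⟨by omega, fun s N' hN => ?_⟩
      obtain ⟨N', rfl⟩ : ∃ K, N' = K + 1 := ⟨N' - 1, by omega⟩
      rw [Tree.loop, Tree.tick_of_le (by omega), if_pos h3]
      congr 1; omega
    · obtain ⟨a, u, h4, h5⟩ := Tree.bind_eq_ret h2
      obtain ⟨h6, h7⟩ := hf _ _ _ _ h4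
      obtain ⟨h8, h9⟩ := ih _ _ _ _ h5
      refine ⟨by omega, fun s N' hN => ?_⟩
      obtain ⟨N', rfl⟩ : ∃ K, N' = K + 1 := ⟨N' - 1, by omega⟩
      rw [Tree.loop, Tree.tick_of_le (by omega), if_neg h3,
        show t + s - x.size = t - x.size + s by omega, h7]
      exact h9 s N' (by omega)

theorem Prog.clockMono (p : Prog) : ClockMono p.tree := by
  induction p with
  | id | nil | fst | snd =>
    intro x t y t' h
    obtain ⟨h1, h2⟩ := Tree.tick_eq_ret h
    injection h2 with h4 h5
    subst h4
    have e1 := x.size_fst_le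
    have e2 := x.size_snd_le
    have e3 := x.size_pos
    refine ⟨by try simp only [Data.size]
               omega, fun s => ?_⟩
    rw [Prog.tree, Tree.tick_of_le (by omega)]
    congr 1; omega
  | pair p q ihp ihq =>
    intro x t y t' h
    obtain ⟨h1, h2⟩ := Tree.tick_eq_ret h
    obtain ⟨a, u, h4, h5⟩ := Tree.bind_eq_ret h2
    obtain ⟨b, v, h6, h7⟩ := Tree.bind_eq_ret h5
    injection h7 with h8 h9
    subst h8 h9
    obtain ⟨e1, e2⟩ := ihp _ _ _ _ h4
    obtain ⟨e3, e4⟩ := ihq _ _ _ _ h6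
    have e5 := x.size_pos
    refine ⟨by simp only [Data.size]; omega, fun s => ?_⟩
    rw [Prog.tree, Tree.tick_of_le (by omega), show t + s - x.size = t - x.size + s by omega,
      e2, Tree.bind, e4, Tree.bind]
  | comp p q ihp ihq =>
    intro x t y t' h
    obtain ⟨h1, h2⟩ := Tree.tick_eq_ret h
    obtain ⟨a, u, h4, h5⟩ := Tree.bind_eq_ret h2
    obtain ⟨e1, e2⟩ := ihq _ _ _ _ h4
    obtain ⟨e3, e4⟩ := ihp _ _ _ _ h5
    refine ⟨by omega, fun s => ?_⟩
    rw [Prog.tree, Tree.tick_of_le (by omega), show t + s - x.size = t - x.size + s by omega,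
      e2, Tree.bind, e4]
  | cond c p q ihc ihp ihq =>
    intro x t y t' h
    obtain ⟨h1, h2⟩ := Tree.tick_eq_ret h
    obtain ⟨a, u, h4, h5⟩ := Tree.bind_eq_ret h2
    obtain ⟨e1, e2⟩ := ihc _ _ _ _ h4
    split_ifs at h5 with h6
    · obtain ⟨e3, e4⟩ := ihq _ _ _ _ h5
      refine ⟨by omega, fun s => ?_⟩
      rw [Prog.tree, Tree.tick_of_le (by omega), show t + s - x.size = t - x.size + s by omega,
        e2, Tree.bind, if_pos h6, e4]
    · obtain ⟨e3, e4⟩ := ihp _ _ _ _ h5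
      refine ⟨by omega, fun s => ?_⟩
      rw [Prog.tree, Tree.tick_of_le (by omega), show t + s - x.size = t - x.size + s by omega,
        e2, Tree.bind, if_neg h6, e4]
  | loop p ih =>
    intro x t y t' h
    obtain ⟨h1, h2⟩ := ClockMono.loop ih _ _ _ _ _ h
    exact ⟨h1, fun s => h2 s _ (by omega)⟩
  | rand k =>
    intro x t y t' h
    obtain ⟨h1, h2⟩ := Tree.tick_eq_ret h
    simp at h2
  | query =>
    intro x t y t' h
    obtain ⟨h1, h2⟩ := Tree.tick_eq_ret h
    simp at h2

/-! ### Deterministic runs with a cost bound -/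

/-- On input `x` the program `p` halts with output `y` at a cost of at most `c`. -/
def Runs (p : Prog) (x y : Data) (c : ℕ) : Prop :=
  ∀ t, c ≤ t → ∃ t', p.tree x t = .ret y t' ∧ t ≤ t' + c

/-- By `ClockMono` extra time is returned unused, so success with one limit gives the same cost for
all larger limits. -/
theorem runs_of_evalDet {p : Prog} {x y : Data} {t t' : ℕ}
    (h : p.evalDet x t = some (y, t')) : Runs p x y t := by
  intro s hs
  have h1 := ((p.clockMono _ _ _ _ (Prog.tree_of_evalDet h)).2 (s - t))
  rw [show t + (s - t) = s by omega] at h1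
  exact ⟨_, h1, by omega⟩

theorem Runs.evalDet {p : Prog} {x y : Data} {c t : ℕ} (h : Runs p x y c) (ht : c ≤ t) :
    ∃ t', p.evalDet x t = some (y, t') := by
  obtain ⟨t', h1, -⟩ := h t ht
  exact ⟨t', Prog.evalDet_of_tree h1⟩

theorem Runs.mono {p : Prog} {x y : Data} {c c' : ℕ} (h : Runs p x y c) (hc : c ≤ c') :
    Runs p x y c' := fun t ht => by
  obtain ⟨t', h1, h2⟩ := h t (hc.trans ht)
  exact ⟨t', h1, by omega⟩

/-- `ClockMono` also pays for the size of the output. Time bounds thus bound sizes, and polynomial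
time is closed under composition. -/
theorem Runs.size_le {p : Prog} {x y : Data} {c : ℕ} (h : Runs p x y c) : y.size ≤ c := by
  obtain ⟨t', h1, -⟩ := h c le_rfl
  have := (p.clockMono _ _ _ _ h1).1
  omega

theorem Runs.id (x : Data) : Runs .id x x x.size := fun t ht =>
  ⟨t - x.size, Tree.tick_of_le ht, by omega⟩

theorem Runs.nil (x : Data) : Runs .nil x .nil x.size := fun t ht =>
  ⟨t - x.size, Tree.tick_of_le ht, by omega⟩

theorem Runs.fst (x : Data) : Runs .fst x x.fst x.size := fun t ht =>
  ⟨t - x.size, Tree.tick_of_le ht, by omega⟩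

theorem Runs.snd (x : Data) : Runs .snd x x.snd x.size := fun t ht =>
  ⟨t - x.size, Tree.tick_of_le ht, by omega⟩

theorem Runs.comp {p q : Prog} {x y z : Data} {c d : ℕ} (hq : Runs q x y c) (hp : Runs p y z d) :
    Runs (.comp p q) x z (x.size + c + d) := fun t ht => by
  obtain ⟨t1, h1, h2⟩ := hq (t - x.size) (by omega)
  obtain ⟨t2, h3, h4⟩ := hp t1 (by omega)
  refine ⟨t2, ?_, by omega⟩
  rw [Prog.tree, Tree.tick_of_le (by omega), h1, Tree.bind, h3]

theorem Runs.pair {p q : Prog} {x y z : Data} {c d : ℕ} (hp : Runs p x y c) (hq : Runs q x z d) :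
    Runs (.pair p q) x (.cons y z) (x.size + c + d) := fun t ht => by
  obtain ⟨t1, h1, h2⟩ := hp (t - x.size) (by omega)
  obtain ⟨t2, h3, h4⟩ := hq t1 (by omega)
  refine ⟨t2, ?_, by omega⟩
  rw [Prog.tree, Tree.tick_of_le (by omega), h1, Tree.bind, h3, Tree.bind]

theorem Runs.cond_pos {b p q : Prog} {x y z : Data} {c d : ℕ} (hb : Runs b x y c)
    (hy : y.isNil = false) (hp : Runs p x z d) :
    Runs (.cond b p q) x z (x.size + c + d) := fun t ht => by
  obtain ⟨t1, h1, h2⟩ := hb (t - x.size) (by omega)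
  obtain ⟨t2, h3, h4⟩ := hp t1 (by omega)
  refine ⟨t2, ?_, by omega⟩
  rw [Prog.tree, Tree.tick_of_le (by omega), h1, Tree.bind, if_neg (by simp [hy]), h3]

theorem Runs.cond_neg {b p q : Prog} {x y z : Data} {c d : ℕ} (hb : Runs b x y c)
    (hy : y.isNil = true) (hq : Runs q x z d) :
    Runs (.cond b p q) x z (x.size + c + d) := fun t ht => by
  obtain ⟨t1, h1, h2⟩ := hb (t - x.size) (by omega)
  obtain ⟨t2, h3, h4⟩ := hq t1 (by omega)
  refine ⟨t2, ?_, by omega⟩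
  rw [Prog.tree, Tree.tick_of_le (by omega), h1, Tree.bind, if_pos hy, h3]

/-- Induction on the number `i` of rounds to go; in each round `B` pays for the loop test and `c`
for the body. -/
theorem tree_loop_ret {p : Prog} {N : ℕ} {s : ℕ → Data} {B c : ℕ}
    (hs : ∀ j ≤ N, (s j).size ≤ B) (hpos : ∀ j < N, (s j).fst.isNil = false)
    (hend : (s N).fst.isNil = true) (hp : ∀ j < N, Runs p (s j) (s (j + 1)) c) :
    ∀ i j, i + j = N → ∀ F t, i + 1 ≤ F → (i + 1) * (B + c) ≤ t →
      ∃ t', Tree.loop p.tree F (s j) t = .ret (s N) t' ∧ t ≤ t' + (i + 1) * (B + c) := by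
  intro i
  induction i with
  | zero =>
    intro j hj F t hF ht
    obtain rfl : j = N := by omega
    obtain ⟨F, rfl⟩ : ∃ K, F = K + 1 := ⟨F - 1, by omega⟩
    have := hs j le_rfl
    rw [Tree.loop, Tree.tick_of_le (by omega), if_pos hend]
    exact ⟨_, rfl, by omega⟩
  | succ i ih =>
    intro j hj F t hF ht
    obtain ⟨F, rfl⟩ : ∃ K, F = K + 1 := ⟨F - 1, by omega⟩
    have h0 := hs j (by omega)
    have e : (i + 1 + 1) * (B + c) = (i + 1) * (B + c) + (B + c) := by ring
    rw [e] at ht ⊢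
    obtain ⟨t1, h1, h2⟩ := hp j (by omega) (t - (s j).size) (by omega)
    obtain ⟨t2, h3, h4⟩ := ih (j + 1) (by omega) F t1 (by omega) (by omega)
    refine ⟨t2, ?_, by omega⟩
    rw [Tree.loop, Tree.tick_of_le (by omega), if_neg (by simp [hpos j (by omega)]), h1,
      Tree.bind, h3]

theorem Runs.loop {p : Prog} {N : ℕ} {s : ℕ → Data} {B c : ℕ}
    (hs : ∀ j ≤ N, (s j).size ≤ B) (hpos : ∀ j < N, (s j).fst.isNil = false)
    (hend : (s N).fst.isNil = true) (hp : ∀ j < N, Runs p (s j) (s (j + 1)) c) :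
    Runs (.loop p) (s 0) (s N) ((N + 1) * (B + c)) := fun t ht => by
  have hB : 0 < B := lt_of_lt_of_le (Data.size_pos _) (hs 0 (by omega))
  -- Every round costs at least one unit because `B` is positive, so the `t + 1` rounds that the
  -- clock allows suffice.
  refine tree_loop_ret hs hpos hend hp N 0 (by omega) (t + 1) t ?_ ht
  have : (N + 1) * 1 ≤ (N + 1) * (B + c) := Nat.mul_le_mul_left _ (by omega)
  omega

end PayloadCode

namespace PayloadCode

/-! ## Polynomially bounded functions -/

/-- `g` is bounded by a polynomial in `s`. -/
def PolyBdd {ι : Type*} (s g : ι → ℕ) : Prop := ∃ q : Polynomial ℕ, ∀ i, g i ≤ q.eval (s i)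

/-- The coefficients are natural numbers. -/
theorem eval_mono (q : Polynomial ℕ) {a b : ℕ} (h : a ≤ b) : q.eval a ≤ q.eval b := by
  simp only [Polynomial.eval_eq_sum, Polynomial.sum]
  gcongr

namespace PolyBdd

variable {ι κ : Type*} {s g h : ι → ℕ}

theorem self (s : ι → ℕ) : PolyBdd s s := ⟨.X, fun i => by simp⟩

theorem const (c : ℕ) : PolyBdd s fun _ => c := ⟨.C c, fun i => by simp⟩

theorem of_le (hg : PolyBdd s g) (hh : ∀ i, h i ≤ g i) : PolyBdd s h :=
  let ⟨q, hq⟩ := hg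
  ⟨q, fun i => (hh i).trans (hq i)⟩

theorem add (hg : PolyBdd s g) (hh : PolyBdd s h) : PolyBdd s fun i => g i + h i :=
  let ⟨q, hq⟩ := hg
  let ⟨r, hr⟩ := hh
  ⟨q + r, fun i => by simpa using add_le_add (hq i) (hr i)⟩

theorem mul (hg : PolyBdd s g) (hh : PolyBdd s h) : PolyBdd s fun i => g i * h i :=
  let ⟨q, hq⟩ := hg
  let ⟨r, hr⟩ := hh
  ⟨q * r, fun i => by simpa using Nat.mul_le_mul (hq i) (hr i)⟩

theorem eval (q : Polynomial ℕ) (hg : PolyBdd s g) : PolyBdd s fun i => q.eval (g i) :=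
  let ⟨r, hr⟩ := hg
  ⟨q.comp r, fun i => by simpa using eval_mono q (hr i)⟩

theorem trans (hg : PolyBdd s g) (hh : PolyBdd g h) : PolyBdd s h :=
  let ⟨_, hr⟩ := hh
  (eval _ hg).of_le hr

theorem reindex (hg : PolyBdd s g) (u : κ → ι) : PolyBdd (s ∘ u) (g ∘ u) :=
  let ⟨q, hq⟩ := hg
  ⟨q, fun i => hq (u i)⟩

end PolyBdd

/-! ## Polynomial-time computability of families of trees -/

/-- From `e i` one program computes `f i` in time polynomial in the size of `e i`. -/
def PTF {ι : Type*} (e f : ι → Data) : Prop :=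
  ∃ (p : Prog) (c : ι → ℕ), PolyBdd (fun i => (e i).size) c ∧ ∀ i, Runs p (e i) (f i) (c i)

namespace PTF

variable {ι κ : Type*} {e f g : ι → Data}

theorem size_polyBdd (h : PTF e f) : PolyBdd (fun i => (e i).size) fun i => (f i).size :=
  let ⟨_, _, hc, hr⟩ := h
  hc.of_le fun i => (hr i).size_le

theorem refl (e : ι → Data) : PTF e e :=
  ⟨.id, _, .self _, fun _ => .id _⟩

theorem comp (h : PTF e f) (h' : PTF f g) : PTF e g := by
  have hs := h.size_polyBdd
  obtain ⟨p, c, hc, hp⟩ := h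
  obtain ⟨p', c', hc', hp'⟩ := h'
  exact ⟨.comp p' p, _, ((PolyBdd.self _).add hc).add (hs.trans hc'),
    fun i => (hp i).comp (hp' i)⟩

theorem reindex (h : PTF e f) (u : κ → ι) : PTF (fun k => e (u k)) fun k => f (u k) :=
  let ⟨p, _, hc, hr⟩ := h
  ⟨p, _, hc.reindex u, fun k => hr (u k)⟩

theorem congr {e' f' : ι → Data} (h : PTF e f) (he : ∀ i, e i = e' i) (hf : ∀ i, f i = f' i) :
    PTF e' f' := by
  obtain rfl : e = e' := funext he
  obtain rfl : f = f' := funext hf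
  exact h

/-- Call of a subroutine. -/
theorem call {e' f' : κ → Data} (h' : PTF e' f') (u : ι → κ)
    (h : PTF e fun i => e' (u i)) : PTF e fun i => f' (u i) :=
  h.comp (h'.reindex u)

theorem nil : PTF e fun _ => Data.nil := ⟨.nil, _, .self _, fun _ => .nil _⟩

theorem fst (h : PTF e f) : PTF e fun i => (f i).fst :=
  h.comp ⟨.fst, _, .self _, fun _ => .fst _⟩

theorem snd (h : PTF e f) : PTF e fun i => (f i).snd :=
  h.comp ⟨.snd, _, .self _, fun _ => .snd _⟩

theorem pair (h : PTF e f) (h' : PTF e g) : PTF e fun i => .cons (f i) (g i) :=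
  let ⟨p, _, hc, hp⟩ := h
  let ⟨p', _, hc', hp'⟩ := h'
  ⟨.pair p p', _, ((PolyBdd.self _).add hc).add hc', fun i => (hp i).pair (hp' i)⟩

theorem const (d : Data) : PTF e fun _ => d := by
  induction d with
  | nil => exact nil
  | cons a b iha ihb => exact iha.pair ihb

/-- Encoding of truth values. -/
def _root_.PayloadCode.Data.ofBool (b : Bool) : Data := cond b (Data.num 1) Data.nil

/-- Each branch has to be computable only on the inputs that reach it; the subtypes make this
available to `ofFinset`, where the membership of the input shrinks along the branches. -/
theorem ite {c : ι → Data} (hc : PTF e c)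
    (hf : PTF (fun i : {i // (c i).isNil = false} => e i) fun i => f i)
    (hg : PTF (fun i : {i // (c i).isNil = true} => e i) fun i => g i) :
    PTF e fun i => if (c i).isNil then g i else f i := by
  classical
  obtain ⟨p, a, ha, hp⟩ := hc
  obtain ⟨p1, a1, ⟨q1, ha1⟩, hp1⟩ := hf
  obtain ⟨p2, a2, ⟨q2, ha2⟩, hp2⟩ := hg
  refine ⟨.cond p p1 p2, _, ((PolyBdd.self _).add ha).add
    (((PolyBdd.self _).eval q1).add ((PolyBdd.self _).eval q2)), fun i => ?_⟩
  dsimp only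
  cases h : (c i).isNil with
  | true =>
    rw [if_pos rfl]
    refine (Runs.cond_neg (hp i) h (hp2 ⟨i, h⟩)).mono ?_
    have := ha2 ⟨i, h⟩
    dsimp only at this
    omega
  | false =>
    rw [if_neg (by simp)]
    refine (Runs.cond_pos (hp i) h (hp1 ⟨i, h⟩)).mono ?_
    have := ha1 ⟨i, h⟩
    dsimp only at this
    omega

theorem bite {b : ι → Bool} (hb : PTF e fun i => Data.ofBool (b i))
    (hf : PTF (fun i : {i // b i = true} => e i) fun i => f i)
    (hg : PTF (fun i : {i // b i = false} => e i) fun i => g i) :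
    PTF e fun i => if b i then f i else g i := by
  have h1 : ∀ i, (Data.ofBool (b i)).isNil = !(b i) := fun i => by
    cases b i <;> rfl
  refine (ite hb (f := f) (g := g) ?_ ?_).congr (fun _ => rfl) fun i => ?_
  · exact hf.reindex (fun i : {i // (Data.ofBool (b i)).isNil = false} =>
      ⟨i.1, by simpa [h1] using i.2⟩)
  · exact hg.reindex (fun i : {i // (Data.ofBool (b i)).isNil = true} =>
      ⟨i.1, by simpa [h1] using i.2⟩)
  · rw [h1]; cases b i <;> rfl

theorem isNil (h : PTF e f) : PTF e fun i => Data.ofBool (f i).isNil := by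
  refine (ite (f := fun _ => Data.nil) (g := fun _ => Data.num 1) h
    (const _) (const _)).congr (fun _ => rfl) fun i => ?_
  cases (f i).isNil <;> rfl

theorem band {b c : ι → Bool} (hb : PTF e fun i => Data.ofBool (b i))
    (hc : PTF e fun i => Data.ofBool (c i)) : PTF e fun i => Data.ofBool (b i && c i) := by
  refine (bite (f := fun i => Data.ofBool (c i)) (g := fun _ => Data.nil) hb
    (hc.reindex _) (const _)).congr (fun _ => rfl) fun i => ?_
  cases b i <;> rfl

theorem bnot {b : ι → Bool} (hb : PTF e fun i => Data.ofBool (b i)) :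
    PTF e fun i => Data.ofBool (!b i) := by
  refine (bite (f := fun _ => Data.nil) (g := fun _ => Data.num 1) hb
    (const _) (const _)).congr (fun _ => rfl) fun i => ?_
  cases b i <;> rfl

open Classical in
theorem eqConst (h : PTF e f) (d : Data) : PTF e fun i => Data.ofBool (decide (f i = d)) := by
  induction d generalizing f with
  | nil =>
    refine h.isNil.congr (fun _ => rfl) fun i => ?_
    cases f i <;> simp [Data.isNil]
  | cons a b iha ihb =>
    refine (band h.isNil.bnot (band (iha h.fst) (ihb h.snd))).congr (fun _ => rfl) fun i => ?_
    cases f i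
    · simp [Data.isNil]
    · simp only [Data.isNil, Data.fst, Data.snd, Data.cons.injEq, Bool.decide_and, Bool.not_false,
        Bool.true_and]
      congr!

/-- The code of the input is compared with the codes of the elements one after the other. In the
negative branch the input lies in the smaller set. -/
theorem ofFinset {α : Type*} (s : Finset α) (a d : α → Data) (x : ι → α) (ha : a.Injective)
    (hx : ∀ i, x i ∈ s) (h : PTF e fun i => a (x i)) : PTF e fun i => d (x i) := by
  classical
  induction s using Finset.induction_on generalizing ι with
  | empty => exact nil.congr (fun _ => rfl) fun i => absurd (hx i) (Finset.notMem_empty _)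
  | insert b s hb ih =>
    refine (bite (f := fun _ => d b) (g := fun i => d (x i)) (h.eqConst (a b)) (const _)
      (ih (ι := {i // decide (a (x i) = a b) = false}) (fun i => x i) (fun i => ?_)
        (h.reindex _))).congr (fun _ => rfl) fun i => ?_
    · have h1 := hx i.1
      have h2 := i.2
      simp only [decide_eq_false_iff_not, ha.eq_iff] at h2
      simpa [h2] using h1
    · by_cases h1 : x i = b <;> simp [ha.eq_iff, h1]

/-- Functions of a finite type are computed by a table. -/
theorem table {α : Type*} [Finite α] (a d : α → Data) (ha : a.Injective) (x : ι → α)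
    (h : PTF e fun i => a (x i)) : PTF e fun i => d (x i) :=
  have := Fintype.ofFinite α
  ofFinset Finset.univ a d x ha (fun _ => Finset.mem_univ _) h

end PTF

theorem Data.num_injective : Function.Injective Data.num := by
  intro a b h
  induction a generalizing b with
  | zero => cases b <;> simp_all [Data.num]
  | succ a ih =>
    cases b with
    | zero => simp [Data.num] at h
    | succ b =>
      simp only [Data.num, Data.cons.injEq, true_and] at h
      rw [ih h]

theorem encSym_injective {S : Type} [Fintype S] : Function.Injective (encSym (S := S)) :=
  fun _ _ h => (Fintype.equivFin S).injective (Fin.val_injective (Data.num_injective h))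

theorem PTF.sym {ι : Type*} {e : ι → Data} {S T : Type} [Fintype S] [Fintype T] (φ : S → T)
    {x : ι → S} (h : PTF e fun i => encSym (x i)) : PTF e fun i => encSym (φ (x i)) :=
  PTF.table encSym (fun s => encSym (φ s)) encSym_injective x h

theorem PTF.sym₂ {ι : Type*} {e : ι → Data} {S T U : Type} [Fintype S] [Fintype T] [Fintype U]
    (φ : S → T → U) {x : ι → S} {y : ι → T} (h : PTF e fun i => encSym (x i))
    (h' : PTF e fun i => encSym (y i)) : PTF e fun i => encSym (φ (x i) (y i)) :=
  PTF.table (fun s : S × T => Data.cons (encSym s.1) (encSym s.2))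
    (fun s => encSym (φ s.1 s.2))
    (fun a b h => by
      simp only [Data.cons.injEq] at h
      exact Prod.ext (encSym_injective h.1) (encSym_injective h.2))
    (fun i => (x i, y i)) (h.pair h')

/-! ### Loops -/

/-- A polynomial-time step can square the size each time, so a bound `B` on all intermediate states,
polynomial in the first one, is required. -/
theorem PTF.iterate {ι : Type*} {st : ι → ℕ → Data} {N : ι → ℕ}
    (hpos : ∀ i, ∀ j < N i, (st i j).fst.isNil = false)
    (hend : ∀ i, (st i (N i)).fst.isNil = true)
    (hN : PolyBdd (fun i => (st i 0).size) N)
    {B : ι → ℕ} (hB : PolyBdd (fun i => (st i 0).size) B)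
    (hsize : ∀ i, ∀ j ≤ N i, (st i j).size ≤ B i)
    (hstep : PTF (fun k : (i : ι) × Fin (N i) => st k.1 k.2) fun k => st k.1 (k.2 + 1)) :
    PTF (fun i => st i 0) fun i => st i (N i) := by
  obtain ⟨p, c, ⟨q, hc⟩, hp⟩ := hstep
  refine ⟨.loop p, _, (hN.add (.const 1)).mul (hB.add (hB.eval q)), fun i => ?_⟩
  refine Runs.loop (hsize i) (hpos i) (hend i) fun j hj => (hp ⟨i, j, hj⟩).mono ?_
  exact (hc ⟨i, j, hj⟩).trans (eval_mono q (hsize i j hj.le))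

/-! ### Lists -/

namespace Data

def listSize (l : List Data) : ℕ := (l.map fun d => 1 + d.size).sum

theorem size_ofList (l : List Data) : (ofList l).size = 1 + listSize l := by
  induction l with
  | nil => rfl
  | cons a l ih => simp [ofList, size, ih, listSize]; omega

theorem listSize_append (l l' : List Data) : listSize (l ++ l') = listSize l + listSize l' := by
  simp [listSize]

theorem listSize_reverse (l : List Data) : listSize l.reverse = listSize l := by
  simp [listSize, List.sum_reverse]

theorem listSize_sublist {l l' : List Data} (h : l.Sublist l') : listSize l ≤ listSize l' :=
  (h.map _).sum_le_sum (fun _ _ => Nat.zero_le _)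

theorem length_le_listSize (l : List Data) : 2 * l.length ≤ listSize l := by
  induction l with
  | nil => simp [listSize]
  | cons a l ih =>
    have := a.size_pos
    simp only [listSize, List.map_cons, List.sum_cons, List.length_cons] at ih ⊢
    omega

theorem listSize_le (l : List Data) (B : ℕ) (h : ∀ d ∈ l, d.size ≤ B) :
    listSize l ≤ l.length * (1 + B) := by
  induction l with
  | nil => simp [listSize]
  | cons a l ih =>
    have h1 := h a (by simp)
    have h2 := ih fun d hd => h d (by simp [hd])
    simp only [listSize, List.map_cons, List.sum_cons, List.length_cons] at h2 ⊢
    rw [Nat.add_mul]; omega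

theorem size_le_of_mem {l : List Data} {d : Data} (h : d ∈ l) : d.size ≤ listSize l := by
  induction l with
  | nil => simp at h
  | cons a l ih =>
    simp only [listSize, List.map_cons, List.sum_cons] at ih ⊢
    rcases List.mem_cons.1 h with rfl | h
    · omega
    · have := ih h; omega

theorem num_eq_ofList (n : ℕ) : num n = ofList (List.replicate n nil) := by
  induction n with
  | zero => rfl
  | succ n ih => simp [num, List.replicate_succ, ofList, ih]

theorem size_num (n : ℕ) : (num n).size = 2 * n + 1 := by
  induction n with
  | zero => rfl
  | succ n ih => simp only [num, size, ih]; omega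

theorem isNil_ofList (l : List Data) : (ofList l).isNil = l.isEmpty := by
  cases l <;> rfl

end Data

open Data in
-- Two stacks; the loop tests its left subtree, so the part still to be read stands there.
theorem PTF.reverse {ι : Type*} {e : ι → Data} {l : ι → List Data}
    (h : PTF e fun i => ofList (l i)) : PTF e fun i => ofList (l i).reverse := by
  have key : PTF (fun i => Data.cons (ofList (l i)) Data.nil)
      fun i => Data.cons (ofList []) (ofList (l i).reverse) := by
    refine (PTF.iterate (st := fun i j => .cons (ofList ((l i).drop j))
      (ofList ((l i).take j).reverse)) (N := fun i => (l i).length) ?_ ?_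
      (B := fun i => (Data.cons (ofList (l i)) Data.nil).size) ?_ ?_ ?_ ?_).congr ?_ ?_
    · intro i j hj
      simp [Data.fst, isNil_ofList, hj]
    · intro i
      simp [Data.fst, isNil_ofList]
    · refine (PolyBdd.self _).of_le fun i => ?_
      have := length_le_listSize (l i)
      simp only [List.drop_zero, size, size_ofList]; omega
    · refine (PolyBdd.self _).of_le fun i => ?_
      simp [size, ofList]
    · intro i j hj
      have : listSize (l i) = listSize ((l i).take j) + listSize ((l i).drop j) := by
        rw [← listSize_append, List.take_append_drop]
      simp only [size, size_ofList, listSize_reverse]; omega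
    · refine (PTF.pair (PTF.refl _).fst.snd ((PTF.refl _).fst.fst.pair (PTF.refl _).snd)).congr
        (fun _ => rfl) fun k => ?_
      obtain ⟨i, j, hj⟩ := k
      simp only [Data.fst, Data.snd]
      rw [List.drop_eq_getElem_cons hj, ← List.take_concat_get' _ _ hj, List.reverse_append]
      simp only [ofList, List.reverse_singleton, List.singleton_append]
    · intro i; simp [ofList]
    · intro i; simp
  exact (h.pair (PTF.const .nil)).comp key |>.snd

/-- The list of the values `f b l'` for the splittings `l = l₁ ++ b :: l'`. -/
def suffixMap {β γ : Type*} (f : β → List β → γ) : List β → List γ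
  | [] => []
  | b :: l => f b l :: suffixMap f l

theorem suffixMap_length {β γ : Type*} (f : β → List β → γ) (l : List β) :
    (suffixMap f l).length = l.length := by
  induction l with
  | nil => rfl
  | cons b l ih => simp [suffixMap, ih]

theorem suffixMap_drop {β γ : Type*} (f : β → List β → γ) (l : List β) (j : ℕ) :
    (suffixMap f l).drop j = suffixMap f (l.drop j) := by
  induction l generalizing j with
  | nil => simp [suffixMap]
  | cons b l ih => cases j <;> simp [suffixMap, ih]

theorem suffixMap_const {β γ : Type*} (f : β → γ) (l : List β) :
    suffixMap (fun b _ => f b) l = l.map f := by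
  induction l with
  | nil => rfl
  | cons b l ih => simp [suffixMap, ih]

open Data in
/-- Fold over a list from the right; the accumulator and the list elements are encoded in a way
that may depend on the part of the list that has been processed. -/
theorem PTF.foldr {ι : Type*} {β : Type*} {e : ι → Data} {l : ι → List β}
    (eb : ι → β → List β → Data) (acc : ι → List β → Data)
    (hl : PTF e fun i => ofList (suffixMap (eb i) (l i)))
    (h0 : PTF e fun i => acc i [])
    (hstep : PTF (fun k : {k : ι × β × List β // k.2.1 :: k.2.2 <:+ l k.1} =>
        Data.cons (eb k.1.1 k.1.2.1 k.1.2.2) (.cons (acc k.1.1 k.1.2.2) (e k.1.1)))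
      fun k => acc k.1.1 (k.1.2.1 :: k.1.2.2))
    {B : ι → ℕ} (hB : PolyBdd (fun i => (e i).size) B)
    (hsize : ∀ i l', l' <:+ l i → (acc i l').size ≤ B i) :
    PTF e fun i => acc i (l i) := by
  -- The loop reads lists from the front and a right fold starts at the end, hence the reversal. The
  -- state holds the rest of `L`, the accumulator for the suffix already processed, and a copy of
  -- the input `e i` for the step.
  set L : ι → List Data := fun i => (suffixMap (eb i) (l i)).reverse with hL
  have hLlen : ∀ i, (L i).length = (l i).length := fun i => by simp [hL, suffixMap_length]
  set st : ι → ℕ → Data := fun i j => .cons (ofList ((L i).drop j))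
    (.cons (acc i ((l i).drop ((l i).length - j))) (e i)) with hst
  have hst0 : PTF e fun i => st i 0 := by
    refine ((PTF.reverse hl).pair (h0.pair (PTF.refl _))).congr (fun _ => rfl) fun i => ?_
    simp [hst, hL]
  have hLs : PolyBdd (fun i => (e i).size) fun i => (ofList (L i)).size :=
    (PTF.reverse hl).size_polyBdd
  have he0 : ∀ i, (e i).size ≤ (st i 0).size := fun i => by
    simp only [hst, size]; omega
  have hb0 : PolyBdd (fun i => (st i 0).size) fun i => (e i).size :=
    (PolyBdd.self _).of_le he0
  have key : PTF (fun i => st i 0) fun i => st i (l i).length := by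
    refine PTF.iterate (N := fun i => (l i).length) (st := st) ?_ ?_ ?_
      (B := fun i => (1 + (ofList (L i)).size) + (1 + B i + (e i).size)) ?_ ?_ ?_
    · intro i j hj
      simp [hst, Data.fst, isNil_ofList, hLlen, hj]
    · intro i
      simp [hst, Data.fst, isNil_ofList, hLlen]
    · refine hb0.trans (hLs.of_le fun i => ?_)
      have := length_le_listSize (L i)
      rw [← hLlen, size_ofList]; omega
    · exact hb0.trans (((PolyBdd.const 1).add hLs).add
        (((PolyBdd.const 1).add hB).add (PolyBdd.self _)))
    · intro i j hj
      have h1 := hsize i ((l i).drop ((l i).length - j)) (List.drop_suffix _ _)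
      have h2 := listSize_sublist (List.drop_sublist j (L i))
      simp only [hst, size, size_ofList]; omega
    · have hu : ∀ k : (i : ι) × Fin (l i).length, ∃ b l', b :: l' <:+ l k.1 ∧
          (l k.1).drop ((l k.1).length - k.2) = l' ∧
          (l k.1).drop ((l k.1).length - (k.2 + 1)) = b :: l' ∧
          (L k.1).drop k.2 = eb k.1 b l' :: (L k.1).drop (k.2 + 1) := by
        rintro ⟨i, j, hj⟩
        dsimp only
        have h1 : (l i).length - (j + 1) < (l i).length := by omega
        have h2 := List.drop_eq_getElem_cons h1
        rw [show (l i).length - (j + 1) + 1 = (l i).length - j by omega] at h2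
        refine ⟨_, _, ?_, rfl, h2, ?_⟩
        · rw [← h2]; exact List.drop_suffix _ _
        · rw [List.drop_eq_getElem_cons (by rw [hLlen]; exact hj)]
          congr 1
          have h3 := congrArg List.head? (suffixMap_drop (eb i) (l i) ((l i).length - (j + 1)))
          rw [h2, suffixMap, List.head?_cons, List.head?_drop,
            List.getElem?_eq_getElem (by rw [suffixMap_length]; omega)] at h3
          simp only [hL, List.getElem_reverse, suffixMap_length]
          simp only [Option.some.injEq] at h3
          rw [← h3]
          congr 1; omega
      choose b l' h1 h2 h3 h4 using hu
      have hin : PTF (fun k : (i : ι) × Fin (l i).length => st k.1 k.2) fun k =>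
          Data.cons (eb k.1 (b k) (l' k)) (.cons (acc k.1 (l' k)) (e k.1)) := by
        refine ((PTF.refl _).fst.fst.pair (PTF.refl _).snd).congr (fun _ => rfl) fun k => ?_
        simp only [hst, Data.fst, Data.snd, h2, h4, ofList]
      have hnew := PTF.call hstep
        (fun k : (i : ι) × Fin (l i).length => ⟨(k.1, b k, l' k), h1 k⟩) hin
      refine ((PTF.refl _).fst.snd.pair (hnew.pair (PTF.refl _).snd.snd)).congr
        (fun _ => rfl) fun k => ?_
      simp only [hst, Data.fst, Data.snd, h3, h4, ofList]
  refine ((hst0.comp key).snd.fst).congr (fun _ => rfl) fun i => ?_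
  simp [hst, Data.snd, Data.fst]

end PayloadCode

namespace PayloadCode

open Data

/-! ### Operations on lists, words and numerals -/

namespace PTF

variable {ι : Type*} {e : ι → Data}

theorem map {β : Type*} {l : ι → List β} (eb eo : ι → β → Data)
    (hl : PTF e fun i => ofList ((l i).map (eb i)))
    (hf : PTF (fun k : {k : ι × β // k.2 ∈ l k.1} => Data.cons (eb k.1.1 k.1.2) (e k.1.1))
      fun k => eo k.1.1 k.1.2) :
    PTF e fun i => ofList ((l i).map (eo i)) := by
  obtain ⟨q, hq⟩ := hf.size_polyBdd
  have hls := hl.size_polyBdd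
  refine PTF.foldr (l := l) (fun i b _ => eb i b) (fun i l' => ofList (l'.map (eo i))) ?_
    (const _) ?_ (B := fun i => 1 + (ofList ((l i).map (eb i))).size * (1 + q.eval
      (1 + (ofList ((l i).map (eb i))).size + (e i).size))) ?_ ?_
  · simpa only [suffixMap_const] using hl
  · have h1 := PTF.call hf (fun k : {k : ι × β × List β // k.2.1 :: k.2.2 <:+ l k.1} =>
      ⟨(k.1.1, k.1.2.1), k.2.subset (by simp)⟩)
      (e := fun k => Data.cons (eb k.1.1 k.1.2.1)
        (.cons (ofList (k.1.2.2.map (eo k.1.1))) (e k.1.1)))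
      ((refl _).fst.pair (refl _).snd.snd)
    exact h1.pair (refl _).snd.fst
  · exact (PolyBdd.const 1).add (hls.mul ((PolyBdd.const 1).add
      ((((PolyBdd.const 1).add hls).add (PolyBdd.self _)).eval q)))
  · intro i l' hl'
    rw [size_ofList]
    refine Nat.add_le_add_left ((listSize_le _ (q.eval
      (1 + (ofList ((l i).map (eb i))).size + (e i).size)) ?_).trans ?_) _
    · intro d hd
      obtain ⟨b, hb, rfl⟩ := List.mem_map.1 hd
      have hb' := hl'.subset hb
      refine (hq ⟨(i, b), hb'⟩).trans (eval_mono q ?_)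
      have := size_le_of_mem (List.mem_map_of_mem (f := eb i) hb')
      simp only [size, size_ofList]; omega
    · refine Nat.mul_le_mul_right _ ?_
      have := length_le_listSize ((l i).map (eb i))
      have h2 := hl'.length_le
      simp only [List.length_map] at this ⊢
      rw [size_ofList]; omega

theorem append {l l' : ι → List Data} (h : PTF e fun i => ofList (l i))
    (h' : PTF e fun i => ofList (l' i)) : PTF e fun i => ofList (l i ++ l' i) := by
  refine PTF.foldr (l := l) (fun i b _ => b) (fun i s => ofList (s ++ l' i)) ?_
    (by simpa using h') ?_ (B := fun i => (ofList (l i)).size + (ofList (l' i)).size)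
    (h.size_polyBdd.add h'.size_polyBdd) ?_
  · simpa only [suffixMap_const, List.map_id'] using h
  · exact (refl _).fst.pair (refl _).snd.fst
  · intro i s hs
    have := listSize_sublist hs.sublist
    simp only [size_ofList, listSize_append]; omega

theorem length {l : ι → List Data} (h : PTF e fun i => ofList (l i)) :
    PTF e fun i => num (l i).length := by
  refine (map (l := l) (fun i b => b) (fun _ _ => Data.nil) (by simpa using h)
    (const _)).congr (fun _ => rfl) fun i => ?_
  simp [num_eq_ofList]

theorem replicate {n : ι → ℕ} (h : PTF e fun i => num (n i)) (d : Data) :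
    PTF e fun i => ofList (List.replicate (n i) d) := by
  simp only [num_eq_ofList] at h
  refine (map (l := fun i => List.replicate (n i) Data.nil) (fun i b => b) (fun _ _ => d)
    (by simpa using h) (const _)).congr (fun _ => rfl) fun i => ?_
  simp

theorem zip {l l' : ι → List Data} (h : PTF e fun i => ofList (l i))
    (h' : PTF e fun i => ofList (l' i)) (hle : ∀ i, (l i).length ≤ (l' i).length) :
    PTF e fun i => ofList (List.zipWith Data.cons (l i) (l' i)) := by
  set z := fun i => List.zipWith Data.cons (l i) (l' i) with hz
  have hzlen : ∀ i, (z i).length = (l i).length := fun i => by simp [hz, hle i]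
  have hzsize : ∀ i, listSize (z i) ≤ listSize (l i) + listSize (l' i) := by
    intro i
    simp only [hz]
    generalize l i = a
    generalize l' i = b
    induction a generalizing b with
    | nil => simp [listSize]
    | cons x a ih =>
      cases b with
      | nil => simp [listSize]
      | cons y b =>
        have := ih b
        simp only [listSize, List.zipWith_cons_cons, List.map_cons, List.sum_cons, size] at this ⊢
        omega
  have key : PTF (fun i => Data.cons (ofList (l i)) (.cons (ofList (l' i)) Data.nil))
      fun i => Data.cons (ofList ((l i).drop (l i).length))
        (.cons (ofList ((l' i).drop (l i).length)) (ofList ((z i).take (l i).length).reverse)) := by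
    refine (PTF.iterate (st := fun i j => .cons (ofList ((l i).drop j))
      (.cons (ofList ((l' i).drop j)) (ofList ((z i).take j).reverse)))
      (N := fun i => (l i).length) ?_ ?_ ?_
      (B := fun i => 2 * (Data.cons (ofList (l i)) (.cons (ofList (l' i)) Data.nil)).size)
      ?_ ?_ ?_).congr ?_ fun i => rfl
    · intro i j hj
      simp [Data.fst, isNil_ofList, hj]
    · intro i
      simp [Data.fst, isNil_ofList]
    · refine (PolyBdd.self _).of_le fun i => ?_
      have := length_le_listSize (l i)
      simp only [List.drop_zero, size, size_ofList]; omega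
    · refine (PolyBdd.const 2).mul ((PolyBdd.self _).of_le fun i => ?_)
      simp [size, ofList]
    · intro i j hj
      have h1 := hzsize i
      have h2 := listSize_sublist (List.take_sublist j (z i))
      have h3 := listSize_sublist (List.drop_sublist j (l i))
      have h4 := listSize_sublist (List.drop_sublist j (l' i))
      simp only [size, size_ofList, listSize_reverse]; omega
    · refine (PTF.pair (PTF.refl _).fst.snd ((PTF.refl _).snd.fst.snd.pair
        (((PTF.refl _).fst.fst.pair (PTF.refl _).snd.fst.fst).pair (PTF.refl _).snd.snd))).congr
        (fun _ => rfl) fun k => ?_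
      obtain ⟨i, j, hj⟩ := k
      have hj' : j < (l' i).length := hj.trans_le (hle i)
      have hj2 : j < (z i).length := by rw [hzlen]; exact hj
      simp only [Data.fst, Data.snd]
      rw [List.drop_eq_getElem_cons hj, List.drop_eq_getElem_cons hj',
        ← List.take_concat_get' _ _ hj2, List.reverse_append]
      simp only [ofList, List.reverse_singleton, List.singleton_append]
      simp [hz]
    · intro i; simp [ofList]
  have h2 := reverse ((h.pair (h'.pair (const .nil))).comp key).snd.snd
  refine h2.congr (fun _ => rfl) fun i => ?_
  rw [← hzlen, List.reverse_reverse, List.take_length]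

theorem drop {n : ι → ℕ} {l : ι → List Data} (hn : PTF e fun i => num (n i))
    (h : PTF e fun i => ofList (l i)) : PTF e fun i => ofList ((l i).drop (n i)) := by
  refine (PTF.foldr (l := fun i => List.replicate (n i) ()) (fun i b _ => .nil)
    (fun i s => ofList ((l i).drop s.length)) ?_
    (by simpa using h) ?_ (B := fun i => (ofList (l i)).size) h.size_polyBdd ?_).congr
    (fun _ => rfl) fun i => ?_
  · simpa only [suffixMap_const, List.map_replicate, num_eq_ofList] using hn
  · refine (refl _).snd.fst.snd.congr (fun _ => rfl) fun k => ?_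
    simp only [Data.snd, Data.fst, List.length_cons]
    rw [← List.drop_drop]
    -- The tail of an empty list is empty, in agreement with `Data.snd Data.nil = Data.nil`.
    cases (l k.1.1).drop k.1.2.2.length <;> rfl
  · intro i s hs
    have := listSize_sublist (List.drop_sublist s.length (l i))
    simp only [size_ofList]; omega
  · simp

theorem take {n : ι → ℕ} {l : ι → List Data} (hn : PTF e fun i => num (n i))
    (h : PTF e fun i => ofList (l i)) (hle : ∀ i, n i ≤ (l i).length) :
    PTF e fun i => ofList ((l i).take (n i)) := by
  simp only [num_eq_ofList] at hn
  have h1 := zip hn h (by simpa using hle)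
  refine (map (l := fun i => List.zipWith Data.cons (List.replicate (n i) .nil) (l i))
    (fun i b => b) (fun _ d => d.snd) (by simpa using h1)
    (refl _).fst.snd).congr (fun _ => rfl) fun i => ?_
  congr 1
  refine List.ext_getElem (by simp) fun j h1 h2 => ?_
  simp [Data.snd]

theorem num_add {a b : ι → ℕ} (ha : PTF e fun i => num (a i)) (hb : PTF e fun i => num (b i)) :
    PTF e fun i => num (a i + b i) := by
  simp only [num_eq_ofList] at ha hb ⊢
  simpa only [List.replicate_append_replicate] using ha.append hb

theorem num_mul {a b : ι → ℕ} (ha : PTF e fun i => num (a i)) (hb : PTF e fun i => num (b i)) :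
    PTF e fun i => num (a i * b i) := by
  refine (PTF.foldr (l := fun i => List.replicate (a i) ()) (fun i b _ => .nil)
    (fun i s => .cons (num (s.length * b i)) (num (b i))) ?_
    ((nil.pair hb).congr (fun _ => rfl) fun i => by simp [num]) ?_
    (B := fun i => 2 * ((num (a i)).size * (num (b i)).size) + 3 + 2 * (num (b i)).size)
    (((PolyBdd.const 2).mul (ha.size_polyBdd.mul hb.size_polyBdd)).add (.const 3) |>.add
      ((PolyBdd.const 2).mul hb.size_polyBdd)) ?_).fst.congr
    (fun _ => rfl) fun i => ?_
  · simpa only [suffixMap_const, List.map_replicate, num_eq_ofList] using ha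
  · refine ((num_add (b := fun k => k.1.2.2.length * b k.1.1) (refl _).snd.fst.snd
      (refl _).snd.fst.fst).pair (refl _).snd.fst.snd).congr (fun _ => rfl) fun k => ?_
    simp only [Data.snd, Data.fst, List.length_cons]
    congr 2; ring
  · intro i s hs
    have h1 := hs.length_le
    simp only [List.length_replicate] at h1
    have h2 := Nat.mul_le_mul_right (b i) h1
    simp only [size, size_num]
    nlinarith
  · simp [Data.fst]

theorem num_eval {a : ι → ℕ} (ha : PTF e fun i => num (a i)) (q : Polynomial ℕ) :
    PTF e fun i => num (q.eval (a i)) := by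
  induction q using Polynomial.induction_on' with
  | add p q hp hq => simpa using hp.num_add hq
  | monomial n c =>
    simp only [Polynomial.eval_monomial]
    refine num_mul (const _) ?_
    induction n with
    | zero => simpa using const _
    | succ n ih => simpa [pow_succ] using num_mul ih ha

/-- Comparison of numerals. -/
theorem num_lt {a b : ι → ℕ} (ha : PTF e fun i => num (a i)) (hb : PTF e fun i => num (b i)) :
    PTF e fun i => ofBool (decide (a i < b i)) := by
  rw [show (fun i => num (b i)) = fun i => ofList (List.replicate (b i) .nil) from
    funext fun i => num_eq_ofList _] at hb
  refine (ha.drop hb).isNil.bnot.congr (fun _ => rfl) fun i => ?_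
  rw [isNil_ofList]
  congr 1
  rw [Bool.eq_iff_iff]
  simp
  omega

/-- A fold over the units of the numeral, with the half and the parity as accumulator. -/
theorem num_half {a : ι → ℕ} (ha : PTF e fun i => num (a i)) :
    PTF e fun i => num (a i / 2) := by
  refine (PTF.foldr (l := fun i => List.replicate (a i) ()) (fun i b _ => .nil)
    (fun i s => .cons (num (s.length / 2)) (ofBool (decide (s.length % 2 = 1)))) ?_
    (by simpa using const _) ?_
    (B := fun i => (num (a i)).size + 4)
    (ha.size_polyBdd.add (.const 4)) ?_).fst.congr
    (fun _ => rfl) fun i => ?_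
  · simpa only [suffixMap_const, List.map_replicate, num_eq_ofList] using ha
  · have h1 : PTF (fun k : {k : ι × Unit × List Unit //
        k.2.1 :: k.2.2 <:+ List.replicate (a k.1) ()} =>
        Data.cons .nil (.cons (.cons (num (k.1.2.2.length / 2))
          (ofBool (decide (k.1.2.2.length % 2 = 1)))) (e k.1.1)))
        fun k => ofBool (decide (k.1.2.2.length % 2 = 1)) := (refl _).snd.fst.snd
    refine (bite (f := fun k => Data.cons (num (k.1.2.2.length / 2 + 1)) .nil)
      (g := fun k => Data.cons (num (k.1.2.2.length / 2)) (num 1)) h1 ?_ ?_).congr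
      (fun _ => rfl) fun k => ?_
    · exact (PTF.pair nil (refl _).snd.fst.fst).pair (const _)
    · exact ((refl _).snd.fst.fst).pair (const _)
    · obtain ⟨⟨i, _, s⟩, _⟩ := k
      dsimp only
      by_cases h : s.length % 2 = 1
      · have h3 : (s.length + 1) / 2 = s.length / 2 + 1 := by omega
        have h4 : ¬ (s.length + 1) % 2 = 1 := by omega
        simp [h, h3, h4, ofBool]
      · have h3 : (s.length + 1) / 2 = s.length / 2 := by omega
        have h4 : (s.length + 1) % 2 = 1 := by omega
        simp [h, h3, h4, ofBool]
  · intro i s hs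
    have h1 := hs.length_le
    simp only [List.length_replicate] at h1
    have h2 : (ofBool (decide (s.length % 2 = 1))).size ≤ 3 := by
      cases decide (s.length % 2 = 1) <;> simp [ofBool, size, num]
    simp only [size, size_num]
    omega
  · simp [Data.fst]

end PTF

theorem encVec_eq {S : Type} [Fintype S] {n : ℕ} (w : Fin n → S) :
    encVec w = ofList (List.ofFn fun j => encSym (w j)) := by
  simp [encVec, encList, List.map_ofFn, Function.comp_def]

namespace PTF

variable {ι : Type*} {e : ι → Data} {S T U : Type} [Fintype S] [Fintype T] [Fintype U]
  {n : ι → ℕ}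

theorem vecZip {u : ∀ i, Fin (n i) → S} {v : ∀ i, Fin (n i) → T} (hu : PTF e fun i => encVec (u i))
    (hv : PTF e fun i => encVec (v i)) : PTF e fun i => ofList
      ((List.finRange (n i)).map fun j => Data.cons (encSym (u i j)) (encSym (v i j))) := by
  simp only [encVec_eq] at hu hv
  refine (zip hu hv (by simp)).congr (fun _ => rfl) fun i => ?_
  congr 1
  exact List.ext_getElem (by simp) fun j h1 h2 => by simp

theorem vecMap₂ {u : ∀ i, Fin (n i) → S} {v : ∀ i, Fin (n i) → T} (φ : S → T → U)
    (hu : PTF e fun i => encVec (u i)) (hv : PTF e fun i => encVec (v i)) :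
    PTF e fun i => encVec fun j => φ (u i j) (v i j) := by
  refine (map (l := fun i => List.ofFn fun j => (u i j, v i j))
    (fun _ s => Data.cons (encSym s.1) (encSym s.2)) (fun i s => encSym (φ s.1 s.2)) ?_
    (sym₂ φ (refl _).fst.fst (refl _).fst.snd)).congr (fun _ => rfl) fun i => ?_
  · refine (vecZip hu hv).congr (fun _ => rfl) fun i => ?_
    simp only [List.ofFn_eq_map, List.map_map, Function.comp_def]
  · simp [encVec_eq, List.map_ofFn, Function.comp_def]

theorem vecLength {u : ∀ i, Fin (n i) → S} (hu : PTF e fun i => encVec (u i)) :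
    PTF e fun i => num (n i) := by
  simp only [encVec_eq] at hu
  simpa using hu.length

theorem vecConst (hn : PTF e fun i => num (n i)) (a : S) :
    PTF e fun i => encVec (n := n i) fun _ => a := by
  refine (hn.replicate (encSym a)).congr (fun _ => rfl) fun i => ?_
  simp [encVec_eq, List.ofFn_const]

end PTF

/-- The security parameter becomes part of the index, so uniformity in `k` is the use of a single
program in `PTF`. -/
theorem PolyTime.ptf {α β : ℕ → Type} {ein : ∀ k, α k → Data} {eout : ∀ k, β k → Data}
    {f : ∀ k, α k → β k} (h : PolyTime ein eout f) :
    PTF (fun i : (k : ℕ) × α k => Data.cons (num i.1) (ein i.1 i.2))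
      fun i => eout i.1 (f i.1 i.2) := by
  obtain ⟨p, q, h⟩ := h
  refine ⟨p, _, (PolyBdd.self _).eval q, fun i => ?_⟩
  obtain ⟨rest, h1⟩ := h i.1 i.2
  exact runs_of_evalDet h1

theorem PTF.polyTime {α β : ℕ → Type} {ein : ∀ k, α k → Data} {eout : ∀ k, β k → Data}
    {f : ∀ k, α k → β k}
    (h : PTF (fun i : (k : ℕ) × α k => Data.cons (num i.1) (ein i.1 i.2))
      fun i => eout i.1 (f i.1 i.2)) : PolyTime ein eout f := by
  obtain ⟨p, c, ⟨q, hq⟩, h⟩ := h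
  exact ⟨p, q, fun k x => (h ⟨k, x⟩).evalDet (hq ⟨k, x⟩)⟩

theorem PolyTimeLength.ptf {d : ℕ → ℕ} (h : PolyTimeLength d) : PTF num fun k => num (d k) :=
  PTF.call (PolyTime.ptf h) (fun k => ⟨k, ()⟩) ((PTF.refl _).pair PTF.nil)

/-! ### The encoder is computable in polynomial time -/

section Encoder

variable {Smsg Ssyn A : Type} [AddCommGroup Smsg] [Fintype Smsg] [AddCommGroup Ssyn]
  [Fintype Ssyn] [Fintype A] {M d₁ d₂ r n : ℕ → ℕ}

/-- The first part of a seed. -/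
def seedSyn {d d' : ℕ} (s : Fin (d + d') → Bool) : Fin d → Bool := fun j => s (Fin.castAdd d' j)

/-- The second part of a seed. -/
def seedMsg {d d' : ℕ} (s : Fin (d + d') → Bool) : Fin d' → Bool := fun j => s (Fin.natAdd d j)

/-- Encoder and decoder both start from these two words. The seed is cut at `d₁`, which is why this
length must be computable. -/
theorem PTF.masks {Gsyn : ∀ k, (Fin (d₁ k) → Bool) → Fin (n k) → Ssyn}
    {Gmsg : ∀ k, (Fin (d₂ k) → Bool) → Fin (n k) → Smsg}
    {parse : ∀ k, (Fin (r k) → A) → Fin (n k) → Smsg × Ssyn}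
    (hd₁ : PolyTimeLength d₁)
    (hsyn : PolyTime (fun _ => encVec) (fun _ => encVec) Gsyn)
    (hmsg : PolyTime (fun _ => encVec) (fun _ => encVec) Gmsg)
    (hparse : PolyTime (fun _ => encVec) (fun _ => encVec) parse)
    {ι : Type*} {e : ι → Data} {k : ι → ℕ} {s : ∀ i, Fin (d₁ (k i) + d₂ (k i)) → Bool}
    {shift : ∀ i, Fin (r (k i)) → A} (hk : PTF e fun i => num (k i))
    (hs : PTF e fun i => encVec (s i)) (hsh : PTF e fun i => encVec (shift i)) :
    PTF e (fun i => encVec fun j => Gsyn (k i) (seedSyn (s i)) j + (parse (k i) (shift i) j).2) ∧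
    PTF e (fun i => encVec fun j => Gmsg (k i) (seedMsg (s i)) j + (parse (k i) (shift i) j).1) := by
  have hd := PTF.call (e := e) hd₁.ptf k hk
  have hs' : PTF e fun i => ofList ((List.ofFn fun j => encSym (s i j))) := by
    simpa only [encVec_eq] using hs
  have hs1 : PTF e fun i => encVec (seedSyn (s i)) := by
    refine (hd.take hs' fun i => by simp).congr (fun _ => rfl) fun i => ?_
    rw [encVec_eq, List.ofFn_add, List.take_left' (by simp)]; rfl
  have hs2 : PTF e fun i => encVec (seedMsg (s i)) := by
    refine (hd.drop hs').congr (fun _ => rfl) fun i => ?_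
    rw [encVec_eq, List.ofFn_add, List.drop_left' (by simp)]; rfl
  have h2 := PTF.call (e := e) hsyn.ptf (fun i => ⟨k i, seedSyn (s i)⟩) (hk.pair hs1)
  have h3 := PTF.call (e := e) hmsg.ptf (fun i => ⟨k i, seedMsg (s i)⟩) (hk.pair hs2)
  have h4 := PTF.call (e := e) hparse.ptf (fun i => ⟨k i, shift i⟩) (hk.pair hsh)
  exact ⟨PTF.vecMap₂ (fun a p => a + p.2) h2 h4, PTF.vecMap₂ (fun a p => a + p.1) h3 h4⟩

theorem loadCode_polyTime {enc : ∀ k, Fin (M k) → Fin (n k) → Smsg}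
    {Gsyn : ∀ k, (Fin (d₁ k) → Bool) → Fin (n k) → Ssyn}
    {Gmsg : ∀ k, (Fin (d₂ k) → Bool) → Fin (n k) → Smsg}
    {parse : ∀ k, (Fin (r k) → A) → Fin (n k) → Smsg × Ssyn}
    (henc : PolyTime (fun _ => encMsg) (fun _ => encVec) enc)
    (hd₁ : PolyTimeLength d₁)
    (hsyn : PolyTime (fun _ => encVec) (fun _ => encVec) Gsyn)
    (hmsg : PolyTime (fun _ => encVec) (fun _ => encVec) Gmsg)
    (hparse : PolyTime (fun _ => encVec) (fun _ => encVec) parse) :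
    PolyTime (α := fun k => Fin (M k) × (Fin (d₁ k + d₂ k) → Bool) × (Fin (r k) → A))
      (fun _ => encArgs) (fun _ => encVec)
      (fun k x => loadCode enc Gsyn Gmsg parse k x.1 x.2.1 x.2.2) := by
  apply PTF.polyTime
  set e := fun i : (k : ℕ) × (Fin (M k) × (Fin (d₁ k + d₂ k) → Bool) × (Fin (r k) → A)) =>
    Data.cons (num i.1) (encArgs i.2)
  have hk : PTF e fun i => num i.1 := (PTF.refl _).fst
  have h1 : PTF e fun i => encVec (enc i.1 i.2.1) :=
    PTF.call (e := e) henc.ptf (fun i => ⟨i.1, i.2.1⟩) (hk.pair (PTF.refl _).snd.fst)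
  have hs : PTF e fun i => encVec i.2.2.1 := (PTF.refl _).snd.snd.fst
  have hsh : PTF e fun i => encVec i.2.2.2 := (PTF.refl _).snd.snd.snd
  obtain ⟨h2, h3⟩ := PTF.masks hd₁ hsyn hmsg hparse hk hs hsh
  refine (PTF.vecMap₂ (fun a b => (a, b)) (PTF.vecMap₂ (fun a b => a + b) h1 h3) h2).congr
    (fun _ => rfl) fun i => congrArg encVec (funext fun j => ?_)
  simp only [loadCode, add_assoc]
  rfl

end Encoder

end PayloadCode

namespace PayloadCode

open Data

/-! ## Alignment by dynamic programming -/

section Align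

variable {K β γ : Type}

/-- The length of an alignment, the symbol assigned to each position, and the symbols that are
not assigned to any position. -/
abbrev Cell (β : Type) := ℕ × List (Option β) × List β

open Classical in
/-- The alignment of `s :: σ` with `b :: y` from those of `σ` with `b :: y`, of `σ` with `y`, and
of `s :: σ` with `y`. -/
noncomputable def alignCell (key : β → K) (s : K) (b : β) (c₁ c₂ c₃ : Cell β) : Cell β :=
  if key b = s then (c₂.1 + 1, some b :: c₂.2.1, c₂.2.2)
  else if c₁.1 < c₃.1 then (c₃.1, c₃.2.1, b :: c₃.2.2)
  else (c₁.1, none :: c₁.2.1, c₁.2.2)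

/-- One row of the dynamic program, with the previous row given as a function of the suffix; this
makes `align` structurally recursive in both words. -/
noncomputable def alignStep (key : β → K) (s : K) (prev : List β → Cell β) : List β → Cell β
  | [] => (0, none :: (prev []).2.1, [])
  | b :: y => alignCell key s b (prev (b :: y)) (prev y) (alignStep key s prev y)

/-- A longest common subsequence of `σ` and `y.map key`. -/
noncomputable def align (key : β → K) : List K → List β → Cell β
  | [] => fun y => (0, [], y)
  | s :: σ => alignStep key s (align key σ)

theorem align_cons_nil (key : β → K) (s : K) (σ : List K) :
    align key (s :: σ) [] = (0, none :: (align key σ []).2.1, []) := rfl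

theorem align_cons_cons (key : β → K) (s : K) (σ : List K) (b : β) (y : List β) :
    align key (s :: σ) (b :: y) = alignCell key s b (align key σ (b :: y)) (align key σ y)
      (align key (s :: σ) y) := rfl

/-- Induction along the recursion of `align`. -/
theorem align_induction (key : β → K) {P : List K → List β → Cell β → Prop}
    (h0 : ∀ y, P [] y (0, [], y))
    (h1 : ∀ s σ, P σ [] (align key σ []) → P (s :: σ) [] (0, none :: (align key σ []).2.1, []))
    (h2 : ∀ s σ b y c, key b = s → P σ y c → P (s :: σ) (b :: y) (c.1 + 1, some b :: c.2.1, c.2.2))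
    (h3 : ∀ s σ b y c, key b ≠ s → P (s :: σ) y c → P (s :: σ) (b :: y) (c.1, c.2.1, b :: c.2.2))
    (h4 : ∀ s σ b y c, key b ≠ s → P σ (b :: y) c → P (s :: σ) (b :: y) (c.1, none :: c.2.1, c.2.2))
    (σ : List K) (y : List β) : P σ y (align key σ y) := by
  induction σ generalizing y with
  | nil => exact h0 y
  | cons s σ ih =>
    induction y with
    | nil => exact h1 s σ (ih [])
    | cons b y ih' =>
      rw [align_cons_cons, alignCell]
      split_ifs with h h'
      · exact h2 s σ b y _ h (ih y)
      · exact h3 s σ b y _ h ih'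
      · exact h4 s σ b y _ h (ih _)

theorem align_length (key : β → K) (σ : List K) (y : List β) :
    (align key σ y).2.1.length = σ.length := by
  refine align_induction key (P := fun σ y c => c.2.1.length = σ.length) ?_ ?_ ?_ ?_ ?_ σ y <;>
    simp_all

theorem align_fst (key : β → K) (σ : List K) (y : List β) :
    (align key σ y).1 = (align key σ y).2.1.reduceOption.length := by
  -- For empty `y` the recursion writes the length `0` directly, so the induction has to know that
  -- the previous length was `0` as well.
  refine align_induction key (P := fun σ y c => c.1 = c.2.1.reduceOption.length ∧
    (y = [] → c.1 = 0)) ?_ ?_ ?_ ?_ ?_ σ y |>.1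
  · simp
  · simp_all
  all_goals simp_all [List.reduceOption_cons_of_some, List.reduceOption_cons_of_none]

theorem align_sublist (key : β → K) (σ : List K) (y : List β) :
    (align key σ y).2.1.reduceOption.Sublist y := by
  refine align_induction key (P := fun σ y c => c.2.1.reduceOption.Sublist y) ?_ ?_ ?_ ?_ ?_ σ y
  · simp
  · intro s σ h; simpa using h
  · intro s σ b y c _ h; simpa using h
  · intro s σ b y c _ h; exact h.cons _
  · intro s σ b y c _ h; simpa using h

theorem align_rem_sublist (key : β → K) (σ : List K) (y : List β) :
    (align key σ y).2.2.Sublist y := by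
  refine align_induction key (P := fun σ y c => c.2.2.Sublist y) ?_ ?_ ?_ ?_ ?_ σ y
  · simp
  · simp
  · intro s σ b y c _ h; exact h.cons _
  · intro s σ b y c _ h; simpa using h
  · intro s σ b y c _ h; exact h

/-- Bookkeeping for the rounds: no received symbol is lost or used twice. -/
theorem align_perm (key : β → K) (σ : List K) (y : List β) :
    ((align key σ y).2.1.reduceOption ++ (align key σ y).2.2).Perm y := by
  refine align_induction key (P := fun σ y c => (c.2.1.reduceOption ++ c.2.2).Perm y)
    ?_ ?_ ?_ ?_ ?_ σ y
  · simp
  · intro s σ h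
    -- Nothing can be assigned out of an empty word.
    have := align_sublist key σ []
    simp_all
  · intro s σ b y c _ h; simpa using h
  · intro s σ b y c _ h
    exact List.perm_middle.trans (h.cons b)
  · intro s σ b y c _ h; simpa using h

theorem align_key (key : β → K) (σ : List K) (y : List β) (i : ℕ) (b : β)
    (h : (align key σ y).2.1[i]? = some (some b)) : σ[i]? = some (key b) := by
  refine align_induction key (P := fun σ y c => ∀ i b, c.2.1[i]? = some (some b) →
    σ[i]? = some (key b)) ?_ ?_ ?_ ?_ ?_ σ y i b h
  · simp
  · intro s σ h i b hi
    cases i with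
    | zero => simp at hi
    | succ i => simpa using h i b (by simpa using hi)
  · intro s σ b y c hk h i b' hi
    cases i with
    | zero => simp at hi; simp [← hi, hk]
    | succ i => simpa using h i b' (by simpa using hi)
  · intro s σ b y c _ h; exact h
  · intro s σ b y c hk h i b' hi
    cases i with
    | zero => simp at hi
    | succ i => simpa using h i b' (by simpa using hi)

/-- If the heads agree, removing the first letter of `w` leaves a common subsequence of the tails.
If they differ, `w` avoids one of the two heads, and the larger of the two cells was taken. -/
theorem align_optimal (key : β → K) (σ : List K) (y : List β) (w : List K)
    (h1 : w.Sublist σ) (h2 : w.Sublist (y.map key)) : w.length ≤ (align key σ y).1 := by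
  induction σ generalizing y w with
  | nil => simp_all
  | cons s σ ih =>
    induction y generalizing w with
    | nil => simp_all
    | cons b y ih' =>
      rw [align_cons_cons, alignCell]
      split_ifs with h h'
      · cases w with
        | nil => simp
        | cons a w =>
          have := ih y w ?_ ?_
          · simpa using this
          · exact h1.tail
          · exact h2.tail
      all_goals
        have key1 : w.Sublist σ ∨ w.Sublist (y.map key) := by
          cases h1 with
          | cons _ h1 => exact .inl h1
          | cons_cons _ h1 =>
            cases h2 with
            | cons _ h2 => exact .inr h2
            | cons_cons _ h2 => exact absurd rfl h
        rcases key1 with h3 | h3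
        · have := ih (b :: y) w h3 h2
          dsimp only; omega
        · have := ih' w h1 h3
          dsimp only; omega

def Cell.map (f : β → γ) (c : Cell β) : Cell γ := (c.1, c.2.1.map (Option.map f), c.2.2.map f)

/-- An alignment sees the symbols only through their keys. The analysis can therefore align the
indices of the received symbols, which are pairwise distinct, in place of the symbols. -/
theorem align_map (key : γ → K) (f : β → γ) (σ : List K) (y : List β) :
    align key σ (y.map f) = Cell.map f (align (fun b => key (f b)) σ y) := by
  induction σ generalizing y with
  | nil => simp [align, Cell.map]
  | cons s σ ih =>
    induction y with
    | nil =>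
      have := ih []
      rw [List.map_nil] at this
      simp [align_cons_nil, this, Cell.map]
    | cons b y ih' =>
      have h1 := ih (b :: y)
      rw [List.map_cons] at h1 ⊢
      rw [align_cons_cons, align_cons_cons, h1, ih, ih']
      unfold alignCell
      by_cases h2 : key (f b) = s
      · rw [if_pos h2, if_pos h2]; simp [Cell.map]
      · rw [if_neg h2, if_neg h2]
        split_ifs with h3 h4 h4
        · simp [Cell.map]
        · exact absurd h3 h4
        · exact absurd h4 h3
        · simp [Cell.map]

end Align

/-! ### Rounds of alignment -/

section Rounds

variable {K β γ : Type} {n : ℕ}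

noncomputable def asgVec (key : β → K) (σ : Fin n → K) (y : List β) (i : Fin n) : Option β :=
  (align key (List.ofFn σ) y).2.1[i]'(by rw [align_length]; simp)

/-- The symbols that are still unassigned after `R` rounds. -/
noncomputable def remaining (key : β → K) (σ : Fin n → K) (y : List β) : ℕ → List β
  | 0 => y
  | R + 1 => (align key (List.ofFn σ) (remaining key σ y R)).2.2

/-- The symbols assigned to a position: `none` stands for no symbol and `some none` for several
symbols. -/
def collect (a : Option (Option β)) (o : Option β) : Option (Option β) :=
  o.elim a fun b => a.elim (some (some b)) fun _ => some none

noncomputable def collected (key : β → K) (σ : Fin n → K) (y : List β) :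
    ℕ → Fin n → Option (Option β)
  | 0 => fun _ => none
  | R + 1 => fun i => collect (collected key σ y R i) (asgVec key σ (remaining key σ y R) i)

theorem asgVec_map (key : γ → K) (f : β → γ) (σ : Fin n → K) (y : List β) (i : Fin n) :
    asgVec key σ (y.map f) i = (asgVec (fun b => key (f b)) σ y i).map f := by
  simp only [asgVec, align_map, Cell.map]
  exact List.getElem_map _

theorem remaining_map (key : γ → K) (f : β → γ) (σ : Fin n → K) (y : List β) (R : ℕ) :
    remaining key σ (y.map f) R = (remaining (fun b => key (f b)) σ y R).map f := by
  induction R with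
  | zero => rfl
  | succ R ih => simp only [remaining, ih, align_map, Cell.map]

theorem collected_map (key : γ → K) (f : β → γ) (σ : Fin n → K) (y : List β) (R : ℕ) (i : Fin n) :
    collected key σ (y.map f) R i =
      (collected (fun b => key (f b)) σ y R i).map (Option.map f) := by
  induction R with
  | zero => rfl
  | succ R ih =>
    simp only [collected, ih, remaining_map, asgVec_map]
    cases asgVec (fun b => key (f b)) σ (remaining (fun b => key (f b)) σ y R) i <;>
    cases collected (fun b => key (f b)) σ y R i <;> rfl

end Rounds

/-! ### Running time -/

section Time

theorem size_encSym_le {S : Type} [Fintype S] (a : S) :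
    (encSym a).size ≤ 2 * Fintype.card S + 1 := by
  rw [encSym, size_num]
  have := (Fintype.equivFin S a).2
  omega

theorem size_encList_le {S : Type} [Fintype S] (l : List S) :
    (encList l).size ≤ 1 + l.length * (2 * Fintype.card S + 2) := by
  rw [encList, size_ofList]
  refine Nat.add_le_add_left ((listSize_le _ (2 * Fintype.card S + 1) ?_).trans ?_) _
  · simp only [List.mem_map]
    rintro d ⟨a, -, rfl⟩
    exact size_encSym_le a
  · rw [List.length_map]
    exact Nat.mul_le_mul_left _ (by omega)

theorem length_le_size_encList {S : Type} [Fintype S] (l : List S) :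
    l.length ≤ (encList l).size := by
  have := length_le_listSize (l.map encSym)
  rw [encList, size_ofList]
  rw [List.length_map] at this
  omega

variable {K S : Type} [Fintype S]

noncomputable def encCell (c : Cell S) : Data :=
  .cons (num c.1) (.cons (encList c.2.1) (encList c.2.2))

/-- A cell contains one entry per position of `σ` and some of the symbols of `y`, so it is of linear
size and the whole table stays polynomial. -/
theorem size_encCell_align (key : S → K) (σ : List K) (y : List S) :
    (encCell (align key σ y)).size ≤
      (σ.length + y.length + 1) * (2 * Fintype.card (Option S) + 8) := by
  have h1 := size_encList_le (align key σ y).2.1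
  have h2 := size_encList_le (align key σ y).2.2
  have h3 := align_length key σ y
  have h4 := (align_rem_sublist key σ y).length_le
  have h5 : (align key σ y).1 ≤ σ.length := by
    rw [align_fst, ← h3]; exact List.reduceOption_length_le _
  have h6 : Fintype.card S ≤ Fintype.card (Option S) := by simp
  simp only [encCell, size, size_num]
  rw [h3] at h1
  have h7 : (align key σ y).2.2.length * (2 * Fintype.card S + 2) ≤
    y.length * (2 * Fintype.card (Option S) + 2) := Nat.mul_le_mul h4 (by omega)
  nlinarith

/-- The cells of a row of the dynamic programming table. -/
noncomputable def encRow (key : S → K) (σ : List K) (y : List S) : Data :=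
  ofList (suffixMap (fun b y' => .cons (encSym b) (encCell (align key σ (b :: y')))) y)

theorem encRow_cons (key : S → K) (σ : List K) (b : S) (y : List S) :
    encRow key σ (b :: y) =
      .cons (.cons (encSym b) (encCell (align key σ (b :: y)))) (encRow key σ y) := rfl

theorem size_encRow (key : S → K) (σ : List K) (y : List S) :
    (encRow key σ y).size ≤ 1 + y.length * ((σ.length + y.length + 1) *
      (2 * Fintype.card (Option S) + 8) + (2 * Fintype.card S + 3)) := by
  induction y with
  | nil => simp [encRow, suffixMap, ofList, size]
  | cons b y ih =>
    have h1 := size_encCell_align key σ (b :: y)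
    have h2 := size_encSym_le b
    simp only [encRow_cons, size, List.length_cons] at h1 ⊢
    have h3 : (σ.length + y.length + 1) * (2 * Fintype.card (Option S) + 8) ≤
      (σ.length + (y.length + 1) + 1) * (2 * Fintype.card (Option S) + 8) :=
      Nat.mul_le_mul_right _ (by omega)
    have h4 := Nat.mul_le_mul_left y.length (Nat.add_le_add_right h3 (2 * Fintype.card S + 3))
    rw [Nat.add_mul y.length 1]
    omega

/-- A polynomial bound for the trees that occur in the computation of an alignment. -/
def alignBound (S : Type) [Fintype S] (N : ℕ) : ℕ :=
  3 + N * (N * (2 * Fintype.card (Option S) + 8) + (2 * Fintype.card S + 3)) +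
    2 * (N * (2 * Fintype.card (Option S) + 8))

theorem size_align_state (key : S → K) (σ τ ρ : List K) (y z w : List S) (N : ℕ)
    (h : σ.length + y.length + 1 ≤ N) (h' : τ.length + z.length + 1 ≤ N)
    (h'' : ρ.length + w.length + 1 ≤ N) :
    (Data.cons (encRow key σ y) (.cons (encCell (align key τ z))
      (encCell (align key ρ w)))).size ≤ alignBound S N := by
  have h1 := size_encRow key σ y
  have h2 := size_encCell_align key τ z
  have h3 := size_encCell_align key ρ w
  have h4 := Nat.mul_le_mul_right (2 * Fintype.card (Option S) + 8) h
  have h5 := Nat.mul_le_mul_right (2 * Fintype.card (Option S) + 8) h'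
  have h6 := Nat.mul_le_mul_right (2 * Fintype.card (Option S) + 8) h''
  have h7 : y.length * ((σ.length + y.length + 1) *
      (2 * Fintype.card (Option S) + 8) + (2 * Fintype.card S + 3)) ≤
      N * (N * (2 * Fintype.card (Option S) + 8) + (2 * Fintype.card S + 3)) :=
    Nat.mul_le_mul (by omega) (Nat.add_le_add_right h4 _)
  simp only [size, alignBound]
  omega

theorem alignBound_polyBdd {ι : Type*} {s N : ι → ℕ} (h : PolyBdd s N) :
    PolyBdd s fun i => alignBound S (N i) :=
  (((PolyBdd.const 3).add (h.mul ((h.mul (.const _)).add (.const _))))).add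
    ((PolyBdd.const 2).mul (h.mul (.const _)))

theorem encList_asg {n : ℕ} (key : S → K) (σ : Fin n → K) (y : List S) :
    encList (align key (List.ofFn σ) y).2.1 = encVec (asgVec key σ y) := by
  rw [encVec]
  congr 1
  exact List.ext_getElem (by simp [align_length]) fun j h1 h2 => by simp [asgVec]

theorem PTF.bite' {ι : Type*} {e f g : ι → Data} {b : ι → Bool}
    (hb : PTF e fun i => ofBool (b i)) (hf : PTF e f) (hg : PTF e g) :
    PTF e fun i => if b i then f i else g i :=
  bite hb (hf.reindex _) (hg.reindex _)

variable [Fintype K]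

theorem PTF.alignCell {ι : Type*} {e : ι → Data} (key : S → K) {s : ι → K} {b : ι → S}
    {c₁ c₂ c₃ : ι → Cell S} (hs : PTF e fun i => encSym (s i)) (hb : PTF e fun i => encSym (b i))
    (h₁ : PTF e fun i => encCell (c₁ i)) (h₂ : PTF e fun i => encCell (c₂ i))
    (h₃ : PTF e fun i => encCell (c₃ i)) :
    PTF e fun i => encCell (alignCell key (s i) (b i) (c₁ i) (c₂ i) (c₃ i)) := by
  classical
  have hnone : PTF e fun _ => encSym (none : Option S) := const _
  have hsome : PTF e fun i => encSym (some (b i)) := hb.sym some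
  have heq : PTF e fun i => ofBool (decide (key (b i) = s i)) :=
    PTF.table (fun s : K × S => Data.cons (encSym s.1) (encSym s.2))
      (fun s => ofBool (decide (key s.2 = s.1)))
      (fun a b h => by
        simp only [Data.cons.injEq] at h
        exact Prod.ext (encSym_injective h.1) (encSym_injective h.2))
      (fun i => (s i, b i)) (hs.pair hb)
  have hlt := PTF.num_lt (a := fun i => (c₁ i).1) (b := fun i => (c₃ i).1) h₁.fst h₃.fst
  have r1 : PTF e fun i => encCell ((c₂ i).1 + 1, some (b i) :: (c₂ i).2.1, (c₂ i).2.2) :=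
    (nil.pair h₂.fst).pair ((hsome.pair h₂.snd.fst).pair h₂.snd.snd)
  have r2 : PTF e fun i => encCell ((c₃ i).1, (c₃ i).2.1, b i :: (c₃ i).2.2) :=
    h₃.fst.pair (h₃.snd.fst.pair (hb.pair h₃.snd.snd))
  have r3 : PTF e fun i => encCell ((c₁ i).1, none :: (c₁ i).2.1, (c₁ i).2.2) :=
    h₁.fst.pair ((hnone.pair h₁.snd.fst).pair h₁.snd.snd)
  have r4 := PTF.bite' hlt r2 r3
  refine (PTF.bite' heq r1 r4).congr (fun _ => rfl) fun i => ?_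
  simp only [PayloadCode.alignCell, decide_eq_true_eq]
  split_ifs <;> rfl

/-- Computation of a new row. -/
theorem PTF.alignRow {ι : Type*} {e : ι → Data} (key : S → K) {s : ι → K} {σ : ι → List K}
    {y : ι → List S} (hs : PTF e fun i => encSym (s i))
    (hrow : PTF e fun i => encRow key (σ i) (y i))
    (hnil : PTF e fun i => encCell (align key (σ i) []))
    {N : ι → ℕ} (hN : PolyBdd (fun i => (e i).size) N)
    (hle : ∀ i, (σ i).length + (y i).length + 2 ≤ N i) :
    PTF e fun i => Data.cons (encRow key (s i :: σ i) (y i))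
      (.cons (encCell (align key (s i :: σ i) (y i))) (encCell (align key (σ i) (y i)))) := by
  have hn : PTF e fun i => encCell (align key (s i :: σ i) []) :=
    (const (num 0)).pair (((const (encSym (none : Option S))).pair hnil.snd.fst).pair (const _))
  -- The fold runs over the old row, whose entries supply `b` and the cell `c₁`. The accumulator
  -- keeps the new row, its foremost cell `c₃` and the diagonal cell `c₂` of the old row.
  refine PTF.foldr (l := y) (e := e)
    (fun i b y' => .cons (encSym b) (encCell (align key (σ i) (b :: y'))))
    (fun i y' => Data.cons (encRow key (s i :: σ i) y')
      (.cons (encCell (align key (s i :: σ i) y')) (encCell (align key (σ i) y'))))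
    hrow ((const _).pair (hn.pair hnil)) ?_ (alignBound_polyBdd (S := S) hN) ?_
  · set J := {k : ι × S × List S // k.2.1 :: k.2.2 <:+ y k.1}
    set e' : J → Data := fun k => Data.cons (.cons (encSym k.1.2.1)
      (encCell (align key (σ k.1.1) (k.1.2.1 :: k.1.2.2))))
      (.cons (Data.cons (encRow key (s k.1.1 :: σ k.1.1) k.1.2.2)
      (.cons (encCell (align key (s k.1.1 :: σ k.1.1) k.1.2.2))
        (encCell (align key (σ k.1.1) k.1.2.2)))) (e k.1.1)) with he'
    have h0 : PTF e' fun k => e k.1.1 := (refl _).snd.snd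
    have h1 : PTF e' fun k => encSym (s k.1.1) := h0.comp (hs.reindex fun k : J => k.1.1)
    have h2 : PTF e' fun k => encSym k.1.2.1 := (refl _).fst.fst
    have h3 : PTF e' fun k => encCell (align key (σ k.1.1) (k.1.2.1 :: k.1.2.2)) :=
      (refl _).fst.snd
    have h4 : PTF e' fun k => encCell (align key (s k.1.1 :: σ k.1.1) k.1.2.2) :=
      (refl _).snd.fst.snd.fst
    have h5 : PTF e' fun k => encCell (align key (σ k.1.1) k.1.2.2) := (refl _).snd.fst.snd.snd
    have h6 : PTF e' fun k => encRow key (s k.1.1 :: σ k.1.1) k.1.2.2 := (refl _).snd.fst.fst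
    have h7 := PTF.alignCell key h1 h2 h3 h5 h4
    exact ((h2.pair h7).pair h6).pair (h7.pair h3)
  · intro i y' hy'
    have h1 := hy'.length_le
    have h2 := hle i
    refine size_align_state key _ _ _ _ _ _ (N i) ?_ ?_ ?_ <;> (try simp only [List.length_cons]) <;> omega

/-- A fold over `σ` that keeps one row at a time, after a fold that builds the row of the empty
word. The cell for empty `y` is carried separately, since `encRow` stores nonempty suffixes only. -/
theorem PTF.align {ι : Type*} {e : ι → Data} (key : S → K) {σ : ι → List K}
    {y : ι → List S} (hσ : PTF e fun i => encList (σ i)) (hy : PTF e fun i => encList (y i)) :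
    PTF e fun i => encCell (align key (σ i) (y i)) := by
  have h0 : PTF e fun i => Data.cons (encRow key [] (y i)) (encList (y i)) := by
    refine PTF.foldr (l := y) (e := e) (fun i b y' => encSym b)
      (fun i y' => Data.cons (encRow key [] y') (encList y')) ?_ (const _) ?_
      (B := fun i => 1 + (1 + (y i).length * ((0 + (y i).length + 1) *
        (2 * Fintype.card (Option S) + 8) + (2 * Fintype.card S + 3))) +
        (1 + (y i).length * (2 * Fintype.card S + 2))) ?_ ?_
    · simpa only [suffixMap_const, encList] using hy
    · set J := {k : ι × S × List S // k.2.1 :: k.2.2 <:+ y k.1}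
      set e' : J → Data := fun k => Data.cons (encSym k.1.2.1)
        (.cons (.cons (encRow key [] k.1.2.2) (encList k.1.2.2)) (e k.1.1))
      have h2 : PTF e' fun k => encSym k.1.2.1 := (refl _).fst
      have h3 : PTF e' fun k => encRow key [] k.1.2.2 := (refl _).snd.fst.fst
      have h4 : PTF e' fun k => encList (k.1.2.1 :: k.1.2.2) := h2.pair (refl _).snd.fst.snd
      exact ((h2.pair ((const (num 0)).pair ((const (encList [])).pair h4))).pair h3).pair h4
    · have hl : PolyBdd (fun i => (e i).size) fun i => (y i).length :=
        hy.size_polyBdd.of_le fun i => length_le_size_encList _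
      exact ((PolyBdd.const 1).add ((PolyBdd.const 1).add (hl.mul (((((PolyBdd.const 0).add hl).add
        (.const 1)).mul (.const _)).add (.const _))))).add ((PolyBdd.const 1).add
          (hl.mul (.const _)))
    · intro i y' hy'
      have h1 := hy'.length_le
      have h2 := size_encRow key [] y'
      have h3 := size_encList_le y'
      have h4 : y'.length * (([] : List K).length + y'.length + 1) ≤
        (y i).length * (0 + (y i).length + 1) := Nat.mul_le_mul h1 (by simp; omega)
      have h5 := Nat.mul_le_mul_right (2 * Fintype.card (Option S) + 8) h4
      have h6 := Nat.mul_le_mul_right (2 * Fintype.card S + 3) h1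
      have h7 := Nat.mul_le_mul_right (2 * Fintype.card S + 2) h1
      simp only [size]
      rw [Nat.mul_add, ← Nat.mul_assoc] at h2 ⊢
      omega
  have hrow : PTF e fun i => Data.cons (encRow key (σ i) (y i)) (.cons (encCell
      (PayloadCode.align key (σ i) [])) (encCell (PayloadCode.align key (σ i) (y i)))) := by
    have hN : PolyBdd (fun i => (e i).size) fun i => (encList (σ i)).size + (encList (y i)).size
        + 2 := (hσ.size_polyBdd.add hy.size_polyBdd).add (.const 2)
    refine PTF.foldr (l := σ) (e := e) (fun i s σ' => encSym s)
      (fun i σ' => Data.cons (encRow key σ' (y i)) (.cons (encCell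
        (PayloadCode.align key σ' [])) (encCell (PayloadCode.align key σ' (y i))))) ?_ ?_ ?_
        (alignBound_polyBdd (S := S) hN) ?_
    · simpa only [suffixMap_const, encList] using hσ
    · exact h0.fst.pair ((const _).pair ((const (num 0)).pair ((const (encList [])).pair h0.snd)))
    · set J := {k : ι × K × List K // k.2.1 :: k.2.2 <:+ σ k.1}
      set e' : J → Data := fun k => Data.cons (encSym k.1.2.1) (.cons (Data.cons
        (encRow key k.1.2.2 (y k.1.1)) (.cons (encCell (PayloadCode.align key k.1.2.2 []))
          (encCell (PayloadCode.align key k.1.2.2 (y k.1.1))))) (e k.1.1))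
      have h1 : PTF e' fun k => e k.1.1 := (refl _).snd.snd
      have h2 : PTF e' fun k => encSym k.1.2.1 := (refl _).fst
      have h3 : PTF e' fun k => encRow key k.1.2.2 (y k.1.1) := (refl _).snd.fst.fst
      have h4 : PTF e' fun k => encCell (PayloadCode.align key k.1.2.2 []) :=
        (refl _).snd.fst.snd.fst
      have h5 := PTF.alignRow key h2 h3 h4 (h1.size_polyBdd.trans (hN.reindex fun k : J => k.1.1))
        (fun k => by
          have h6 := k.2.length_le
          have h7 := length_le_size_encList (σ k.1.1)
          have h8 := length_le_size_encList (y k.1.1)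
          simp only [List.length_cons] at h6
          simp only [Function.comp]
          omega)
      have h6 : PTF e' fun k => encCell (PayloadCode.align key (k.1.2.1 :: k.1.2.2) []) :=
        (const (num 0)).pair (((const (encSym (none : Option S))).pair h4.snd.fst).pair (const _))
      exact h5.fst.pair (h6.pair h5.snd.fst)
    · intro i σ' hσ'
      have h6 := hσ'.length_le
      have h7 := length_le_size_encList (σ i)
      have h8 := length_le_size_encList (y i)
      refine size_align_state key _ _ _ _ _ _ _ ?_ ?_ ?_ <;> (try simp only [List.length_nil]) <;> omega
  exact hrow.snd.snd

/-- `R` depends on `δ` alone. The rounds are composed in the program itself, and a fixed number of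
polynomial bounds composes to a polynomial bound. -/
theorem PTF.rounds {ι : Type*} {e : ι → Data} (key : S → K) {n : ι → ℕ} {σ : ∀ i, Fin (n i) → K}
    {y : ι → List S} (hσ : PTF e fun i => encVec (σ i)) (hy : PTF e fun i => encList (y i))
    (R : ℕ) :
    PTF e (fun i => encList (remaining key (σ i) (y i) R)) ∧
      PTF e (fun i => encVec (collected key (σ i) (y i) R)) := by
  induction R with
  | zero => exact ⟨hy, hσ.vecLength.vecConst none⟩
  | succ R ih =>
    have h := PTF.align key hσ ih.1
    refine ⟨h.snd.snd, PTF.vecMap₂ collect ih.2 (h.snd.fst.congr (fun _ => rfl) fun i => ?_)⟩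
    exact encList_asg _ _ _

end Time

end PayloadCode

namespace PayloadCode

/-! ## Correctness of the alignment -/

section Correct

variable {K : Type} {m n : ℕ}

/-- A strictly monotone matching of a word with itself that pairs equal symbols at different
positions. -/
def IsSelfMatching (σ : Fin n → K) (P : Finset (Fin n × Fin n)) : Prop :=
  (∀ p ∈ P, p.1 ≠ p.2 ∧ σ p.1 = σ p.2) ∧ ∀ p ∈ P, ∀ q ∈ P, p.1 < q.1 ↔ p.2 < q.2

variable (κ : Fin m → K) (σ : Fin n → K)

/-- The indices that are unassigned after `R` rounds. -/
noncomputable def rem (R : ℕ) : List (Fin m) := remaining κ σ (List.finRange m) R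

/-- The index that is assigned to a position in round `R`. -/
noncomputable def asg (R : ℕ) : Fin n → Option (Fin m) := asgVec κ σ (rem κ σ R)

theorem rem_succ_sublist (R : ℕ) : (rem κ σ (R + 1)).Sublist (rem κ σ R) :=
  align_rem_sublist _ _ _

theorem rem_sublist_of_le {R R' : ℕ} (h : R ≤ R') : (rem κ σ R').Sublist (rem κ σ R) := by
  induction R', h using Nat.le_induction with
  | base => exact List.Sublist.refl _
  | succ R' _ ih => exact (rem_succ_sublist κ σ R').trans ih

theorem rem_pairwise (R : ℕ) : (rem κ σ R).Pairwise (· < ·) :=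
  (List.pairwise_lt_finRange m).sublist (rem_sublist_of_le κ σ (Nat.zero_le R))

theorem rem_nodup (R : ℕ) : (rem κ σ R).Nodup := (rem_pairwise κ σ R).imp fun h => h.ne

variable {κ σ}

theorem mem_reduceOption_of_asg {R : ℕ} {i : Fin n} {j : Fin m} (h : asg κ σ R i = some j) :
    j ∈ (align κ (List.ofFn σ) (rem κ σ R)).2.1.reduceOption := by
  rw [List.reduceOption_mem_iff, ← h, asg, asgVec]
  exact List.getElem_mem _

theorem asg_key {R : ℕ} {i : Fin n} {j : Fin m} (h : asg κ σ R i = some j) : κ j = σ i := by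
  have h1 := align_key κ (List.ofFn σ) (rem κ σ R) i j (by
    rw [← h, asg, asgVec, List.getElem?_eq_getElem (by rw [align_length]; simp)]; rfl)
  simpa using h1.symm

theorem mem_rem_of_asg {R : ℕ} {i : Fin n} {j : Fin m} (h : asg κ σ R i = some j) :
    j ∈ rem κ σ R :=
  (align_sublist κ (List.ofFn σ) (rem κ σ R)).subset (mem_reduceOption_of_asg h)

theorem notMem_rem_succ_of_asg {R : ℕ} {i : Fin n} {j : Fin m} (h : asg κ σ R i = some j) :
    j ∉ rem κ σ (R + 1) := by
  have h1 := (align_perm κ (List.ofFn σ) (rem κ σ R)).nodup_iff.2 (rem_nodup κ σ R)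
  exact List.disjoint_of_nodup_append h1 (mem_reduceOption_of_asg h)

theorem exists_asg_of_notMem {R : ℕ} {j : Fin m} (h : j ∈ rem κ σ R)
    (h' : j ∉ rem κ σ (R + 1)) : ∃ i, asg κ σ R i = some j := by
  have h1 := (align_perm κ (List.ofFn σ) (rem κ σ R)).mem_iff.2 h
  rcases List.mem_append.1 h1 with h2 | h2
  · rw [List.reduceOption_mem_iff] at h2
    obtain ⟨i, hi, h3⟩ := List.getElem_of_mem h2
    have hi' : i < n := by rw [align_length] at hi; simpa using hi
    exact ⟨⟨i, hi'⟩, h3⟩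
  · exact absurd h2 h'

theorem asg_lt {R : ℕ} {i i' : Fin n} {j j' : Fin m} (h : asg κ σ R i = some j)
    (h' : asg κ σ R i' = some j') (hi : i < i') : j < j' := by
  have h1 := (rem_pairwise κ σ R).sublist (align_sublist κ (List.ofFn σ) (rem κ σ R))
  rw [List.reduceOption, List.pairwise_filterMap, List.pairwise_iff_getElem] at h1
  exact h1 i i' (by rw [align_length]; simp) (by rw [align_length]; simp) hi j h j' h'

theorem asg_lt_iff {R : ℕ} {i i' : Fin n} {j j' : Fin m} (h : asg κ σ R i = some j)
    (h' : asg κ σ R i' = some j') : i < i' ↔ j < j' := by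
  refine ⟨asg_lt h h', fun hj => ?_⟩
  rcases lt_trichotomy i i' with h1 | rfl | h1
  · exact h1
  · rw [h, Option.some.injEq] at h'; omega
  · have := asg_lt h' h h1; omega

/-- The round and the position of an index are unique. -/
theorem asg_unique {R R' : ℕ} {i i' : Fin n} {j : Fin m} (h : asg κ σ R i = some j)
    (h' : asg κ σ R' i' = some j) : i = i' ∧ R = R' := by
  have key : ∀ {R R' : ℕ} {i i' : Fin n}, asg κ σ R i = some j → asg κ σ R' i' = some j →
      ¬ R < R' := fun {R R' i i'} h h' hlt =>
    notMem_rem_succ_of_asg h ((rem_sublist_of_le κ σ hlt).subset (mem_rem_of_asg h'))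
  have hR : R = R' := le_antisymm (not_lt.1 (key h' h)) (not_lt.1 (key h h'))
  subst hR
  refine ⟨?_, rfl⟩
  rcases lt_trichotomy i i' with h1 | h1 | h1
  · have := asg_lt h h' h1; omega
  · exact h1
  · have := asg_lt h' h h1; omega

/-- What is left after `R` rounds has no long common subsequence with `σ`. -/
theorem mul_length_le (R : ℕ) (w : List K) (h1 : w.Sublist (List.ofFn σ))
    (h2 : w.Sublist ((rem κ σ R).map κ)) : R * w.length ≤ m := by
  -- The remaining lists decrease, so `w` was available in each earlier round, and by optimality
  -- each round removed at least `w.length` symbols.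
  have key : ∀ r ≤ R, (rem κ σ r).length + r * w.length ≤ m := by
    intro r
    induction r with
    | zero => intro _; simp [rem, remaining]
    | succ r ih =>
      intro hr
      have h3 := ih (by omega)
      have h4 := align_optimal κ (List.ofFn σ) (rem κ σ r) w h1
        (h2.trans ((rem_sublist_of_le κ σ (by omega)).map κ))
      rw [align_fst] at h4
      have h5 := (align_perm κ (List.ofFn σ) (rem κ σ r)).length_eq
      rw [List.length_append] at h5
      have h6 : rem κ σ (r + 1) = (align κ (List.ofFn σ) (rem κ σ r)).2.2 := rfl
      rw [h6, Nat.add_mul]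
      omega
  have := key R le_rfl
  omega

variable (κ σ)

open Classical in
/-- The indices that are assigned to a position in the first `R` rounds. -/
noncomputable def assigned (R : ℕ) (i : Fin n) : Finset (Fin m) :=
  Finset.univ.filter fun j => ∃ r < R, asg κ σ r i = some j

variable {κ σ}

theorem mem_assigned {R : ℕ} {i : Fin n} {j : Fin m} :
    j ∈ assigned κ σ R i ↔ ∃ r < R, asg κ σ r i = some j := by
  simp [assigned]

theorem mem_rem_or_assigned (R : ℕ) (j : Fin m) :
    j ∈ rem κ σ R ∨ ∃ i, j ∈ assigned κ σ R i := by
  induction R with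
  | zero => exact .inl (List.mem_finRange j)
  | succ R ih =>
    rcases ih with h | ⟨i, h⟩
    · by_cases h' : j ∈ rem κ σ (R + 1)
      · exact .inl h'
      · obtain ⟨i, hi⟩ := exists_asg_of_notMem h h'
        exact .inr ⟨i, mem_assigned.2 ⟨R, by omega, hi⟩⟩
    · obtain ⟨r, hr, h⟩ := mem_assigned.1 h
      exact .inr ⟨i, mem_assigned.2 ⟨r, by omega, h⟩⟩

theorem assigned_unique {R : ℕ} {i i' : Fin n} {j : Fin m} (h : j ∈ assigned κ σ R i)
    (h' : j ∈ assigned κ σ R i') : i = i' := by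
  obtain ⟨r, -, h⟩ := mem_assigned.1 h
  obtain ⟨r', -, h'⟩ := mem_assigned.1 h'
  exact (asg_unique h h').1

/-- An index is assigned in one round only, so every assignment enlarges the set of the position,
and the three values of `collect` distinguish no, one and several indices. -/
theorem collected_spec (R : ℕ) (i : Fin n) :
    (collected κ σ (List.finRange m) R i = none ∧ assigned κ σ R i = ∅) ∨
    (∃ j, collected κ σ (List.finRange m) R i = some (some j) ∧ assigned κ σ R i = {j}) ∨
    (collected κ σ (List.finRange m) R i = some none ∧ 1 < (assigned κ σ R i).card) := by
  induction R with
  | zero => left; exact ⟨rfl, by ext; simp [mem_assigned]⟩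
  | succ R ih =>
    have h1 : collected κ σ (List.finRange m) (R + 1) i =
      collect (collected κ σ (List.finRange m) R i) (asg κ σ R i) := rfl
    have h2 : ∀ j, j ∈ assigned κ σ (R + 1) i ↔ j ∈ assigned κ σ R i ∨ asg κ σ R i = some j := by
      intro j
      simp only [mem_assigned]
      constructor
      · rintro ⟨r, hr, h⟩
        rcases Nat.lt_succ_iff_lt_or_eq.1 hr with hr | rfl
        · exact .inl ⟨r, hr, h⟩
        · exact .inr h
      · rintro (⟨r, hr, h⟩ | h)
        · exact ⟨r, by omega, h⟩
        · exact ⟨R, by omega, h⟩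
    rw [h1]
    cases ha : asg κ σ R i with
    | none =>
      have h3 : assigned κ σ (R + 1) i = assigned κ σ R i := by
        ext j; rw [h2, ha]; simp
      rw [h3]; exact ih
    | some j =>
      have h3 : assigned κ σ (R + 1) i = insert j (assigned κ σ R i) := by
        ext j'; rw [h2, ha, Finset.mem_insert]; simp [eq_comm, or_comm]
      have h4 : j ∉ assigned κ σ R i := by
        intro h
        obtain ⟨r, hr, h⟩ := mem_assigned.1 h
        have := (asg_unique h ha).2
        omega
      rw [h3, Finset.card_insert_of_notMem h4]
      rcases ih with ⟨h5, h6⟩ | ⟨j', h5, h6⟩ | ⟨h5, h6⟩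
      · exact .inr (.inl ⟨j, by rw [h5]; rfl, by rw [h6]; simp⟩)
      · exact .inr (.inr ⟨by rw [h5]; rfl, by rw [h6]; simp⟩)
      · exact .inr (.inr ⟨by rw [h5]; rfl, by omega⟩)

section Count

variable {ℓ : ℕ} {fy : Fin ℓ → Fin m} {fc : Fin ℓ → Fin n}

/-- Here `fc t` is the position at which the `t`-th surviving symbol was sent and `fy t` the index
at which it was received. The pairs of true and assigned position carry equal symbols and are
monotone because both the true alignment and the round are; they form a self-matching of `σ`. -/
theorem card_bad_round_le (hfy : StrictMono fy) (hfc : StrictMono fc)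
    (hκ : ∀ t, κ (fy t) = σ (fc t)) {B : ℕ} (hB : ∀ P, IsSelfMatching σ P → P.card ≤ B) (r : ℕ)
    (s : Finset (Fin ℓ)) (hs : ∀ t ∈ s, ∃ i, asg κ σ r i = some (fy t) ∧ i ≠ fc t) :
    s.card ≤ B := by
  classical
  rcases s.eq_empty_or_nonempty with rfl | ⟨t₀, -⟩
  · simp
  have : Nonempty (Fin n) := ⟨fc t₀⟩
  choose! g hg hg' using hs
  have hinj : Set.InjOn (fun t => (fc t, g t)) s := fun t _ t' _ h =>
    hfc.injective (Prod.ext_iff.1 h).1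
  rw [← Finset.card_image_of_injOn hinj]
  refine hB _ ⟨?_, ?_⟩
  · simp only [Finset.mem_image]
    rintro _ ⟨t, ht, rfl⟩
    exact ⟨(hg' t ht).symm, by rw [← hκ, asg_key (hg t ht)]⟩
  · simp only [Finset.mem_image]
    rintro _ ⟨t, ht, rfl⟩ _ ⟨t', ht', rfl⟩
    rw [asg_lt_iff (hg t ht) (hg t' ht'), hfc.lt_iff_lt, hfy.lt_iff_lt]

theorem card_bad_le (hfy : StrictMono fy) (hfc : StrictMono fc)
    (hκ : ∀ t, κ (fy t) = σ (fc t)) {B : ℕ} (hB : ∀ P, IsSelfMatching σ P → P.card ≤ B) (R : ℕ)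
    (s : Finset (Fin ℓ)) (hs : ∀ t ∈ s, ∃ i, fy t ∈ assigned κ σ R i ∧ i ≠ fc t) :
    s.card ≤ R * B := by
  classical
  have h : s ⊆ (Finset.range R).biUnion fun r =>
      s.filter fun t => ∃ i, asg κ σ r i = some (fy t) ∧ i ≠ fc t := by
    intro t ht
    obtain ⟨i, hi, hne⟩ := hs t ht
    obtain ⟨r, hr, h⟩ := mem_assigned.1 hi
    simp only [Finset.mem_biUnion, Finset.mem_range, Finset.mem_filter]
    exact ⟨r, hr, ht, i, h, hne⟩
  refine (Finset.card_le_card h).trans (Finset.card_biUnion_le.trans ?_)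
  refine (Finset.sum_le_card_nsmul _ _ B fun r _ => ?_).trans (by simp)
  exact card_bad_round_le hfy hfc hκ hB r _ fun t ht => (Finset.mem_filter.1 ht).2

/-- The transmitted symbols that were never assigned spell a common subsequence of `σ` and the
remaining marks, to which `mul_length_le` applies. -/
theorem card_survivors_le (hfy : StrictMono fy) (hfc : StrictMono fc)
    (hκ : ∀ t, κ (fy t) = σ (fc t)) (R : ℕ) (s : Finset (Fin ℓ))
    (hs : ∀ t ∈ s, fy t ∈ rem κ σ R) : R * s.card ≤ m := by
  classical
  set ts := (List.finRange ℓ).filter (· ∈ s) with hts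
  have hlen : ts.length = s.card := by
    rw [← List.toFinset_card_of_nodup ((List.nodup_finRange ℓ).filter _)]
    congr 1
    ext t; simp
  have hsort : ts.Pairwise (· < ·) := (List.pairwise_lt_finRange ℓ).sublist List.filter_sublist
  have h1 : (ts.map fc).Sublist (List.finRange n) := by
    refine List.sublist_of_subperm_of_pairwise (r := (· < ·)) ?_ ?_ (List.pairwise_lt_finRange n)
    · exact List.subperm_of_subset ((List.pairwise_map.2 (hsort.imp fun h => (hfc h).ne)))
        fun i _ => List.mem_finRange i
    · exact List.pairwise_map.2 (hsort.imp fun h => hfc h)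
  have h2 : (ts.map fy).Sublist (rem κ σ R) := by
    refine List.sublist_of_subperm_of_pairwise (r := (· < ·)) ?_ ?_ (rem_pairwise κ σ R)
    · refine List.subperm_of_subset ((List.pairwise_map.2 (hsort.imp fun h => (hfy h).ne))) ?_
      intro j hj
      obtain ⟨t, ht, rfl⟩ := List.mem_map.1 hj
      exact hs t (by simpa [hts] using ht)
    · exact List.pairwise_map.2 (hsort.imp fun h => hfy h)
  rw [← hlen, ← List.length_map (f := fun t => σ (fc t))]
  refine mul_length_le (κ := κ) (σ := σ) R _ ?_ ?_
  · rw [List.ofFn_eq_map]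
    simpa [Function.comp_def] using h1.map σ
  · simpa [Function.comp_def, hκ] using h2.map κ

/-- The word that the decoder hands to the half-error decoder. -/
def decodedWord {β S : Type} (f : Fin n → β → S) (a : Fin n → Option (Option β)) (i : Fin n) :
    Option S := (a i).elim none (Option.map (f i))

/-- A charging argument. An erasure needs one charge and a substitution two: one because the right
symbol is missing, one because a wrong symbol is present. A missing symbol was deleted, never
assigned, or assigned elsewhere; a wrong symbol was inserted or sent from another position.
Misassigned symbols can be charged twice, at their true and at their assigned position, hence the
factor `2` of `R * B`. -/
theorem halfErrors_decodedWord_le {S : Type} (c : Fin n → S) (f : Fin n → Fin m → S)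
    (hfy : StrictMono fy) (hfc : StrictMono fc)
    (hκ : ∀ t, κ (fy t) = σ (fc t)) (hf : ∀ t, f (fc t) (fy t) = c (fc t))
    {B : ℕ} (hB : ∀ P, IsSelfMatching σ P → P.card ≤ B) (R : ℕ) :
    ∃ U, R * U ≤ m ∧
      halfErrors c (decodedWord f (collected κ σ (List.finRange m) R)) + 2 * ℓ ≤
        n + m + U + 2 * (R * B) := by
  classical
  set z := decodedWord f (collected κ σ (List.finRange m) R) with hz
  set A := assigned κ σ R with hA
  set U := Finset.univ.filter fun t => fy t ∈ rem κ σ R with hU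
  set T3 := Finset.univ.filter fun t => ∃ i, fy t ∈ A i ∧ i ≠ fc t with hT3
  refine ⟨U.card, card_survivors_le hfy hfc hκ R U (by simp [hU]), ?_⟩
  have hbad : T3.card ≤ R * B := card_bad_le hfy hfc hκ hB R T3 (by simp [hT3, hA])
  -- `N` consists of the deleted positions and `X` of the inserted symbols; they account for `n - ℓ`
  -- and `m - ℓ`.
  set N := Finset.univ.filter fun i => i ∉ Set.range fc with hN
  set X := Finset.univ.filter fun j => j ∉ Set.range fy with hX
  have hNc : N.card + ℓ = n := by
    have h1 : (Finset.univ.image fc).card = ℓ := by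
      rw [Finset.card_image_of_injective _ hfc.injective]; simp
    have h2 : N = (Finset.univ.image fc)ᶜ := by ext; simp [hN]
    have h3 := Finset.card_compl_add_card (Finset.univ.image fc)
    rw [h1, ← h2, Fintype.card_fin] at h3
    exact h3
  have hXc : X.card + ℓ = m := by
    have h1 : (Finset.univ.image fy).card = ℓ := by
      rw [Finset.card_image_of_injective _ hfy.injective]; simp
    have h2 : X = (Finset.univ.image fy)ᶜ := by ext; simp [hX]
    have h3 := Finset.card_compl_add_card (Finset.univ.image fy)
    rw [h1, ← h2, Fintype.card_fin] at h3
    exact h3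
  -- the five sources of half-errors at a position
  set F2 := fun i => U.filter fun t => fc t = i
  set F3 := fun i => T3.filter fun t => fc t = i
  set F4 := fun i => X.filter fun j => j ∈ A i
  set F5 := fun i => T3.filter fun t => fy t ∈ A i ∧ fc t ≠ i
  have s1 : ∑ i, (if i ∈ N then 1 else 0) = N.card := by simp
  have s2 : ∑ i, (F2 i).card = U.card :=
    (Finset.card_eq_sum_card_fiberwise (fun t _ => Finset.mem_univ (fc t))).symm
  have s3 : ∑ i, (F3 i).card = T3.card :=
    (Finset.card_eq_sum_card_fiberwise (fun t _ => Finset.mem_univ (fc t))).symm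
  -- Each index is assigned to at most one position, so these sets are disjoint for different `i`.
  have s4 : ∑ i, (F4 i).card ≤ X.card := by
    rw [← Finset.card_biUnion]
    · exact Finset.card_le_card fun j hj => by
        obtain ⟨i, -, h⟩ := Finset.mem_biUnion.1 hj
        exact (Finset.mem_filter.1 h).1
    · intro i _ i' _ hne
      refine Finset.disjoint_left.2 fun j h h' => hne ?_
      exact assigned_unique (Finset.mem_filter.1 h).2 (Finset.mem_filter.1 h').2
  have s5 : ∑ i, (F5 i).card ≤ T3.card := by
    rw [← Finset.card_biUnion]
    · exact Finset.card_le_card fun j hj => by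
        obtain ⟨i, -, h⟩ := Finset.mem_biUnion.1 hj
        exact (Finset.mem_filter.1 h).1
    · intro i _ i' _ hne
      refine Finset.disjoint_left.2 fun j h h' => hne ?_
      exact assigned_unique (Finset.mem_filter.1 h).2.1 (Finset.mem_filter.1 h').2.1
  have hcost : ∀ i, 2 * (if z i ≠ none ∧ z i ≠ some (c i) then 1 else 0) +
      (if z i = none then 1 else 0) ≤
      (if i ∈ N then 1 else 0) + (F2 i).card + (F3 i).card + (F4 i).card + (F5 i).card := by
    intro i
    -- a missing position
    have hmiss : (∀ t, fc t = i → fy t ∉ A i) →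
        1 ≤ (if i ∈ N then 1 else 0) + (F2 i).card + (F3 i).card := by
      intro h
      by_cases hi : i ∈ N
      · simp [hi]; omega
      · simp only [hN, Finset.mem_filter, Finset.mem_univ, true_and, not_not] at hi
        obtain ⟨t, rfl⟩ := hi
        rcases mem_rem_or_assigned (κ := κ) (σ := σ) R (fy t) with h1 | ⟨i', h1⟩
        · have : t ∈ F2 (fc t) := by simp [F2, hU, h1]
          have := Finset.card_pos.2 ⟨t, this⟩
          omega
        · have hne : i' ≠ fc t := by rintro rfl; exact h t rfl h1
          have : t ∈ F3 (fc t) := by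
            simp only [F3, hT3, Finset.mem_filter, Finset.mem_univ, true_and, and_true]
            exact ⟨i', h1, hne⟩
          have := Finset.card_pos.2 ⟨t, this⟩
          omega
    -- a wrong symbol
    have hwrong : ∀ j ∈ A i, (∀ t, fc t = i → fy t ≠ j) → 1 ≤ (F4 i).card + (F5 i).card := by
      intro j hj h
      by_cases hjX : j ∈ X
      · have : j ∈ F4 i := Finset.mem_filter.2 ⟨hjX, hj⟩
        have := Finset.card_pos.2 ⟨j, this⟩
        omega
      · simp only [hX, Finset.mem_filter, Finset.mem_univ, true_and, not_not] at hjX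
        obtain ⟨t, rfl⟩ := hjX
        have hne : fc t ≠ i := fun h1 => h t h1 rfl
        have : t ∈ F5 i := by
          simp only [F5, hT3, Finset.mem_filter, Finset.mem_univ, true_and]
          exact ⟨⟨i, hj, hne.symm⟩, hj, hne⟩
        have := Finset.card_pos.2 ⟨t, this⟩
        omega
    rcases collected_spec (κ := κ) (σ := σ) R i with ⟨h1, h2⟩ | ⟨j, h1, h2⟩ | ⟨h1, h2⟩
    · have h3 : z i = none := by simp [hz, decodedWord, h1]
      have := hmiss fun t _ => by rw [hA, h2]; simp
      simp only [h3, ne_eq, not_true_eq_false, false_and, if_false, if_true]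
      omega
    · have h3 : z i = some (f i j) := by simp [hz, decodedWord, h1]
      by_cases h4 : f i j = c i
      · simp [h3, h4]
      · have h5 : ∀ t, fc t = i → fy t ≠ j := by
          rintro t rfl rfl; exact h4 (hf t)
        have h6 := hmiss fun t ht => by
          rw [hA, h2, Finset.mem_singleton]; exact h5 t ht
        have h7 := hwrong j (by rw [hA, h2]; simp) h5
        simp only [h3, ne_eq, reduceCtorEq, not_false_eq_true, Option.some.injEq, h4, and_self,
          if_true, if_false]
        omega
    · have h3 : z i = none := by simp [hz, decodedWord, h1]
      have : 1 ≤ (if i ∈ N then 1 else 0) + (F2 i).card + (F3 i).card + (F4 i).card +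
          (F5 i).card := by
        -- With several symbols, either the right one is absent, or one of the others is wrong; one
        -- charge is enough for the erasure.
        by_cases h4 : ∃ t, fc t = i ∧ fy t ∈ A i
        · obtain ⟨t, ht, ht'⟩ := h4
          obtain ⟨j, hj, hne⟩ := Finset.exists_mem_ne h2 (fy t)
          have := hwrong j hj fun t' ht2 => by
            rw [hfc.injective (ht2.trans ht.symm)]; exact hne.symm
          omega
        · have := hmiss fun t ht ht' => h4 ⟨t, ht, ht'⟩
          omega
      simp only [h3, ne_eq, not_true_eq_false, false_and, if_false, if_true]
      omega
  have hsum := Finset.sum_le_sum fun i (_ : i ∈ Finset.univ) => hcost i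
  simp only [Finset.sum_add_distrib, ← Finset.mul_sum] at hsum
  rw [s1, s2, s3] at hsum
  rw [halfErrors]
  simp only [Finset.card_filter]
  omega

end Count

end Correct

end PayloadCode

namespace PayloadCode

/-! ## Edit distance -/

theorem exists_lcs {S : Type} (x y : List S) :
    ∃ (f : Fin (lcsLength x y) → Fin x.length) (g : Fin (lcsLength x y) → Fin y.length),
      StrictMono f ∧ StrictMono g ∧ ∀ t, x.get (f t) = y.get (g t) := by
  have h : lcsLength x y ∈ {l | ∃ z : List S, z.Sublist x ∧ z.Sublist y ∧ z.length = l} := by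
    refine Nat.sSup_mem ⟨0, [], by simp⟩ ⟨x.length, ?_⟩
    rintro _ ⟨z, hz, -, rfl⟩
    exact hz.length_le
  obtain ⟨z, hx, hy, hl⟩ := h
  obtain ⟨f, hf⟩ := List.sublist_iff_exists_fin_orderEmbedding_get_eq.1 hx
  obtain ⟨g, hg⟩ := List.sublist_iff_exists_fin_orderEmbedding_get_eq.1 hy
  rw [← hl]
  exact ⟨f, g, f.strictMono, g.strictMono, fun t => (hf t).symm.trans (hg t)⟩

section Decode

variable {Smsg Ssyn : Type} [AddCommGroup Smsg] {n : ℕ}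

/-- The word handed to the half-error decoder by `R` rounds of alignment with `σ`. -/
noncomputable def unmask (R : ℕ) (σ : Fin n → Ssyn) (mask : Fin n → Smsg)
    (y : List (Smsg × Ssyn)) : Fin n → Option Smsg :=
  decodedWord (fun i b => b.1 - mask i) (collected Prod.snd σ y R)

/-- The true alignment is taken to be a longest common subsequence of the two words, so that the
deletions and insertions add up to the edit distance. -/
theorem halfErrors_unmask_le (R : ℕ) (w : Fin n → Smsg × Ssyn) (mask : Fin n → Smsg)
    (y : List (Smsg × Ssyn)) {B : ℕ}
    (hB : ∀ P, IsSelfMatching (fun i => (w i).2) P → P.card ≤ B) :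
    ∃ U, R * U ≤ y.length ∧
      halfErrors (fun i => (w i).1 - mask i) (unmask R (fun i => (w i).2) mask y) ≤
        editDist y (List.ofFn w) + U + 2 * (R * B) := by
  obtain ⟨fy, fc, hfy, hfc, h⟩ := exists_lcs y (List.ofFn w)
  set κ : Fin y.length → Ssyn := fun j => (y.get j).2 with hκ
  set fc' : Fin (lcsLength y (List.ofFn w)) → Fin n := fun t => (fc t).cast (by simp) with hfc'
  have h' : ∀ t, y.get (fy t) = w (fc' t) := fun t => by rw [h, List.get_ofFn]
  obtain ⟨U, hU, h1⟩ := halfErrors_decodedWord_le (κ := κ) (σ := fun i => (w i).2)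
    (fun i => (w i).1 - mask i) (fun i j => (y.get j).1 - mask i) hfy (fc := fc')
    (fun s t hst => hfc hst) (fun t => by rw [hκ]; simp only [h'])
    (fun t => by simp only [h']) hB R
  refine ⟨U, hU, ?_⟩
  have h2 : unmask R (fun i => (w i).2) mask y = decodedWord (fun i j => (y.get j).1 - mask i)
      (collected κ (fun i => (w i).2) (List.finRange y.length) R) := by
    funext i
    rw [unmask, decodedWord, decodedWord]
    -- `y` is the image of the list of its indices, and `collected_map` passes from symbols to
    -- indices.
    conv_lhs => rw [← List.map_get_finRange y]
    rw [collected_map]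
    cases collected κ (fun i => (w i).2) (List.finRange y.length) R i with
    | none => rfl
    | some o => cases o <;> rfl
  rw [h2, editDist, List.length_ofFn]
  omega

theorem PTF.unmask [Fintype Smsg] [Fintype Ssyn] {ι : Type*} {e : ι → Data} {n : ι → ℕ}
    {σ : ∀ i, Fin (n i) → Ssyn} {mask : ∀ i, Fin (n i) → Smsg} {y : ι → List (Smsg × Ssyn)}
    (hσ : PTF e fun i => encVec (σ i)) (hm : PTF e fun i => encVec (mask i))
    (hy : PTF e fun i => encList (y i)) (R : ℕ) :
    PTF e fun i => encVec (unmask R (σ i) (mask i) (y i)) := by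
  have h := (PTF.rounds Prod.snd hσ hy R).2
  exact PTF.vecMap₂ (fun (a : Option (Option (Smsg × Ssyn))) (c : Smsg) =>
    (a.elim none (Option.map fun b => b.1 - c))) h hm

/-- Since `p ≤ 1`, the received word has length at most `2 N`, so at most `2 N / R ≤ δ N / 2`
symbols stay unassigned. Misassignments number at most `(5/δ) (δ²/20) N = δ N / 4` and count twice.
Together this is `δ N`. -/
theorem halfErrors_unmask_le_of_synchronized {N : ℕ} {δ p : ℝ} (hδ : 0 < δ)
    (hp : p ≤ 1) {R : ℕ} (hR : 4 / δ ≤ R) (hR' : R ≤ 5 / δ)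
    (x : Fin N → Smsg × Ssyn) (mask : Fin N → Smsg) (y : List (Smsg × Ssyn))
    (hx : ¬ ∃ P, IsSelfMatching (fun i => (x i).2) P ∧ P.card = ⌈δ ^ 2 / 20 * N⌉₊)
    (hy : (editDist y (List.ofFn x) : ℝ) ≤ p * N) :
    (halfErrors (fun i => (x i).1 - mask i) (unmask R (fun i => (x i).2) mask y) : ℝ) ≤
      (p + δ) * N := by
  set b := ⌈δ ^ 2 / 20 * N⌉₊ with hb
  -- Subsets of self-matchings are self-matchings, so excluding the size `b` excludes all larger
  -- sizes.
  have hlt : ∀ P, IsSelfMatching (fun i => (x i).2) P → P.card < b := by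
    intro P hP
    by_contra h
    obtain ⟨Q, hQ, hQc⟩ := Finset.exists_subset_card_eq (not_lt.1 h)
    exact hx ⟨Q, ⟨fun p hp => hP.1 p (hQ hp), fun p hp q hq => hP.2 p (hQ hp) q (hQ hq)⟩, hQc⟩
  -- The empty matching would have size `0`; in particular `hx` rules out `N = 0`.
  have hb0 : 0 < b := (Nat.zero_le _).trans_lt (hlt ∅ ⟨by simp, by simp⟩)
  obtain ⟨U, hU, h1⟩ := halfErrors_unmask_le R x mask y (B := b - 1) fun P hP => by
    have := hlt P hP; omega
  -- The strict bound `b - 1` absorbs the rounding, so no additive constant appears.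
  have hb1 : ((b - 1 : ℕ) : ℝ) ≤ δ ^ 2 / 20 * N := by
    have := Nat.ceil_lt_add_one (a := δ ^ 2 / 20 * N) (by positivity)
    rw [← hb] at this
    rw [Nat.cast_sub hb0]
    push_cast
    linarith
  have hylen : y.length ≤ editDist y (List.ofFn x) + N := by
    obtain ⟨f, g, hf, hg, -⟩ := exists_lcs y (List.ofFn x)
    have := Fintype.card_le_of_injective _ hg.injective
    simp only [Fintype.card_fin, List.length_ofFn] at this
    rw [editDist, List.length_ofFn]
    omega
  have hylen' : (y.length : ℝ) ≤ 2 * N := by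
    have : (y.length : ℝ) ≤ editDist y (List.ofFn x) + N := by exact_mod_cast hylen
    have hN : (0 : ℝ) ≤ N := Nat.cast_nonneg N
    nlinarith
  have hU' : (U : ℝ) ≤ δ / 2 * N := by
    have h2 : (R : ℝ) * U ≤ y.length := by exact_mod_cast hU
    have h3 : 4 / δ * U ≤ 2 * N :=
      (mul_le_mul_of_nonneg_right hR (Nat.cast_nonneg U)).trans (h2.trans hylen')
    rw [div_mul_eq_mul_div, div_le_iff₀ hδ] at h3
    linarith
  have hRB : (R : ℝ) * (b - 1 : ℕ) ≤ δ / 4 * N := by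
    calc (R : ℝ) * (b - 1 : ℕ) ≤ 5 / δ * (δ ^ 2 / 20 * N) := by gcongr
      _ = δ / 4 * N := by field_simp; ring
  have h1' : (halfErrors (fun i => (x i).1 - mask i) (unmask R (fun i => (x i).2) mask y) : ℝ) ≤
      editDist y (List.ofFn x) + U + 2 * (R * (b - 1 : ℕ)) := by exact_mod_cast h1
  linarith

end Decode

/-! ## Self-matchings of random words -/

section Random

open Finset

/-- An order embedding of `Fin k` is determined by its image. -/
theorem card_strictMono_le (k n : ℕ) : Nat.card (Fin k ↪o Fin n) ≤ n.choose k := by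
  have h : Function.Injective fun a : Fin k ↪o Fin n =>
      (⟨univ.map a.toEmbedding, by simp [mem_powersetCard]⟩ :
        powersetCard k (univ : Finset (Fin n))) := by
    intro a b hab
    replace hab : univ.map a.toEmbedding = univ.map b.toEmbedding := congrArg Subtype.val hab
    have hc : (univ.map a.toEmbedding).card = k := by simp
    rw [Finset.orderEmbOfFin_unique' hc (f := a) (by simp),
      Finset.orderEmbOfFin_unique' hc (f := b) (fun t => by rw [hab]; simp)]
  have := Nat.card_le_card_of_injective _ h
  simpa using this

variable {K : Type} [Fintype K] {k n : ℕ}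

open Classical in
-- The symbol at the later of the positions `a t`, `b t` is equal to the symbol at the earlier one.
-- The later positions are `k` distinct ones, as the maximum of two strictly monotone maps is
-- strictly monotone, and so the other `n - k` symbols determine `σ`.
theorem card_agree_le (a b : Fin k ↪o Fin n) (hab : ∀ t, a t ≠ b t) :
    #{σ : Fin n → K | ∀ t, σ (a t) = σ (b t)} * Fintype.card K ^ k ≤ Fintype.card K ^ n := by
  set mx : Fin k → Fin n := fun t => max (a t) (b t) with hmx
  have hmono : StrictMono mx := fun s t hst => max_lt_max (a.strictMono hst) (b.strictMono hst)
  set I : Finset (Fin n) := univ.image mx with hI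
  have hIc : I.card = k := by
    rw [hI, card_image_of_injective _ hmono.injective]; simp
  set X := {σ : Fin n → K // ∀ t, σ (a t) = σ (b t)}
  have hinj : Function.Injective fun (σ : X) (i : {i // i ∉ I}) => σ.1 i := by
    rintro ⟨σ, hσ⟩ ⟨τ, hτ⟩ h
    refine Subtype.ext (funext fun i => ?_)
    change σ i = τ i
    -- Reconstruction from left to right: a position of `I` copies an earlier position.
    induction i using WellFoundedLT.induction with
    | ind i ih =>
      by_cases hi : i ∈ I
      · obtain ⟨t, -, rfl⟩ := mem_image.1 hi
        rcases lt_or_gt_of_ne (hab t) with hlt | hlt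
        · have h1 : mx t = b t := max_eq_right hlt.le
          rw [h1, ← hσ, ← hτ]
          exact ih _ (by rw [h1]; exact hlt)
        · have h1 : mx t = a t := max_eq_left hlt.le
          rw [h1, hσ, hτ]
          exact ih _ (by rw [h1]; exact hlt)
      · exact congrFun h ⟨i, hi⟩
  have h1 := Fintype.card_le_of_injective _ hinj
  have h2 : Fintype.card {i // i ∉ I} = n - k := by
    rw [Fintype.card_subtype_compl]; simp [hIc]
  rw [Fintype.card_fun, h2, Fintype.card_subtype] at h1
  have hkn : k ≤ n := by rw [← hIc]; simpa using card_le_univ I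
  calc _ ≤ Fintype.card K ^ (n - k) * Fintype.card K ^ k := Nat.mul_le_mul_right _ h1
    _ = _ := by rw [← pow_add, Nat.sub_add_cancel hkn]

/-- The pairs, listed by first coordinate, have increasing second coordinates as well. -/
theorem IsSelfMatching.exists_orderEmb {K : Type} {σ : Fin n → K} {P : Finset (Fin n × Fin n)}
    (h : IsSelfMatching σ P) (hk : P.card = k) :
    ∃ a b : Fin k ↪o Fin n, (∀ t, a t ≠ b t) ∧ ∀ t, σ (a t) = σ (b t) := by
  have hinj : Set.InjOn Prod.fst (P : Set (Fin n × Fin n)) := by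
    intro p hp q hq hpq
    have h1 := h.2 p hp q hq
    have h2 := h.2 q hq p hp
    refine Prod.ext hpq ?_
    rw [hpq] at h1 h2
    simp only [lt_irrefl, false_iff, not_lt] at h1 h2
    exact le_antisymm h2 h1
  have hc : (P.image Prod.fst).card = k := by rw [card_image_of_injOn hinj, hk]
  set a := (P.image Prod.fst).orderEmbOfFin hc
  have ha : ∀ t, ∃ p ∈ P, p.1 = a t := fun t => by
    exact mem_image.1 ((P.image Prod.fst).orderEmbOfFin_mem hc t)
  choose p hp hpa using ha
  refine ⟨a, OrderEmbedding.ofStrictMono (fun t => (p t).2) fun s t hst => ?_, ?_, ?_⟩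
  · refine (h.2 _ (hp s) _ (hp t)).1 ?_
    rw [hpa, hpa]; exact a.strictMono hst
  · intro t
    rw [← hpa]; exact (h.1 _ (hp t)).1
  · intro t
    rw [← hpa]; exact (h.1 _ (hp t)).2

open Classical in
-- Union bound over the pairs of order embeddings.
theorem card_selfMatching_le :
    #{σ : Fin n → K | ∃ P, IsSelfMatching σ P ∧ P.card = k} * Fintype.card K ^ k ≤
      n.choose k ^ 2 * Fintype.card K ^ n := by
  set E := univ.filter fun ab : (Fin k ↪o Fin n) × (Fin k ↪o Fin n) => ∀ t, ab.1 t ≠ ab.2 t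
  have h : univ.filter (fun σ : Fin n → K => ∃ P, IsSelfMatching σ P ∧ P.card = k) ⊆
      E.biUnion fun ab => univ.filter fun σ : Fin n → K => ∀ t, σ (ab.1 t) = σ (ab.2 t) := by
    intro σ hσ
    obtain ⟨P, hP, hk⟩ := (mem_filter.1 hσ).2
    obtain ⟨a, b, h1, h2⟩ := hP.exists_orderEmb hk
    simp only [mem_biUnion, mem_filter, mem_univ, true_and, E]
    exact ⟨(a, b), h1, h2⟩
  have hE : E.card ≤ n.choose k ^ 2 := by
    refine (card_le_univ E).trans ?_
    rw [Fintype.card_prod, ← Nat.card_eq_fintype_card, sq]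
    exact Nat.mul_le_mul (card_strictMono_le k n) (card_strictMono_le k n)
  calc _ ≤ (∑ ab ∈ E, #{σ : Fin n → K | ∀ t, σ (ab.1 t) = σ (ab.2 t)}) * Fintype.card K ^ k :=
        Nat.mul_le_mul_right _ ((card_le_card h).trans card_biUnion_le)
    _ = ∑ ab ∈ E, #{σ : Fin n → K | ∀ t, σ (ab.1 t) = σ (ab.2 t)} * Fintype.card K ^ k :=
        sum_mul _ _ _
    _ ≤ ∑ ab ∈ E, Fintype.card K ^ n :=
        sum_le_sum fun ab hab => card_agree_le ab.1 ab.2 (mem_filter.1 hab).2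
    _ ≤ _ := by rw [sum_const, smul_eq_mul]; exact Nat.mul_le_mul_right _ hE

/-- From `n ≤ k/ε` and `k^k / k! ≤ e^k`. -/
theorem choose_le_of_le {ε : ℝ} (hε : 0 < ε) (h : ε * n ≤ k) :
    (n.choose k : ℝ) ≤ (Real.exp 1 / ε) ^ k := by
  refine (Nat.choose_le_pow_div k n).trans ?_
  have h1 : (n : ℝ) ≤ k / ε := by rw [le_div_iff₀ hε]; linarith
  have h2 := Real.pow_div_factorial_le_exp (x := k) (by positivity) k
  calc (n : ℝ) ^ k / k.factorial ≤ (k / ε) ^ k / k.factorial := by gcongr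
    _ = (k : ℝ) ^ k / k.factorial / ε ^ k := by rw [div_pow]; ring
    _ ≤ Real.exp k / ε ^ k := by gcongr
    _ = _ := by rw [div_pow, ← Real.exp_nat_mul, mul_one]

open Classical in
/-- The fraction of words that have a self-matching of size `k` is at most `2 ^ (-k)`. -/
theorem card_selfMatching_le_two_pow [Nonempty K] {ε : ℝ} (hε : 0 < ε) (h : ε * n ≤ k)
    (hK : 16 / ε ^ 2 ≤ Fintype.card K) :
    (#{σ : Fin n → K | ∃ P, IsSelfMatching σ P ∧ P.card = k} : ℝ) ≤
      (1 / 2) ^ k * Fintype.card K ^ n := by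
  have h1 : (#{σ : Fin n → K | ∃ P, IsSelfMatching σ P ∧ P.card = k} : ℝ) * Fintype.card K ^ k ≤
      n.choose k ^ 2 * Fintype.card K ^ n := by exact_mod_cast card_selfMatching_le
  have hq : (0 : ℝ) < Fintype.card K := by exact_mod_cast Fintype.card_pos
  have h2 : ((n.choose k : ℝ)) ^ 2 ≤ ((1 / 2) * Fintype.card K) ^ k := by
    have h3 := choose_le_of_le hε h
    calc ((n.choose k : ℝ)) ^ 2 ≤ ((Real.exp 1 / ε) ^ k) ^ 2 := by gcongr
      _ = ((Real.exp 1) ^ 2 / ε ^ 2) ^ k := by rw [← pow_mul, mul_comm, pow_mul, div_pow]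
      _ ≤ _ := by
        gcongr
        -- The constant `16` is `2 · 8`: it makes `e²/ε²` at most half the alphabet size, which
        -- leaves `(1/2)^k`.
        have h4 : Real.exp 1 ^ 2 ≤ 8 := by
          have := Real.exp_one_lt_d9
          have := Real.exp_pos 1
          nlinarith
        calc Real.exp 1 ^ 2 / ε ^ 2 ≤ 8 / ε ^ 2 := by gcongr
          _ = 1 / 2 * (16 / ε ^ 2) := by ring
          _ ≤ _ := by gcongr
  rw [mul_pow] at h2
  have hqk : (0 : ℝ) < (Fintype.card K : ℝ) ^ k := by positivity
  have h5 := mul_le_mul_of_nonneg_right h2 (le_of_lt (pow_pos hq n))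
  refine le_of_mul_le_mul_right ?_ hqk
  calc _ ≤ _ := h1
    _ ≤ _ := h5
    _ = _ := by ring

end Random

/-! ## Uniform distributions -/

section Uniform

variable {α β : Type}

theorem prob_map (P : PMF α) (f : α → β) (E : Set β) : prob (P.map f) E = prob P (f ⁻¹' E) := by
  rw [prob, prob, PMF.toOuterMeasure_map_apply]

theorem prob_ne_top (P : PMF α) (E : Set α) : P.toOuterMeasure E ≠ ⊤ := by
  refine ne_top_of_le_ne_top ENNReal.one_ne_top ?_
  rw [PMF.toOuterMeasure_apply, ← P.tsum_coe]
  exact ENNReal.tsum_le_tsum fun a => Set.indicator_le_self _ _ _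

theorem prob_mono (P : PMF α) {E F : Set α} (h : E ⊆ F) : prob P E ≤ prob P F :=
  ENNReal.toReal_mono (prob_ne_top P F) (P.toOuterMeasure.mono h)

open Classical in
theorem prob_uniform [Fintype α] [Nonempty α] (E : Set α) :
    prob (PMF.uniformOfFintype α) E =
      ((Finset.univ.filter (· ∈ E)).card : ℝ) / Fintype.card α := by
  rw [prob, PMF.toOuterMeasure_uniformOfFintype_apply, ENNReal.toReal_div,
    ENNReal.toReal_natCast, ENNReal.toReal_natCast, Fintype.card_subtype]

theorem uniform_map_equiv [Fintype α] [Nonempty α] [Fintype β] [Nonempty β] (e : α ≃ β) :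
    (PMF.uniformOfFintype α).map e = PMF.uniformOfFintype β := by
  ext b
  rw [PMF.map_apply, tsum_eq_single (e.symm b)]
  · simp [Fintype.card_congr e]
  · intro a ha
    rw [if_neg]
    rintro rfl
    simp at ha

theorem uniform_prod [Fintype α] [Nonempty α] [Fintype β] [Nonempty β] :
    PMF.uniformOfFintype (α × β) = (PMF.uniformOfFintype α).bind fun a =>
      (PMF.uniformOfFintype β).map fun b => (a, b) := by
  ext ⟨a, b⟩
  rw [PMF.bind_apply, tsum_eq_single a]
  · rw [PMF.map_apply, tsum_eq_single b]
    · simp [ENNReal.mul_inv]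
    · intro b' hb'
      rw [if_neg]
      rintro h
      exact hb' (Prod.ext_iff.1 h).2.symm
  · intro a' ha'
    rw [PMF.map_apply]
    simp [ha'.symm]

theorem uniform_map_snd [Fintype α] [Nonempty α] [Fintype β] [Nonempty β] :
    (PMF.uniformOfFintype (α × β)).map Prod.snd = PMF.uniformOfFintype β := by
  rw [uniform_prod, PMF.map_bind]
  simp only [PMF.map_comp, Function.comp_def]
  rw [PMF.bind_const]
  exact PMF.map_id _

theorem uniform_map_snd_comp [Fintype α] [Nonempty α] [Fintype β] [Nonempty β] {n : ℕ} :
    (PMF.uniformOfFintype (Fin n → α × β)).map (fun w i => (w i).2) =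
      PMF.uniformOfFintype (Fin n → β) := by
  rw [← uniform_map_snd (α := Fin n → α) (β := Fin n → β), ← uniform_map_equiv
    (Equiv.arrowProdEquivProdArrow (Fin n) (fun _ => α) (fun _ => β)), PMF.map_comp]
  rfl

end Uniform

/-! ## Uniformity and robustness of the code -/

section Robust

variable {Smsg Ssyn A : Type} [AddCommGroup Smsg] [Fintype Smsg] [AddCommGroup Ssyn]
  [Fintype Ssyn] [Fintype A] [Nonempty A] {M d₁ d₂ r n : ℕ → ℕ}
  {enc : ∀ k, Fin (M k) → Fin (n k) → Smsg}
  {Gsyn : ∀ k, (Fin (d₁ k) → Bool) → Fin (n k) → Ssyn}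
  {Gmsg : ∀ k, (Fin (d₂ k) → Bool) → Fin (n k) → Smsg}
  {parse : ∀ k, (Fin (r k) → A) → Fin (n k) → Smsg × Ssyn}

theorem loadCode_uniform (hparse : ∀ k, (PMF.uniformOfFintype (Fin (r k) → A)).map (parse k) =
    PMF.uniformOfFintype (Fin (n k) → Smsg × Ssyn)) (k : ℕ) (a : Fin (M k))
    (s : Fin (d₁ k + d₂ k) → Bool) :
    (PMF.uniformOfFintype (Fin (r k) → A)).map
        (fun shift => loadCode enc Gsyn Gmsg parse k a s shift) =
      PMF.uniformOfFintype (Fin (n k) → Smsg × Ssyn) := by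
  -- The fixed word by which the parsed shift is translated.
  set u : Fin (n k) → Smsg × Ssyn := fun i => (enc k a i + Gmsg k (seedMsg s) i,
    Gsyn k (seedSyn s) i)
  rw [← uniform_map_equiv (Equiv.addLeft u), ← hparse, PMF.map_comp]
  rfl

/-- For a fixed seed a word without large self-matchings is used with high probability. -/
theorem prob_synchronized (hparse : ∀ k, (PMF.uniformOfFintype (Fin (r k) → A)).map (parse k) =
    PMF.uniformOfFintype (Fin (n k) → Smsg × Ssyn)) {ε : ℝ} (hε : 0 < ε)
    (hK : 16 / ε ^ 2 ≤ Fintype.card Ssyn) (k : ℕ) (a : Fin (M k)) :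
    1 - (1 / 2) ^ ⌈ε * n k⌉₊ ≤
      prob (PMF.uniformOfFintype ((Fin (d₁ k + d₂ k) → Bool) × (Fin (r k) → A)))
        {x | ¬ ∃ P, IsSelfMatching (fun i => (loadCode enc Gsyn Gmsg parse k a x.1 x.2 i).2) P ∧
          P.card = ⌈ε * n k⌉₊} := by
  classical
  -- The synchronization word is uniform for each seed, hence also for a random seed. The security
  -- of the generators plays no part in robustness.
  have h1 : (PMF.uniformOfFintype ((Fin (d₁ k + d₂ k) → Bool) × (Fin (r k) → A))).map
      (fun x i => (loadCode enc Gsyn Gmsg parse k a x.1 x.2 i).2) =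
      PMF.uniformOfFintype (Fin (n k) → Ssyn) := by
    rw [uniform_prod, PMF.map_bind, ← PMF.bind_const
      (PMF.uniformOfFintype (Fin (d₁ k + d₂ k) → Bool)) (PMF.uniformOfFintype (Fin (n k) → Ssyn))]
    congr 1
    funext s
    rw [PMF.map_comp, ← uniform_map_snd_comp (α := Smsg) (β := Ssyn), ← loadCode_uniform hparse k a s,
      PMF.map_comp]
    rfl
  set E := {σ : Fin (n k) → Ssyn | ¬ ∃ P, IsSelfMatching σ P ∧ P.card = ⌈ε * n k⌉₊} with hE
  have h2 := prob_map (PMF.uniformOfFintype ((Fin (d₁ k + d₂ k) → Bool) × (Fin (r k) → A)))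
    (fun x i => (loadCode enc Gsyn Gmsg parse k a x.1 x.2 i).2) E
  rw [h1, prob_uniform] at h2
  refine le_of_le_of_eq ?_ h2
  have h3 := card_selfMatching_le_two_pow (K := Ssyn) (n := n k) hε (Nat.le_ceil _) hK
  have hq : (0 : ℝ) < Fintype.card (Fin (n k) → Ssyn) := by exact_mod_cast Fintype.card_pos
  rw [le_div_iff₀ hq]
  have h4 := Finset.card_filter_add_card_filter_not (s := (Finset.univ : Finset (Fin (n k) → Ssyn)))
    (fun σ => ∃ P, IsSelfMatching σ P ∧ P.card = ⌈ε * n k⌉₊)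
  rw [Finset.card_univ] at h4
  have h5 : ((Fintype.card (Fin (n k) → Ssyn) : ℕ) : ℝ) = (Fintype.card Ssyn : ℝ) ^ n k := by
    rw [Fintype.card_fun]; simp
  have h4' := congrArg (Nat.cast (R := ℝ)) h4
  rw [Nat.cast_add] at h4'
  rw [h5] at h4' ⊢
  simp only [hE, Set.mem_ofPred_eq]
  linarith

/-- Eventually `k ≤ c · n k`, so the failure probability is below the geometric sequence with ratio
`(1/2)^(ε/c)`. -/
theorem negligible_two_pow {ε : ℝ} (hε : 0 < ε) (hn : Asymptotics.IsBigO Filter.atTop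
    (fun k : ℕ => (k : ℝ)) (fun k : ℕ => (n k : ℝ))) :
    Negligible fun k => (1 / 2 : ℝ) ^ ⌈ε * n k⌉₊ := by
  obtain ⟨c, hc, hcn⟩ := hn.exists_pos
  rw [Asymptotics.isBigOWith_iff] at hcn
  set ρ : ℝ := (1 / 2 : ℝ) ^ (ε / c) with hρ
  have hρ0 : 0 < ρ := Real.rpow_pos_of_pos (by norm_num) _
  have hρ1 : ρ < 1 := Real.rpow_lt_one (by norm_num) (by norm_num) (by positivity)
  have hgeo : Negligible fun k => ρ ^ k := by
    intro j
    exact tendsto_pow_const_mul_const_pow_of_lt_one j hρ0.le hρ1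
  refine Asymptotics.SuperpolynomialDecay.trans_eventually_abs_le hgeo ?_
  filter_upwards [hcn] with k hk
  simp only [Function.comp_apply]
  rw [abs_of_nonneg (by positivity), abs_of_nonneg (by positivity)]
  simp only [Real.norm_natCast] at hk
  rw [← Real.rpow_natCast (1 / 2 : ℝ), ← Real.rpow_natCast ρ, hρ, ← Real.rpow_mul (by norm_num)]
  refine Real.rpow_le_rpow_of_exponent_ge (by norm_num) (by norm_num) ?_
  refine le_trans ?_ (Nat.le_ceil _)
  rw [div_mul_eq_mul_div, div_le_iff₀ hc]
  nlinarith

/-- Apart from degenerate parameters, the half-error decoder is run on the unmasked word. A fixed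
synchronized word `σ` handles all `y` at once, which places the quantifier over `y` inside the
event. -/
theorem exists_decoder {pmsg pload δ : ℝ} (henc : IsHalfErrorCode enc pmsg)
    (hd₁ : PolyTimeLength d₁)
    (hsyn : PolyTime (fun _ => encVec) (fun _ => encVec) Gsyn)
    (hmsg : PolyTime (fun _ => encVec) (fun _ => encVec) Gmsg)
    (hparse : IsShiftParser parse) (hn : Asymptotics.IsBigO Filter.atTop
      (fun k : ℕ => (k : ℝ)) (fun k : ℕ => (n k : ℝ))) (hδ : 0 < δ) (hp : pload ≤ pmsg - δ)
    (hK : 6400 * δ⁻¹ ^ 4 ≤ Fintype.card Ssyn) :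
    ∃ dec : ∀ k, List (Smsg × Ssyn) × (Fin (d₁ k + d₂ k) → Bool) × (Fin (r k) → A) →
        Option (Fin (M k)),
      PolyTime (fun _ => encDecArgs) (fun _ => encOptMsg) dec ∧
      ∃ μ : ℕ → ℝ, Negligible μ ∧ ∀ k (a : Fin (M k)),
        1 - μ k ≤ prob (PMF.uniformOfFintype ((Fin (d₁ k + d₂ k) → Bool) × (Fin (r k) → A)))
          {x | ∀ y : List (Smsg × Ssyn),
            (editDist y (List.ofFn (loadCode enc Gsyn Gmsg parse k a x.1 x.2)) : ℝ) ≤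
              pload * n k → dec k (y, x.1, x.2) = some a} := by
  obtain ⟨hdec, hdecT, hdecS⟩ := henc.exists_dec
  set e := fun i : (k : ℕ) × (List (Smsg × Ssyn) × (Fin (d₁ k + d₂ k) → Bool) ×
    (Fin (r k) → A)) => Data.cons (Data.num i.1) (encDecArgs i.2)
  have hk : PTF e fun i => Data.num i.1 := (PTF.refl _).fst
  have hy : PTF e fun i => encList i.2.1 := (PTF.refl _).snd.fst
  have hs : PTF e fun i => encVec i.2.2.1 := (PTF.refl _).snd.snd.fst
  have hsh : PTF e fun i => encVec i.2.2.2 := (PTF.refl _).snd.snd.snd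
  obtain ⟨h2, h3⟩ := PTF.masks hd₁ hsyn hmsg hparse.polyTime_parse hk hs hsh
  -- If `pmsg ≥ 1`, the half-error decoder tolerates `n` erasures; if `pload < 0`, the bound on the
  -- edit distance forces `n k = 0`. Otherwise `0 ≤ pload` and `pmsg < 1`, so that `δ < 1`.
  by_cases hcase : 1 ≤ pmsg ∨ pload < 0
  · -- a word of erasures is decoded correctly
    refine ⟨fun k x => hdec k fun _ => none, ?_, fun _ => 0,
      Asymptotics.superpolynomialDecay_zero _ _, fun k a => ?_⟩
    · exact PTF.polyTime (PTF.call (e := e) hdecT.ptf (fun i => ⟨i.1, fun _ => none⟩)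
        (hk.pair (h2.vecLength.vecConst none)))
    · rw [sub_zero]
      have huniv : prob (PMF.uniformOfFintype ((Fin (d₁ k + d₂ k) → Bool) × (Fin (r k) → A)))
          Set.univ = 1 := by
        rw [prob, (PMF.toOuterMeasure_apply_eq_one_iff _ _).2 (Set.subset_univ _)]
        rfl
      rw [← huniv]
      refine prob_mono _ fun x _ y hy => hdecS k a _ ?_
      have h1 : halfErrors (enc k a) (fun _ => none) = n k := by simp [halfErrors]
      rw [h1]
      have hN : (0 : ℝ) ≤ n k := Nat.cast_nonneg _
      rcases hcase with h | h
      · nlinarith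
      · have h4 := (Nat.cast_nonneg (α := ℝ) _).trans hy
        have h5 : (n k : ℝ) = 0 := by nlinarith
        rw [h5]; simp
  · push Not at hcase
    obtain ⟨hp1, hp0⟩ := hcase
    have hδ1 : δ < 1 := by linarith
    -- The value `4/δ` reduces the unassigned symbols to `δ/2` per position; `δ < 1` absorbs the
    -- rounding into `5/δ`.
    set R := ⌈4 / δ⌉₊ with hR
    have hR1 : 4 / δ ≤ R := Nat.le_ceil _
    have hR2 : (R : ℝ) ≤ 5 / δ := by
      have h4 := Nat.ceil_lt_add_one (a := 4 / δ) (by positivity)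
      rw [← hR] at h4
      have h5 : 1 ≤ 1 / δ := by rw [le_div_iff₀ hδ]; linarith
      have h6 : 5 / δ = 4 / δ + 1 / δ := by ring
      linarith
    refine ⟨fun k x => hdec k (unmask R (fun j => Gsyn k (seedSyn x.2.1) j + (parse k x.2.2 j).2)
      (fun j => Gmsg k (seedMsg x.2.1) j + (parse k x.2.2 j).1) x.1), ?_, _,
      negligible_two_pow (ε := δ ^ 2 / 20) (by positivity) hn, fun k a => ?_⟩
    · exact PTF.polyTime (PTF.call (e := e) hdecT.ptf (fun i => ⟨i.1, _⟩)
        (hk.pair (PTF.unmask h2 h3 hy R)))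
    · refine (prob_synchronized (enc := enc) (Gsyn := Gsyn) (Gmsg := Gmsg) hparse.uniform
        (ε := δ ^ 2 / 20) (by positivity) ?_ k a).trans (prob_mono _ ?_)
      · refine le_of_eq_of_le ?_ hK
        field_simp
        norm_num
      · rintro ⟨s, sh⟩ hx y hy
        refine hdecS k a _ ?_
        have h4 := halfErrors_unmask_le_of_synchronized hδ (by linarith : pload ≤ 1) hR1 hR2
          (loadCode enc Gsyn Gmsg parse k a s sh)
          (fun j => Gmsg k (seedMsg s) j + (parse k sh j).1) y hx hy
        -- Subtraction of the mask recovers the code word of the half-error code.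
        have h5 : (fun i => (loadCode enc Gsyn Gmsg parse k a s sh i).1 -
            (Gmsg k (seedMsg s) i + (parse k sh i).1)) = enc k a := by
          funext i
          simp only [loadCode, add_assoc]
          exact add_sub_cancel_right _ _
        rw [h5] at h4
        refine h4.trans ?_
        have hN : (0 : ℝ) ≤ n k := Nat.cast_nonneg _
        nlinarith

end Robust

end PayloadCode

namespace PayloadCode

/-! ## Couplings -/

/-- `P` and `Q` have a coupling that is supported on `R`. -/
def Coupled {α β : Type} (R : α → β → Prop) (P : PMF α) (Q : PMF β) : Prop :=
  ∃ W : PMF (α × β), W.map Prod.fst = P ∧ W.map Prod.snd = Q ∧ ∀ w ∈ W.support, R w.1 w.2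

namespace Coupled

variable {α β γ δ : Type} {R : α → β → Prop} {P : PMF α} {Q : PMF β}

/-- Used for computations that fail, whose simulation may do anything. -/
theorem pure_left {a : α} (h : ∀ b, R a b) : Coupled R (PMF.pure a) Q := by
  refine ⟨Q.map fun b => (a, b), ?_, ?_, ?_⟩
  · rw [PMF.map_comp]; exact PMF.map_const _ _
  · rw [PMF.map_comp]; exact PMF.map_id _
  · intro w hw
    obtain ⟨b, -, rfl⟩ := (PMF.mem_support_map_iff _ _ _).1 hw
    exact h b

theorem pure {a : α} {b : β} (h : R a b) : Coupled R (PMF.pure a) (PMF.pure b) := by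
  refine ⟨PMF.pure (a, b), PMF.pure_map _ _, PMF.pure_map _ _, ?_⟩
  intro w hw
  rw [PMF.support_pure, Set.mem_singleton_iff] at hw
  subst hw; exact h

theorem refl {R : α → α → Prop} (h : ∀ a ∈ P.support, R a a) : Coupled R P P := by
  refine ⟨P.map fun a => (a, a), ?_, ?_, ?_⟩
  · rw [PMF.map_comp]; exact PMF.map_id _
  · rw [PMF.map_comp]; exact PMF.map_id _
  · intro w hw
    obtain ⟨a, ha, rfl⟩ := (PMF.mem_support_map_iff _ _ _).1 hw
    exact h a ha

theorem exists_of_mem_support (h : Coupled R P Q) {b : β} (hb : b ∈ Q.support) :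
    ∃ a ∈ P.support, R a b := by
  obtain ⟨W, rfl, rfl, hW⟩ := h
  obtain ⟨w, hw, rfl⟩ := (PMF.mem_support_map_iff _ _ _).1 hb
  exact ⟨w.1, (PMF.mem_support_map_iff _ _ _).2 ⟨w, hw, rfl⟩, hW w hw⟩

theorem mono {R' : α → β → Prop} (h : Coupled R P Q) (hR : ∀ a b, R a b → R' a b) :
    Coupled R' P Q :=
  let ⟨W, h1, h2, h3⟩ := h
  ⟨W, h1, h2, fun w hw => hR _ _ (h3 w hw)⟩

theorem bind {R' : γ → δ → Prop} {f : α → PMF γ} {g : β → PMF δ} (h : Coupled R P Q)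
    (hfg : ∀ a ∈ P.support, ∀ b, R a b → Coupled R' (f a) (g b)) :
    Coupled R' (P.bind f) (Q.bind g) := by
  classical
  obtain ⟨W, rfl, rfl, hW⟩ := h
  have key : ∀ w : α × β, ∃ V : PMF (γ × δ), V.map Prod.fst = f w.1 ∧ V.map Prod.snd = g w.2 ∧
      (w ∈ W.support → ∀ v ∈ V.support, R' v.1 v.2) := by
    intro w
    by_cases hw : w ∈ W.support
    · obtain ⟨V, h1, h2, h3⟩ := hfg w.1 ((PMF.mem_support_map_iff _ _ _).2 ⟨w, hw, rfl⟩) w.2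
        (hW w hw)
      exact ⟨V, h1, h2, fun _ => h3⟩
    -- Outside the support of `W` there is no coupling to choose; the independent product serves as
    -- a default value.
    · refine ⟨(f w.1).bind fun x => (g w.2).map fun y => (x, y), ?_, ?_, fun h => absurd h hw⟩
      · simp only [PMF.map_bind, PMF.map_comp, Function.comp_def]
        exact (congrArg _ (funext fun a => PMF.map_const _ _)).trans (PMF.bind_pure _)
      · simp only [PMF.map_bind, PMF.map_comp, Function.comp_def]
        rw [PMF.bind_const]; exact PMF.map_id _
  choose V h1 h2 h3 using key
  refine ⟨W.bind V, ?_, ?_, ?_⟩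
  · rw [PMF.map_bind, PMF.bind_map]
    exact congrArg _ (funext h1)
  · rw [PMF.map_bind, PMF.bind_map]
    exact congrArg _ (funext h2)
  · intro v hv
    obtain ⟨w, hw, hv⟩ := (PMF.mem_support_bind_iff _ _ _).1 hv
    exact h3 w hw v hv

theorem map {R' : γ → δ → Prop} {f : α → γ} {g : β → δ} (h : Coupled R P Q)
    (hfg : ∀ a b, R a b → R' (f a) (g b)) : Coupled R' (P.map f) (Q.map g) := by
  rw [← PMF.bind_pure_comp, ← PMF.bind_pure_comp]
  exact h.bind fun a _ b hab => pure (hfg a b hab)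

theorem prob_eq (h : Coupled R P Q) {E : Set α} {F : Set β}
    (hEF : ∀ a b, R a b → (a ∈ E ↔ b ∈ F)) : prob P E = prob Q F := by
  obtain ⟨W, rfl, rfl, hW⟩ := h
  rw [prob_map, prob_map, prob, prob]
  congr 1
  refine PMF.toOuterMeasure_apply_eq_of_inter_support_eq _ ?_
  ext w
  simp only [Set.mem_inter_iff, Set.mem_preimage, and_congr_left_iff]
  exact fun hw => hEF _ _ (hW w hw)

end Coupled

/-! ## Randomized programs -/

theorem Runs.comp_tree {p q : Prog} {x y : Data} {c t : ℕ} (hq : Runs q x y c)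
    (ht : x.size + c ≤ t) : ∃ t', t ≤ t' + (x.size + c) ∧ t' + y.size ≤ t ∧
      (Prog.comp p q).tree x t = p.tree y t' := by
  obtain ⟨t1, h1, h2⟩ := hq (t - x.size) (by omega)
  have h3 := (q.clockMono _ _ _ _ h1).1
  refine ⟨t1, by omega, by omega, ?_⟩
  rw [Prog.tree, Tree.tick_of_le (by omega), h1, Tree.bind]

theorem Prog.tree_comp {p q : Prog} {x : Data} {t : ℕ} (h : x.size ≤ t) :
    (Prog.comp p q).tree x t = (q.tree x (t - x.size)).bind p.tree := Tree.tick_of_le h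

theorem Prog.tree_pair {p q : Prog} {x : Data} {t : ℕ} (h : x.size ≤ t) :
    (Prog.pair p q).tree x t = (p.tree x (t - x.size)).bind fun a t =>
      (q.tree x t).bind fun b t => .ret (.cons a b) t := Tree.tick_of_le h

/-- On input `x` the program `p` halts at a cost of at most `c`, and its output has the
distribution `P`. -/
def Samples (p : Prog) (x : Data) (P : PMF Data) (c : ℕ) : Prop :=
  ∀ t, c ≤ t → Coupled (fun y o => ∃ t', o = some (y, t') ∧ t ≤ t' + c ∧ t' + y.size ≤ t) P
    ((p.tree x t).eval noOracle)

namespace Samples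

variable {p q : Prog} {x : Data} {P Q : PMF Data} {c d : ℕ}

theorem of_runs {y : Data} (h : Runs p x y c) : Samples p x (PMF.pure y) c := by
  intro t ht
  obtain ⟨t', h1, h2⟩ := h t ht
  rw [h1]
  exact Coupled.pure ⟨t', rfl, h2, (p.clockMono _ _ _ _ h1).1⟩

theorem mono (h : Samples p x P c) (hc : c ≤ d) : Samples p x P d := fun t ht =>
  (h t (hc.trans ht)).mono fun _ _ ⟨t', h1, h2, h3⟩ => ⟨t', h1, by omega, h3⟩

theorem size_le (h : Samples p x P c) {y : Data} (hy : y ∈ P.support) : y.size ≤ c := by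
  obtain ⟨W, rfl, -, hW⟩ := h c le_rfl
  obtain ⟨w, hw, rfl⟩ := (PMF.mem_support_map_iff _ _ _).1 hy
  obtain ⟨t', -, -, h⟩ := hW w hw
  omega

theorem comp {F : Data → PMF Data} (hq : Samples q x P c)
    (hp : ∀ y ∈ P.support, Samples p y (F y) d) :
    Samples (.comp p q) x (P.bind F) (x.size + c + d) := by
  intro t ht
  rw [Prog.tree_comp (by omega), Tree.eval_bind]
  refine (hq _ (by omega)).bind ?_
  rintro y hy _ ⟨t', rfl, h1, h2⟩
  refine (hp y hy t' (by omega)).mono ?_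
  rintro z _ ⟨t'', rfl, h3, h4⟩
  exact ⟨t'', rfl, by omega, by omega⟩

theorem pair (hp : Samples p x P c) (hq : Samples q x Q d) :
    Samples (.pair p q) x (P.bind fun a => Q.map fun b => .cons a b) (x.size + c + d) := by
  intro t ht
  rw [Prog.tree_pair (by omega), Tree.eval_bind]
  refine (hp _ (by omega)).bind ?_
  rintro a - _ ⟨t1, rfl, h1, h2⟩
  simp only [Option.elim, Tree.eval_bind]
  rw [← PMF.bind_pure_comp]
  refine (hq t1 (by omega)).bind ?_
  rintro b - _ ⟨t2, rfl, h3, h4⟩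
  have := x.size_pos
  exact Coupled.pure ⟨t2, rfl, by omega, by simp only [Data.size]; omega⟩

end Samples

/-! ### Uniform words -/

theorem samples_rand (k : ℕ) (x : Data) :
    Samples (.rand k) x ((PMF.uniformOfFintype (Fin (k + 1))).map fun i : Fin (k + 1) => Data.num i)
      (x.size + (2 * k + 1)) := by
  intro t ht
  rw [Prog.tree, Tree.tick_of_le (by omega), Tree.eval, ← PMF.bind_pure_comp]
  refine (Coupled.refl (R := Eq) fun _ _ => rfl).bind ?_
  rintro i - _ rfl
  have h1 : (Data.num (i : ℕ)).size = 2 * i + 1 := Data.size_num _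
  have h2 := i.2
  rw [Tree.tick_of_le (by omega)]
  exact Coupled.pure ⟨_, rfl, by omega, by dsimp only; omega⟩

/-- Samples a list of random numerals; the argument is the length in unary. -/
def sampleBody (k : ℕ) : Prog := .pair (.comp .snd .fst) (.pair (.rand k) .snd)

def sampler (k : ℕ) : Prog := .comp .snd (.comp (.loop (sampleBody k)) (.pair .id .nil))

/-- The output distribution of the sampling loop with `j` symbols to go and the list `out` already
drawn. -/
noncomputable def sampleAux (k : ℕ) : ℕ → Data → PMF Data
  | 0, out => PMF.pure out
  | j + 1, out => (PMF.uniformOfFintype (Fin (k + 1))).bind fun i =>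
      sampleAux k j (.cons (Data.num i) out)

theorem samples_sampleBody (k j : ℕ) (out : Data) {B : ℕ}
    (hB : (Data.cons (Data.num (j + 1)) out).size ≤ B) :
    Samples (sampleBody k) (.cons (Data.num (j + 1)) out)
      ((PMF.uniformOfFintype (Fin (k + 1))).map fun i : Fin (k + 1) =>
        .cons (Data.num j) (.cons (Data.num i) out)) (8 * B + 2 * k + 1) := by
  set x := Data.cons (Data.num (j + 1)) out
  have h1 : Samples (.comp .snd .fst) x (PMF.pure (Data.num j)) (3 * B) := by
    refine (Samples.of_runs ((Runs.fst x).comp (Runs.snd _))).mono ?_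
    have := x.size_fst_le
    omega
  have h2 := h1.pair ((samples_rand k x).pair (Samples.of_runs (Runs.snd x)))
  simp only [PMF.pure_map, PMF.pure_bind] at h2
  refine (Eq.subst (motive := fun P => Samples _ _ P _) ?_ (h2.mono ?_))
  · rw [PMF.map_bind, PMF.bind_map, ← PMF.bind_pure_comp]
    congr 1
    funext i
    simp only [Function.comp, PMF.pure_map]
    rfl
  · omega

/-- `S` bounds the final output: each round adds one node and a numeral of at most `2 k + 1` nodes.
The loop state has the unary counter on the left, where the loop tests it. -/
theorem coupled_sample_loop (k S : ℕ) : ∀ j out, out.size + (2 * k + 2) * j ≤ S → ∀ F t B,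
    2 * j + 2 + S ≤ B → j + 1 ≤ F → (j + 1) * (9 * B + 2 * k + 1) ≤ t →
    Coupled (fun y o => ∃ t', o = some (Data.cons .nil y, t') ∧
        t ≤ t' + (j + 1) * (9 * B + 2 * k + 1) ∧ t' + y.size + 2 ≤ t ∧ y.size ≤ S)
      (sampleAux k j out)
      ((Tree.loop (sampleBody k).tree F (.cons (Data.num j) out) t).eval noOracle) := by
  intro j
  induction j with
  | zero =>
    intro out hS F t B hB hF ht
    obtain ⟨F, rfl⟩ : ∃ K, F = K + 1 := ⟨F - 1, by omega⟩
    have hsz : (Data.cons (Data.num 0) out).size = 2 + out.size := rfl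
    rw [Tree.loop, Tree.tick_of_le (by omega), if_pos (by rfl)]
    exact Coupled.pure ⟨_, rfl, by omega, by omega, by omega⟩
  | succ j ih =>
    intro out hS F t B hB hF ht
    obtain ⟨F, rfl⟩ : ∃ K, F = K + 1 := ⟨F - 1, by omega⟩
    have hsz : (Data.cons (Data.num (j + 1)) out).size ≤ B := by
      simp only [Data.size, Data.size_num]
      have : out.size ≤ S := by omega
      omega
    have e : (j + 1 + 1) * (9 * B + 2 * k + 1) =
      (j + 1) * (9 * B + 2 * k + 1) + (9 * B + 2 * k + 1) := by ring
    rw [e] at ht ⊢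
    rw [Tree.loop, Tree.tick_of_le (by omega), if_neg (by simp [Data.fst, Data.num, Data.isNil]),
      Tree.eval_bind]
    have h1 := samples_sampleBody k j out hsz
      (t - (Data.cons (Data.num (j + 1)) out).size) (by omega)
    rw [sampleAux]
    have h2 : (PMF.uniformOfFintype (Fin (k + 1))).bind (fun i =>
        sampleAux k j (.cons (Data.num i) out)) =
        ((PMF.uniformOfFintype (Fin (k + 1))).map fun i : Fin (k + 1) =>
          Data.cons (Data.num j) (.cons (Data.num i) out)).bind fun y => sampleAux k j y.snd := by
      rw [PMF.bind_map]; rfl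
    rw [h2]
    refine h1.bind ?_
    rintro y hy _ ⟨t1, rfl, h3, h4⟩
    obtain ⟨i, -, rfl⟩ := (PMF.mem_support_map_iff _ _ _).1 hy
    have h5 := i.2
    refine (ih (.cons (Data.num i) out) ?_ F t1 B (by omega) (by omega) (by omega)).mono ?_
    · simp only [Data.size, Data.size_num]
      rw [Nat.mul_add] at hS
      omega
    · rintro y _ ⟨t', rfl, h6, h7, h8⟩
      exact ⟨t', rfl, by omega, by omega, h8⟩

/-- Symbols are prepended, so the first one drawn is the last one of the word; hence the recursion
by `Fin.snoc`. -/
theorem sampleAux_eq {S : Type} [Fintype S] [Nonempty S] (k m : ℕ) (hk : Fintype.card S = k + 1)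
    (l : List S) : sampleAux k m (encList l) =
      (PMF.uniformOfFintype (Fin m → S)).map fun w => encList (List.ofFn w ++ l) := by
  induction m generalizing l with
  | zero =>
    have : PMF.uniformOfFintype (Fin 0 → S) = PMF.pure Fin.elim0 := by
      ext w
      simp [PMF.pure_apply, Subsingleton.elim w Fin.elim0]
    rw [this, PMF.pure_map]
    simp [sampleAux]
  | succ m ih =>
    have h1 : (PMF.uniformOfFintype S).map (fun a => (Fin.cast hk (Fintype.equivFin S a))) =
        PMF.uniformOfFintype (Fin (k + 1)) :=
      uniform_map_equiv ((Fintype.equivFin S).trans (finCongr hk))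
    have h2 : (PMF.uniformOfFintype (S × (Fin m → S))).map (fun a => (Fin.snoc a.2 a.1 :
        Fin (m + 1) → S)) = PMF.uniformOfFintype (Fin (m + 1) → S) :=
      uniform_map_equiv (Fin.snocEquiv fun _ => S)
    rw [sampleAux, ← h1, PMF.bind_map, ← h2, PMF.map_comp, uniform_prod, PMF.map_bind]
    congr 1
    funext a
    have h3 : Data.cons (Data.num (Fin.cast hk (Fintype.equivFin S a) : ℕ)) (encList l) =
        encList (a :: l) := rfl
    simp only [Function.comp]
    rw [h3, ih, PMF.map_comp]
    congr 1
    funext w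
    simp only [Function.comp]
    congr 1
    rw [List.ofFn_succ']
    simp

/-- Uniform words can be sampled in polynomial time. -/
theorem samples_sampler {S : Type} [Fintype S] [Nonempty S] (m : ℕ) :
    Samples (sampler (Fintype.card S - 1)) (Data.num m)
      ((PMF.uniformOfFintype (Fin m → S)).map encVec)
      ((m + 2) * (40 * (m + 2) * (Fintype.card S + 2))) := by
  have hc : 0 < Fintype.card S := Fintype.card_pos
  set k := Fintype.card S - 1 with hk
  have hk' : Fintype.card S = k + 1 := by omega
  set B := 2 * m + 2 + (1 + (2 * k + 2) * m) with hB
  have h0 : (PMF.uniformOfFintype (Fin m → S)).map encVec = sampleAux k m Data.nil := by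
    have := sampleAux_eq k m hk' ([] : List S)
    simp only [List.append_nil] at this
    exact this.symm
  have hs1 : (Data.num m).size = 2 * m + 1 := Data.size_num m
  have hcost : 30 * B + (m + 1) * (9 * B + 2 * k + 1) ≤
      (m + 2) * (40 * (m + 2) * (Fintype.card S + 2)) := by
    rw [hk', hB]
    nlinarith [Nat.zero_le (m * k), Nat.zero_le (m * m * k), Nat.zero_le (m * m)]
  rw [h0]
  intro t ht
  have r1 : Runs (.pair .id .nil) (Data.num m) (.cons (Data.num m) .nil) (3 * B) :=
    ((Runs.id _).pair (Runs.nil _)).mono (by omega)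
  rw [sampler, Prog.tree_comp (by omega)]
  obtain ⟨t1, h1, h1', h2⟩ := r1.comp_tree (p := .loop (sampleBody k)) (t := t - (Data.num m).size)
    (by omega)
  rw [h2, Prog.tree, Tree.eval_bind, ← PMF.bind_pure (sampleAux k m Data.nil)]
  have ht1 : m + 1 ≤ t1 := by
    have := Nat.le_mul_of_pos_right (m + 1) (show 0 < 9 * B + 2 * k + 1 by omega)
    omega
  refine (coupled_sample_loop k (1 + (2 * k + 2) * m) m .nil (by simp [Data.size]) (t1 + 1) t1 B
    (by omega) (by omega) (by omega)).bind ?_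
  rintro y - _ ⟨t2, rfl, h3, h4, h6⟩
  simp only [Option.elim]
  have h5 : (Data.cons .nil y).size = 2 + y.size := rfl
  rw [Prog.tree, Tree.tick_of_le (by omega)]
  exact Coupled.pure ⟨_, rfl, by omega, by omega⟩

end PayloadCode

namespace PayloadCode

/-! ## Simulation of an oracle by a program with a state -/

/-- The distribution of the outcome for an oracle whose state, a number, decreases at each
query. -/
noncomputable def Tree.interp (h : ℕ → Data → PMF (Option Data)) :
    Tree → ℕ → PMF (Option ((Data × ℕ) × ℕ))
  | .fail, _ => PMF.pure none
  | .ret y t, c => PMF.pure (some ((y, t), c))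
  | .rand k f, c => (PMF.uniformOfFintype (Fin (k + 1))).bind fun i => (f i).interp h c
  | .query x f, c => (h c x).bind fun o =>
      o.elim (PMF.pure none) fun y => (f y).interp h (c - 1)

theorem Tree.interp_bind (h : ℕ → Data → PMF (Option Data)) (T : Tree) (g : Data → ℕ → Tree) :
    ∀ c, (T.bind g).interp h c = (T.interp h c).bind fun o =>
      o.elim (PMF.pure none) fun y => (g y.1.1 y.1.2).interp h y.2 := by
  induction T with
  | fail => intro c; simp [Tree.bind, Tree.interp]
  | ret y t => intro c; simp [Tree.bind, Tree.interp]
  | rand k f ih => intro c; simp [Tree.bind, Tree.interp, ih, PMF.bind_bind]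
  | query x f ih =>
    intro c
    simp only [Tree.bind, Tree.interp, PMF.bind_bind]
    congr 1; funext o
    cases o <;> simp [ih]

/-- `p.withState hq` works on pairs of a value and a state, and calls `hq` in place of the oracle. -/
def Prog.withState : Prog → Prog → Prog
  | .id, _ => .id
  | .nil, _ => .pair .nil .snd
  | .fst, _ => .pair (.comp .fst .fst) .snd
  | .snd, _ => .pair (.comp .snd .fst) .snd
  | .pair p q, hq => .comp (.comp (.pair (.pair .snd (.comp .fst .fst)) (.comp .snd .fst))
        (.pair (.comp (q.withState hq) (.pair .snd (.comp .snd .fst))) (.comp .fst .fst)))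
      (.pair (p.withState hq) .fst)
  | .comp p q, hq => .comp (p.withState hq) (q.withState hq)
  | .cond c p q, hq => .comp (.cond (.comp .fst .fst)
        (.comp (p.withState hq) (.pair .snd (.comp .snd .fst)))
        (.comp (q.withState hq) (.pair .snd (.comp .snd .fst))))
      (.pair (c.withState hq) .fst)
  | .loop p, hq => .comp .snd (.comp
      (.loop (.comp (.pair (.comp .fst .fst) .id) (.comp (p.withState hq) .snd)))
      (.pair (.comp .fst .fst) .id))
  | .rand k, _ => .pair (.rand k) .snd
  | .query, hq => hq

/-- On inputs of size at most `T` and states `st c` with `c ≤ c₀`, of size at most `W`, the program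
`hq` simulates the oracle `h`, at a cost of at most `φ`. -/
structure Simulates (h : ℕ → Data → PMF (Option Data)) (hq : Prog) (st : ℕ → Data)
    (φ T W c₀ : ℕ) : Prop where
  size_le : ∀ c ≤ c₀, (st c).size ≤ W
  le_cost : 100 * (T + W + 1) ≤ φ
  samples : ∀ c ≤ c₀, ∀ x : Data, x.size ≤ T → h c x = PMF.pure none ∨
    ∃ P : PMF Data, h c x = P.map some ∧
      Samples hq (.cons x (st c)) (P.map fun y => .cons y (st (c - 1))) φ

/-- The relation between outcomes of a computation and of its simulation: `φ` units of time of the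
simulation stand for one unit of the computation, and `s` units are spared. -/
def SimRel (st : ℕ → Data) (φ c₀ s t : ℕ) (w : Data → Data → Data)
    (u : Option ((Data × ℕ) × ℕ)) (o : Option (Data × ℕ)) : Prop :=
  ∀ y t₁ c₁, u = some ((y, t₁), c₁) → y.size + t₁ ≤ t ∧ c₁ ≤ c₀ ∧
    ∃ t₁', o = some (w y (st c₁), t₁') ∧ φ * t₁ + s ≤ t₁'

theorem Coupled.bind_right {α β γ : Type} {R : α → β → Prop} {R' : α → γ → Prop} {P : PMF α}
    {Q : PMF β} {g : β → PMF γ} (h : Coupled R P Q)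
    (hg : ∀ a b, R a b → Coupled R' (PMF.pure a) (g b)) : Coupled R' P (Q.bind g) := by
  rw [← PMF.bind_pure P]
  exact h.bind fun a _ b hab => hg a b hab

theorem Coupled.and_support {α β : Type} {R : α → β → Prop} {P : PMF α} {Q : PMF β}
    (h : Coupled R P Q) : Coupled (fun a b => R a b ∧ a ∈ P.support ∧ b ∈ Q.support) P Q := by
  obtain ⟨W, rfl, rfl, hW⟩ := h
  exact ⟨W, rfl, rfl, fun w hw => ⟨hW w hw, (PMF.mem_support_map_iff _ _ _).2 ⟨w, hw, rfl⟩,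
    (PMF.mem_support_map_iff _ _ _).2 ⟨w, hw, rfl⟩⟩⟩

namespace SimRel

variable {st : ℕ → Data} {φ c₀ s s' t : ℕ} {w w' : Data → Data → Data}
  {P : PMF (Option ((Data × ℕ) × ℕ))}

/-- A failed computation imposes nothing on its simulation. Failures are excluded at the end by the
hypothesis on the adversary. -/
theorem none (o : Option (Data × ℕ)) : SimRel st φ c₀ s t w none o := fun _ _ _ h => by simp at h

theorem bind {Q : PMF (Option (Data × ℕ))} (h : Coupled (SimRel st φ c₀ s t w) P Q)
    {F : (Data × ℕ) × ℕ → PMF (Option ((Data × ℕ) × ℕ))}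
    {G : Data × ℕ → PMF (Option (Data × ℕ))} {R : Option ((Data × ℕ) × ℕ) → Option (Data × ℕ) → Prop}
    (hR : ∀ o, R Option.none o)
    (hFG : ∀ y t₁ c₁ t₁', y.size + t₁ ≤ t → c₁ ≤ c₀ → φ * t₁ + s ≤ t₁' →
      Coupled R (F ((y, t₁), c₁)) (G (w y (st c₁), t₁'))) :
    Coupled R (P.bind fun o => o.elim (PMF.pure .none) F)
      (Q.bind fun o => o.elim (PMF.pure .none) G) := by
  refine h.bind ?_
  rintro (_ | ⟨⟨y, t₁⟩, c₁⟩) - o hu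
  · exact Coupled.pure_left hR
  · obtain ⟨h1, h2, t₁', rfl, h3⟩ := hu y t₁ c₁ rfl
    exact hFG y t₁ c₁ t₁' h1 h2 h3

/-- A deterministic repacking `d` of value and state is paid from the spared units `s`. -/
theorem after {d : Prog} {Q : PMF (Option (Data × ℕ))} (h : Coupled (SimRel st φ c₀ s t w) P Q)
    {cd : ℕ} (hd : ∀ y c, y.size ≤ t → c ≤ c₀ → Runs d (w y (st c)) (w' y (st c)) cd)
    (hs : s' + cd ≤ s) : Coupled (SimRel st φ c₀ s' t w') P
      (Q.bind fun o => o.elim (PMF.pure .none) fun y => (d.tree y.1 y.2).eval noOracle) := by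
  refine h.bind_right ?_
  rintro (_ | ⟨⟨y, t₁⟩, c₁⟩) o hu
  · exact Coupled.pure_left none
  · obtain ⟨h1, h2, t₁', rfl, h3⟩ := hu y t₁ c₁ rfl
    obtain ⟨t2, h4, h5⟩ := hd y c₁ (by omega) h2 t₁' (by omega)
    simp only [Option.elim, h4, Tree.eval]
    refine Coupled.pure fun y' t' c' hu' => ?_
    simp only [Option.some.injEq, Prod.mk.injEq] at hu'
    obtain ⟨⟨rfl, rfl⟩, rfl⟩ := hu'
    exact ⟨h1, h2, t2, rfl, by omega⟩

theorem pair {p d : Prog} {X z : Data} {t' : ℕ}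
    (h : Coupled (SimRel st φ c₀ s t w) P ((p.tree X (t' - X.size)).eval noOracle))
    {cd : ℕ} (hd : Runs d X z cd) (hs : s' + cd ≤ s) (hX : X.size ≤ t') :
    Coupled (SimRel st φ c₀ s' t fun y e => .cons (w y e) z) P
      (((Prog.pair p d).tree X t').eval noOracle) := by
  rw [Prog.tree_pair hX, Tree.eval_bind]
  refine h.bind_right ?_
  rintro (_ | ⟨⟨y, t₁⟩, c₁⟩) o hu
  · exact Coupled.pure_left none
  · obtain ⟨h1, h2, t₁', rfl, h3⟩ := hu y t₁ c₁ rfl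
    obtain ⟨t2, h4, h5⟩ := hd t₁' (by omega)
    simp only [Option.elim, h4, Tree.eval, Tree.bind]
    refine Coupled.pure fun y' t' c' hu' => ?_
    simp only [Option.some.injEq, Prod.mk.injEq] at hu'
    obtain ⟨⟨rfl, rfl⟩, rfl⟩ := hu'
    exact ⟨h1, h2, t2, rfl, by omega⟩

theorem pure_ret {y : Data} {t₁ c₁ t₁' : ℕ} (h1 : y.size + t₁ ≤ t) (h2 : c₁ ≤ c₀)
    (h3 : φ * t₁ + s ≤ t₁') :
    SimRel st φ c₀ s t w (some ((y, t₁), c₁)) (some (w y (st c₁), t₁')) := fun y' t' c' hu' => by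
  simp only [Option.some.injEq, Prod.mk.injEq] at hu'
  obtain ⟨⟨rfl, rfl⟩, rfl⟩ := hu'
  exact ⟨h1, h2, _, rfl, h3⟩

theorem mono {t₂ : ℕ} (ht : t ≤ t₂) (hs : s' ≤ s) {u : Option ((Data × ℕ) × ℕ)}
    {o : Option (Data × ℕ)} (h : SimRel st φ c₀ s t w u o) : SimRel st φ c₀ s' t₂ w u o :=
  fun y t' c' hu => by
    obtain ⟨h1, h2, t1, h3, h4⟩ := h y t' c' hu
    exact ⟨by omega, h2, t1, h3, by omega⟩

end SimRel

/-- Each instruction costs at least one unit, and this frees at least `φ` units of the simulation,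
enough for the repacking or for one call of the oracle program. -/
theorem mul_sub_add_le {φ t a : ℕ} (h0 : 0 < a) (h : a ≤ t) : φ * (t - a) + φ ≤ φ * t := by
  obtain ⟨b, rfl⟩ := Nat.exists_eq_add_of_le h
  rw [Nat.add_sub_cancel_left, Nat.mul_add]
  have := Nat.le_mul_of_pos_right φ h0
  omega

section Simulation

variable {h : ℕ → Data → PMF (Option Data)} {hq : Prog} {st : ℕ → Data} {φ T W c₀ : ℕ}

/-- `P` simulates the computations `f`. -/
def IsSimulation (h : ℕ → Data → PMF (Option Data)) (st : ℕ → Data) (φ T c₀ : ℕ)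
    (f : Data → ℕ → Tree) (P : Prog) : Prop :=
  ∀ x t t' s c, c ≤ c₀ → t ≤ T → φ * t + s ≤ t' →
    Coupled (SimRel st φ c₀ s t .cons) ((f x t).interp h c)
      ((P.tree (.cons x (st c)) t').eval noOracle)

theorem Tree.interp_tick_neg {a t : ℕ} {f : ℕ → Tree} {c : ℕ} (ha : ¬ a ≤ t) :
    (Tree.tick a t f).interp h c = PMF.pure none := by
  rw [Tree.tick, if_neg ha]; rfl

theorem Prog.tree_of_not_le {p : Prog} {x : Data} {t : ℕ} (h : ¬ x.size ≤ t) :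
    p.tree x t = .fail := by
  cases p <;> exact if_neg h

theorem Prog.tree_rand {k : ℕ} {x : Data} {t : ℕ} (h : x.size ≤ t) :
    (Prog.rand k).tree x t = .rand k fun i => Tree.tick (Data.num i).size (t - x.size) fun t =>
      .ret (Data.num i) t := Tree.tick_of_le h

theorem Prog.tree_query {x : Data} {t : ℕ} (h : x.size ≤ t) :
    Prog.query.tree x t = .query x fun y => Tree.tick y.size (t - x.size) fun t => .ret y t :=
  Tree.tick_of_le h

theorem Prog.tree_cond {b p q : Prog} {x : Data} {t : ℕ} (h : x.size ≤ t) :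
    (Prog.cond b p q).tree x t = (b.tree x (t - x.size)).bind fun b t =>
      if b.isNil then q.tree x t else p.tree x t := Tree.tick_of_le h

theorem Prog.tree_loop (p : Prog) (x : Data) (t : ℕ) :
    (Prog.loop p).tree x t = Tree.loop p.tree (t + 1) x t := rfl

theorem IsSimulation.of_runs (H : Simulates h hq st φ T W c₀) {P : Prog} {g : Data → Data}
    (hg : ∀ x, (g x).size ≤ x.size)
    (hP : ∀ x e : Data, Runs P (.cons x e) (.cons (g x) e) (10 * (Data.cons x e).size)) :
    IsSimulation h st φ T c₀ (fun x t => Tree.tick x.size t fun t => .ret (g x) t) P := by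
  intro x t t' s c hc ht ht'
  by_cases hx : x.size ≤ t
  swap
  · dsimp only; rw [Tree.interp_tick_neg hx]; exact Coupled.pure_left SimRel.none
  have h1 := mul_sub_add_le (φ := φ) x.size_pos hx
  have h2 := H.size_le c hc
  have h3 := H.le_cost
  have h4 : (Data.cons x (st c)).size = 1 + x.size + (st c).size := rfl
  obtain ⟨t1, h5, h6⟩ := hP x (st c) t' (by omega)
  dsimp only
  rw [Tree.tick_of_le hx, h5]
  exact Coupled.pure (SimRel.pure_ret (w := Data.cons) (by have := hg x; omega) hc (by omega))

theorem IsSimulation.rand (H : Simulates h hq st φ T W c₀) (k : ℕ) :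
    IsSimulation h st φ T c₀ (Prog.rand k).tree (.pair (.rand k) .snd) := by
  intro x t t' s c hc ht ht'
  by_cases hx : x.size ≤ t
  swap
  · rw [Prog.tree_of_not_le hx]; exact Coupled.pure_left SimRel.none
  have h1 := mul_sub_add_le (φ := φ) x.size_pos hx
  have h2 := H.size_le c hc
  have h3 := H.le_cost
  have h4 : (Data.cons x (st c)).size = 1 + x.size + (st c).size := rfl
  rw [Prog.tree_rand hx, Prog.tree_pair (by omega), Prog.tree_rand (by omega), Tree.interp,
    Tree.bind, Tree.eval]
  refine (Coupled.refl (R := Eq) fun _ _ => rfl).bind ?_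
  rintro i - _ rfl
  by_cases hi : (Data.num i).size ≤ t - x.size
  swap
  · rw [Tree.interp_tick_neg hi]; exact Coupled.pure_left SimRel.none
  have h5 := mul_sub_add_le (φ := φ) (Data.num i).size_pos hi
  obtain ⟨t1, h6, h7⟩ := Runs.snd (.cons x (st c)) (t' - (Data.cons x (st c)).size -
    (Data.cons x (st c)).size - (Data.num i).size) (by omega)
  rw [Tree.tick_of_le hi, Tree.tick_of_le (by omega), Tree.bind, h6]
  exact Coupled.pure (SimRel.pure_ret (w := Data.cons) (by omega) hc (by omega))

/-- The oracle program runs on the pair of query and state. Its cost of at most `φ` is covered by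
the unit of time that the query itself costs. -/
theorem IsSimulation.query (H : Simulates h hq st φ T W c₀) :
    IsSimulation h st φ T c₀ Prog.query.tree hq := by
  intro x t t' s c hc ht ht'
  by_cases hx : x.size ≤ t
  swap
  · rw [Prog.tree_of_not_le hx]; exact Coupled.pure_left SimRel.none
  have h1 := mul_sub_add_le (φ := φ) x.size_pos hx
  rw [Prog.tree_query hx, Tree.interp]
  obtain h2 | ⟨P, h2, h3⟩ := H.samples c hc x (by omega)
  · rw [h2, PMF.pure_bind]; exact Coupled.pure_left SimRel.none
  have h4 := h3 t' (by omega)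
  have h6 := h3 t' (by omega)
  rw [← PMF.bind_pure ((hq.tree _ t').eval noOracle), h2, PMF.bind_map]
  have h5 : (P.map fun y => Data.cons y (st (c - 1))).map Data.fst = P := by
    rw [PMF.map_comp]; exact PMF.map_id P
  rw [← h5, PMF.bind_map]
  refine h4.bind ?_
  rintro z hz _ ⟨t1, rfl, h7, h8⟩
  obtain ⟨y, -, rfl⟩ := (PMF.mem_support_map_iff _ _ _).1 hz
  simp only [Function.comp, Data.fst, Option.elim]
  by_cases hy : y.size ≤ t - x.size
  swap
  · rw [Tree.interp_tick_neg hy]; exact Coupled.pure_left SimRel.none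
  have h9 := mul_sub_add_le (φ := φ) y.size_pos hy
  rw [Tree.tick_of_le hy]
  exact Coupled.pure (SimRel.pure_ret (w := Data.cons) (by omega) (by omega) (by omega))

theorem IsSimulation.comp (H : Simulates h hq st φ T W c₀) {p q P Q : Prog}
    (hp : IsSimulation h st φ T c₀ p.tree P) (hq' : IsSimulation h st φ T c₀ q.tree Q) :
    IsSimulation h st φ T c₀ (Prog.comp p q).tree (.comp P Q) := by
  intro x t t' s c hc ht ht'
  by_cases hx : x.size ≤ t
  swap
  · rw [Prog.tree_of_not_le hx]; exact Coupled.pure_left SimRel.none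
  have h1 := mul_sub_add_le (φ := φ) x.size_pos hx
  have h2 := H.size_le c hc
  have h3 := H.le_cost
  have h4 : (Data.cons x (st c)).size = 1 + x.size + (st c).size := rfl
  rw [Prog.tree_comp hx, Prog.tree_comp (by omega), Tree.interp_bind, Tree.eval_bind]
  refine SimRel.bind (hq' x _ _ s c hc (by omega) (by omega)) SimRel.none ?_
  intro y t₁ c₁ t₁' h5 h6 h7
  exact (hp y t₁ t₁' s c₁ h6 (by omega) h7).mono fun _ _ => SimRel.mono (by omega) le_rfl

theorem runs_swap (y e x : Data) :
    Runs (.pair .snd (.comp .snd .fst)) (.cons (.cons y e) x) (.cons x e)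
      (5 * (Data.cons (.cons y e) x).size) := by
  refine ((Runs.snd _).pair ((Runs.fst _).comp (Runs.snd _))).mono ?_
  simp only [Data.size, Data.fst]; omega

theorem runs_fst_fst (x : Data) : Runs (.comp .fst .fst) x x.fst.fst (3 * x.size) :=
  ((Runs.fst _).comp (Runs.fst _)).mono (by have := x.size_fst_le; omega)

theorem runs_snd_fst (x : Data) : Runs (.comp .snd .fst) x x.fst.snd (3 * x.size) :=
  ((Runs.fst _).comp (Runs.snd _)).mono (by have := x.size_fst_le; omega)

/-- Both parts need the input `x`, but the state of the second run is the one left by the first. A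
copy of `x` is therefore kept beside each result, and value and state are swapped into place between
the runs. -/
theorem IsSimulation.pair (H : Simulates h hq st φ T W c₀) {p q P Q : Prog}
    (hp : IsSimulation h st φ T c₀ p.tree P) (hq' : IsSimulation h st φ T c₀ q.tree Q) :
    IsSimulation h st φ T c₀ (Prog.pair p q).tree
      (.comp (.comp (.pair (.pair .snd (.comp .fst .fst)) (.comp .snd .fst))
        (.pair (.comp Q (.pair .snd (.comp .snd .fst))) (.comp .fst .fst)))
          (.pair P .fst)) := by
  intro x t t' s c hc ht ht'
  by_cases hx : x.size ≤ t
  swap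
  · rw [Prog.tree_of_not_le hx]; exact Coupled.pure_left SimRel.none
  have h1 := mul_sub_add_le (φ := φ) x.size_pos hx
  have h2 := H.size_le c hc
  have h3 := H.le_cost
  have h4 : (Data.cons x (st c)).size = 1 + x.size + (st c).size := rfl
  have hx0 := x.size_pos
  rw [Prog.tree_pair hx, Prog.tree_comp (by omega), Tree.interp_bind, Tree.eval_bind]
  -- The instruction frees `φ ≥ 100 (T + W + 1)` units; the decreasing multiples of `T + W + 1`
  -- reserve them for the repackings to come.
  refine SimRel.bind (SimRel.pair (z := x) (s := s + 95 * (T + W + 1)) (s' := s + 90 * (T + W + 1))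
    (hp x (t - x.size) _ _ c hc (by omega) ?_) (Runs.fst _) (by omega) (by omega))
    SimRel.none ?_
  · omega
  intro a t₁ c₁ t₁' h5 h6 h7
  have h8 := H.size_le c₁ h6
  have h9 : (Data.cons (.cons a (st c₁)) x).size = 1 + (1 + a.size + (st c₁).size) + x.size := rfl
  have hz : Runs (.comp .fst .fst) (.cons (.cons a (st c₁)) x) a (10 * (T + W + 1)) := (runs_fst_fst _).mono (by omega)
  rw [Tree.interp_bind]
  dsimp only
  rw [Prog.tree_comp (by omega), Tree.eval_bind]
  have key := SimRel.after (t := t₁) (s := s + 60 * (T + W + 1)) (s' := s) (st := st) (φ := φ)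
    (c₀ := c₀) (w := fun y e => .cons (.cons y e) a) (w' := fun y e => .cons (.cons a y) e)
    (P := (q.tree x t₁).interp h c₁) (cd := 30 * (T + W + 1))
    (SimRel.pair (s := s + 70 * (T + W + 1)) (w := Data.cons) (t' := t₁' - (Data.cons (.cons a (st c₁)) x).size)
      (p := .comp Q (.pair .snd (.comp .snd .fst))) ?_ hz (by omega) (by omega))
    (d := .pair (.pair .snd (.comp .fst .fst)) (.comp .snd .fst)) ?_ (by omega)
  · rw [← PMF.bind_pure (PMF.bind (((Prog.pair _ _).tree _ _).eval noOracle) _)]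
    refine key.bind ?_
    rintro (_ | ⟨⟨b, t₂⟩, c₂⟩) - o hu
    · exact Coupled.pure_left SimRel.none
    · obtain ⟨e1, e2, t₂', rfl, e3⟩ := hu b t₂ c₂ rfl
      refine Coupled.pure (SimRel.pure_ret (w := Data.cons) (y := .cons a b) (t₁ := t₂) (c₁ := c₂)
        ?_ e2 (by omega))
      simp only [Data.size]; omega
  · obtain ⟨t2, e1, e2, e3⟩ := (runs_swap a (st c₁) x).comp_tree (p := Q)
      (t := t₁' - (Data.cons (.cons a (st c₁)) x).size - (Data.cons (.cons a (st c₁)) x).size) (by omega)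
    rw [e3]
    exact hq' x t₁ t2 _ c₁ h6 (by omega) (by omega)
  · intro y c hy hc
    have h5 := H.size_le c hc
    set Z := Data.cons (.cons y (st c)) a
    have h8 : Z.size = 1 + (1 + y.size + (st c).size) + a.size := rfl
    exact (((Runs.snd Z).pair (runs_fst_fst Z)).pair (runs_snd_fst Z)).mono (by omega)

theorem IsSimulation.cond (H : Simulates h hq st φ T W c₀) {b p q B P Q : Prog}
    (hb : IsSimulation h st φ T c₀ b.tree B)
    (hp : IsSimulation h st φ T c₀ p.tree P) (hq' : IsSimulation h st φ T c₀ q.tree Q) :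
    IsSimulation h st φ T c₀ (Prog.cond b p q).tree
      (.comp (.cond (.comp .fst .fst) (.comp P (.pair .snd (.comp .snd .fst)))
        (.comp Q (.pair .snd (.comp .snd .fst)))) (.pair B .fst)) := by
  intro x t t' s c hc ht ht'
  by_cases hx : x.size ≤ t
  swap
  · rw [Prog.tree_of_not_le hx]; exact Coupled.pure_left SimRel.none
  have h1 := mul_sub_add_le (φ := φ) x.size_pos hx
  have h2 := H.size_le c hc
  have h3 := H.le_cost
  have h4 : (Data.cons x (st c)).size = 1 + x.size + (st c).size := rfl
  rw [Prog.tree_cond hx, Prog.tree_comp (by omega), Tree.interp_bind, Tree.eval_bind]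
  refine SimRel.bind (SimRel.pair (z := x) (s := s + 95 * (T + W + 1)) (s' := s + 90 * (T + W + 1))
    (hb x (t - x.size) _ _ c hc (by omega) ?_) (Runs.fst _) (by omega) (by omega))
    SimRel.none ?_
  · omega
  intro a t₁ c₁ t₁' h5 h6 h7
  have h8 := H.size_le c₁ h6
  have h9 : (Data.cons (.cons a (st c₁)) x).size = 1 + (1 + a.size + (st c₁).size) + x.size := rfl
  obtain ⟨t2, e1, e2⟩ := (runs_fst_fst (.cons (.cons a (st c₁)) x))
    (t₁' - (Data.cons (.cons a (st c₁)) x).size) (by omega)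
  have hR : ∀ {p P : Prog}, IsSimulation h st φ T c₀ p.tree P →
      Coupled (SimRel st φ c₀ s t .cons) ((p.tree x t₁).interp h c₁)
        (((Prog.comp P (.pair .snd (.comp .snd .fst))).tree (.cons (.cons a (st c₁)) x) t2).eval
          noOracle) := by
    intro p P hp
    obtain ⟨t3, e3, e4, e5⟩ := (runs_swap a (st c₁) x).comp_tree (p := P) (t := t2) (by omega)
    rw [e5]
    exact (hp x t₁ t3 s c₁ h6 (by omega) (by omega)).mono fun _ _ => SimRel.mono (by omega) le_rfl
  dsimp only
  rw [Prog.tree_cond (by omega), e1, Tree.bind]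
  change Coupled _ (Tree.interp h (if a.isNil then _ else _) c₁)
    (Tree.eval noOracle (if a.isNil then _ else _))
  by_cases hn : a.isNil = true
  · rw [if_pos hn, if_pos hn]; exact hR hq'
  · rw [if_neg hn, if_neg hn]; exact hR hp

/-- A loop tests the left subtree of its value, while the simulation works on pairs of value and
state. The simulating loop therefore works on `(x.fst, (x, st c))` and renews the first entry after
each round. -/
theorem IsSimulation.loop (H : Simulates h hq st φ T W c₀) {p P : Prog}
    (hp : IsSimulation h st φ T c₀ p.tree P) :
    IsSimulation h st φ T c₀ (Prog.loop p).tree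
      (.comp .snd (.comp (.loop (.comp (.pair (.comp .fst .fst) .id) (.comp P .snd)))
        (.pair (.comp .fst .fst) .id))) := by
  have h3 := H.le_cost
  have hinit : ∀ x e : Data, Runs (.pair (.comp .fst .fst) .id) (.cons x e)
      (.cons x.fst (.cons x e)) (5 * (Data.cons x e).size) := fun x e =>
    ((runs_fst_fst _).pair (Runs.id _)).mono (by omega)
  -- The simulating loop has more time and so may run at least as many rounds, `N ≤ N'`. The
  -- allowance of `30 (T + W + 1)` units covers the entry into the loop and is recovered from the
  -- tick of each round.
  have key : ∀ N x t t' s c N', N ≤ N' → c ≤ c₀ → t ≤ T → φ * t + s ≤ t' + 30 * (T + W + 1) →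
      Coupled (SimRel st φ c₀ s t fun y e => .cons y.fst (.cons y e))
        ((Tree.loop p.tree N x t).interp h c)
        ((Tree.loop (Prog.comp (.pair (.comp .fst .fst) .id) (.comp P .snd)).tree N'
          (.cons x.fst (.cons x (st c))) t').eval noOracle) := by
    intro N
    induction N with
    | zero => intros; exact Coupled.pure_left SimRel.none
    | succ N ih =>
      intro x t t' s c N' hN hc ht ht'
      obtain ⟨N', rfl⟩ : ∃ K, N' = K + 1 := ⟨N' - 1, by omega⟩
      rw [Tree.loop]
      by_cases hx : x.size ≤ t
      swap
      · rw [Tree.interp_tick_neg hx]; exact Coupled.pure_left SimRel.none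
      have h1 := mul_sub_add_le (φ := φ) x.size_pos hx
      have h2 := H.size_le c hc
      have h4 : (Data.cons x (st c)).size = 1 + x.size + (st c).size := rfl
      have h5 : (Data.cons x.fst (.cons x (st c))).size =
        1 + x.fst.size + (Data.cons x (st c)).size := rfl
      have h6 := x.size_fst_le
      have h0 := x.size_pos
      rw [Tree.tick_of_le hx, Tree.loop, Tree.tick_of_le (by omega)]
      change Coupled _ (Tree.interp h (if x.fst.isNil then _ else _) c)
        (Tree.eval noOracle (if x.fst.isNil then _ else _))
      by_cases hnil : x.fst.isNil = true
      · rw [if_pos hnil, if_pos hnil]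
        exact Coupled.pure (SimRel.pure_ret (w := fun y e => .cons y.fst (.cons y e)) (y := x)
          (t₁ := t - x.size) (by omega) hc (by omega))
      · rw [if_neg hnil, if_neg hnil, Tree.interp_bind, Tree.eval_bind]
        refine SimRel.bind (st := st) (φ := φ) (c₀ := c₀) (t := t - x.size) (s := s) (w := fun y e => .cons y.fst (.cons y e)) ?_
          SimRel.none ?_
        · rw [Prog.tree_comp (by omega), Tree.eval_bind]
          refine SimRel.after (s := s + 20 * (T + W + 1)) (w := Data.cons) ?_
            (cd := 10 * (T + W + 1)) ?_ (by omega)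
          · obtain ⟨t3, e3, e4, e5⟩ := (Runs.snd (.cons x.fst (.cons x (st c)))).comp_tree (p := P)
              (t := t' - (Data.cons x.fst (.cons x (st c))).size -
                (Data.cons x.fst (.cons x (st c))).size) (by omega)
            rw [e5]
            exact hp x _ _ _ c hc (by omega) (by omega)
          · intro y c hy hc
            refine (hinit y (st c)).mono ?_
            have := H.size_le c hc
            simp only [Data.size]; omega
        · intro y t₁ c₁ t₁' e1 e2 e3
          exact (ih y t₁ t₁' s c₁ N' (by omega) e2 (by omega) (by omega)).mono
            fun _ _ => SimRel.mono (by omega) le_rfl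
  intro x t t' s c hc ht ht'
  by_cases hx : x.size ≤ t
  swap
  · rw [Prog.tree_of_not_le hx]; exact Coupled.pure_left SimRel.none
  have h1 := mul_sub_add_le (φ := φ) x.size_pos hx
  have h2 := H.size_le c hc
  have h4 : (Data.cons x (st c)).size = 1 + x.size + (st c).size := rfl
  have htle : t ≤ φ * (t - x.size) + x.size := by
    have := Nat.le_mul_of_pos_left (t - x.size) (show 0 < φ by omega)
    omega
  rw [Prog.tree_comp (by omega), Tree.eval_bind]
  obtain ⟨t1, e1, e2, e3⟩ := (hinit x (st c)).comp_tree
    (p := .loop (.comp (.pair (.comp .fst .fst) .id) (.comp P .snd)))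
    (t := t' - (Data.cons x (st c)).size) (by omega)
  rw [e3, Prog.tree_loop, Prog.tree_loop]
  refine SimRel.after (s := s + 10 * (T + W + 1)) (cd := 10 * (T + W + 1))
    (w := fun y e => .cons y.fst (.cons y e)) (key _ x t t1 _ c _ (by omega) hc ht ?_) ?_ le_rfl
  · omega
  · intro y c hy hc
    have h5 := H.size_le c hc
    have h6 := y.size_fst_le
    refine (Runs.snd (.cons y.fst (.cons y (st c)))).mono ?_
    simp only [Data.size]; omega

/-- A program with an oracle is simulated by a program without an oracle. -/
theorem isSimulation_withState (H : Simulates h hq st φ T W c₀) (p : Prog) :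
    IsSimulation h st φ T c₀ p.tree (p.withState hq) := by
  induction p with
  | id => exact .of_runs H (g := fun x => x) (fun _ => le_rfl) fun x e => (Runs.id _).mono (by omega)
  | nil =>
    exact .of_runs H (g := fun _ => .nil) (fun x => x.size_pos) fun x e =>
      ((Runs.nil _).pair (Runs.snd _)).mono (by omega)
  | fst =>
    exact .of_runs H (fun x => x.size_fst_le) fun x e =>
      ((runs_fst_fst _).pair (Runs.snd _)).mono (by omega)
  | snd =>
    exact .of_runs H (fun x => x.size_snd_le) fun x e =>
      ((runs_snd_fst _).pair (Runs.snd _)).mono (by omega)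
  | pair p q ihp ihq => exact .pair H ihp ihq
  | comp p q ihp ihq => exact .comp H ihp ihq
  | cond c p q ihc ihp ihq => exact .cond H ihc ihp ihq
  | loop p ih => exact .loop H ih
  | rand k => exact .rand H k
  | query => exact .query H

end Simulation

end PayloadCode

namespace PayloadCode

/-! ### The clock of a computation -/

/-- Results and their sizes, and the number of queries, are limited by the clock. -/
def Tree.Clocked : Tree → ℕ → Prop
  | .fail, _ => True
  | .ret y t, n => t + y.size ≤ n
  | .rand _ f, n => ∀ i, (f i).Clocked n
  | .query _ f, n => ∃ m < n, ∀ y, (f y).Clocked m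

namespace Tree.Clocked

theorem mono {T : Tree} {m n : ℕ} (h : T.Clocked m) (hn : m ≤ n) : T.Clocked n := by
  induction T generalizing m n with
  | fail => trivial
  | ret y t => exact le_trans h hn
  | rand k f ih => exact fun i => ih i (h i) hn
  | query x f ih =>
    obtain ⟨l, hl, h⟩ := h
    exact ⟨l, by omega, h⟩

theorem bind {T : Tree} {g : Data → ℕ → Tree} {n e : ℕ} (h : T.Clocked n)
    (hg : ∀ m ≤ n, ∀ y t, t + y.size ≤ m → (g y t).Clocked (m + e)) :
    (T.bind g).Clocked (n + e) := by
  induction T generalizing n with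
  | fail => trivial
  | ret y t => exact hg n le_rfl y t h
  | rand k f ih => exact fun i => ih i (h i) hg
  | query x f ih =>
    obtain ⟨m, hm, h⟩ := h
    exact ⟨m + e, by omega, fun y => ih y (h y) fun l hl => hg l (by omega)⟩

theorem tick {c t : ℕ} {f : ℕ → Tree} (h : c ≤ t → (f (t - c)).Clocked t) :
    (Tree.tick c t f).Clocked t := by
  unfold Tree.tick
  split_ifs with h1
  · exact h h1
  · trivial

theorem loop {f : Data → ℕ → Tree} (hf : ∀ x t, (f x t).Clocked t) :
    ∀ N x t, (Tree.loop f N x t).Clocked t := by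
  intro N
  induction N with
  | zero => intros; trivial
  | succ N ih =>
    intro x t
    refine tick fun h => ?_
    split_ifs
    · exact (Nat.sub_add_cancel h).le
    · exact (bind (e := 0) (hf x _) fun m _ y t ht => (ih y t).mono (by omega)).mono (by omega)

end Tree.Clocked

theorem Prog.clocked (p : Prog) : ∀ x t, (p.tree x t).Clocked t := by
  induction p with
  | id | nil | fst | snd =>
    intro x t
    refine Tree.Clocked.tick fun h => ?_
    have e1 := x.size_fst_le
    have e2 := x.size_snd_le
    have e3 := x.size_pos
    simp only [Tree.Clocked, Data.size]
    omega
  | pair p q ihp ihq =>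
    intro x t
    refine Tree.Clocked.tick fun h => ?_
    have e := x.size_pos
    refine (Tree.Clocked.bind (e := 1) (ihp x _) fun m _ a t ht => ?_).mono (by omega)
    refine (Tree.Clocked.bind (e := 1 + a.size) (ihq x t) fun m _ b t ht => ?_).mono (by omega)
    simp only [Tree.Clocked, Data.size]
    omega
  | comp p q ihp ihq =>
    intro x t
    refine Tree.Clocked.tick fun h => ?_
    exact (Tree.Clocked.bind (e := 0) (ihq x _) fun m _ a t ht =>
      (ihp a t).mono (by omega)).mono (by omega)
  | cond c p q ihc ihp ihq =>
    intro x t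
    refine Tree.Clocked.tick fun h => ?_
    refine (Tree.Clocked.bind (e := 0) (ihc x _) fun m _ a t ht => ?_).mono
      (show t - x.size + 0 ≤ t by omega)
    split_ifs
    · exact (ihq x t).mono (by omega)
    · exact (ihp x t).mono (by omega)
  | loop p ih => exact fun x t => Tree.Clocked.loop ih _ x t
  | rand k =>
    intro x t
    refine Tree.Clocked.tick fun h i => ?_
    refine Tree.Clocked.mono (Tree.Clocked.tick fun h => ?_) (show t - x.size ≤ t by omega)
    simp only [Tree.Clocked]; omega
  | query =>
    intro x t
    have e := x.size_pos
    refine Tree.Clocked.tick fun h => ⟨t - x.size, by omega, fun y => ?_⟩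
    refine Tree.Clocked.tick fun h => ?_
    simp only [Tree.Clocked]; omega

/-- Bounds sampled outputs by the clock, with any oracle. -/
theorem Tree.Clocked.eval {T : Tree} {n : ℕ} (h : T.Clocked n) {orc : Data → OptionT PMF Data}
    {y : Data} {t : ℕ} (hy : some (y, t) ∈ (T.eval orc).support) : t + y.size ≤ n := by
  induction T generalizing n with
  | fail => simp [Tree.eval] at hy
  | ret y' t' =>
    simp only [Tree.eval, PMF.support_pure, Set.mem_singleton_iff, Option.some.injEq,
      Prod.mk.injEq] at hy
    obtain ⟨rfl, rfl⟩ := hy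
    exact h
  | rand k f ih =>
    obtain ⟨i, -, hi⟩ := (PMF.mem_support_bind_iff _ _ _).1 hy
    exact ih i (h i) hi
  | query x f ih =>
    obtain ⟨m, hm, h⟩ := h
    obtain ⟨o, -, ho⟩ := (PMF.mem_support_bind_iff _ _ _).1 hy
    cases o with
    | none => simp at ho
    | some z => exact (ih z (h z) ho).trans hm.le

/-! ### Stateful oracles -/

/-- The outcome of a computation with a stateful oracle. -/
noncomputable def Tree.stateEval (h : ℕ → Data → PMF (Option Data)) (T : Tree) (c : ℕ) :
    PMF (Option (Data × ℕ)) := (T.interp h c).map (Option.map Prod.fst)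

section StateEval

variable {h : ℕ → Data → PMF (Option Data)} {c : ℕ}

theorem Tree.stateEval_fail : Tree.fail.stateEval h c = PMF.pure none := PMF.pure_map _ _

theorem Tree.stateEval_ret (y : Data) (t : ℕ) :
    (Tree.ret y t).stateEval h c = PMF.pure (some (y, t)) := PMF.pure_map _ _

theorem Tree.stateEval_rand (k : ℕ) (f : Fin (k + 1) → Tree) :
    (Tree.rand k f).stateEval h c =
      (PMF.uniformOfFintype (Fin (k + 1))).bind fun i => (f i).stateEval h c := PMF.map_bind _ _ _

theorem Tree.stateEval_query (x : Data) (f : Data → Tree) :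
    (Tree.query x f).stateEval h c = (h c x).bind fun o =>
      o.elim (PMF.pure none) fun y => (f y).stateEval h (c - 1) := by
  rw [Tree.stateEval, Tree.interp, PMF.map_bind]
  congr 1; funext o
  cases o
  · exact PMF.pure_map _ _
  · rfl

/-- An oracle that does not depend on the state within the first `n` queries. -/
theorem Tree.stateEval_eq_eval {orc : Data → OptionT PMF Data} {T : Tree} {n : ℕ}
    (hT : T.Clocked n) (hh : ∀ c' ≤ c, c < c' + n → ∀ x, h c' x = (orc x).run) :
    T.stateEval h c = T.eval orc := by
  induction T generalizing n c with
  | fail => exact Tree.stateEval_fail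
  | ret y t => exact Tree.stateEval_ret y t
  | rand k f ih =>
    rw [Tree.stateEval_rand, Tree.eval]
    congr 1; funext i
    exact ih i (hT i) hh
  | query x f ih =>
    obtain ⟨m, hm, hT⟩ := hT
    rw [Tree.stateEval_query, Tree.eval, hh c le_rfl (by omega)]
    congr 1; funext o
    cases o with
    | none => rfl
    | some y => exact ih y (hT y) fun c' hc hn x => hh c' (by omega) (by omega) x

/-- A shift of the counter by one. The counter stops at `0`: from state `1` of `h'` and state `0` of
`h` both pass to `0`, which is the reason for the first conjunct. -/
theorem Tree.stateEval_succ {h' : ℕ → Data → PMF (Option Data)} (h0 : h' 0 = h 0)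
    (h1 : ∀ c, h' (c + 1) = h c) (T : Tree) :
    T.stateEval h' 0 = T.stateEval h 0 ∧ ∀ c, T.stateEval h' (c + 1) = T.stateEval h c := by
  induction T with
  | fail => simp only [Tree.stateEval_fail, implies_true, and_self]
  | ret y t => simp only [Tree.stateEval_ret, implies_true, and_self]
  | rand k f ih =>
    simp only [Tree.stateEval_rand]
    exact ⟨congrArg _ (funext fun i => (ih i).1), fun c => congrArg _ (funext fun i => (ih i).2 c)⟩
  | query x f ih =>
    simp only [Tree.stateEval_query]
    refine ⟨?_, fun c => ?_⟩
    · rw [h0]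
      congr 1; funext o
      cases o with
      | none => rfl
      | some y => exact (ih y).1
    · rw [h1]
      congr 1; funext o
      cases o with
      | none => rfl
      | some y =>
        cases c with
        | zero => exact (ih y).1
        | succ c => exact (ih y).2 c

/-- A random challenge that is used in one state only can be drawn when it is needed. -/
theorem Tree.bind_stateEval {Z : Type} (μ : PMF Z) (g : Z → ℕ → Data → PMF (Option Data))
    (h1 : ∀ x, (μ.bind fun z => g z 1 x) = h 1 x) (hne : ∀ z c, c ≠ 1 → g z c = h c) (T : Tree) :
    (∀ z, T.stateEval (g z) 0 = T.stateEval h 0) ∧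
      ∀ c, (μ.bind fun z => T.stateEval (g z) c) = T.stateEval h c := by
  induction T with
  | fail => simp only [Tree.stateEval_fail, PMF.bind_const, implies_true, and_self]
  | ret y t => simp only [Tree.stateEval_ret, PMF.bind_const, implies_true, and_self]
  | rand k f ih =>
    simp only [Tree.stateEval_rand]
    refine ⟨fun z => congrArg _ (funext fun i => (ih i).1 z), fun c => ?_⟩
    rw [PMF.bind_comm]
    exact congrArg _ (funext fun i => (ih i).2 c)
  | query x f ih =>
    simp only [Tree.stateEval_query]
    have h0 : ∀ z, ((g z 0 x).bind fun o => o.elim (PMF.pure none) fun y =>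
        (f y).stateEval (g z) (0 - 1)) = (h 0 x).bind fun o => o.elim (PMF.pure none) fun y =>
        (f y).stateEval h (0 - 1) := by
      intro z
      rw [hne z 0 (by omega)]
      congr 1; funext o
      cases o with
      | none => rfl
      | some y => exact (ih y).1 z
    refine ⟨h0, fun c => ?_⟩
    by_cases hc : c = 1
    · subst hc
      -- This query moves the counter from `1` to `0`, so the challenge enters no later answer and
      -- can be drawn now.
      rw [← h1, PMF.bind_bind]
      congr 1; funext z
      congr 1; funext o
      cases o with
      | none => rfl
      | some y => exact (ih y).1 z
    · simp only [fun z => hne z c hc]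
      rw [PMF.bind_comm]
      congr 1; funext o
      cases o with
      | none => exact PMF.bind_const _ _
      | some y => exact (ih y).2 (c - 1)

/-- Failure depends only on which answers are possible, not on their probabilities. -/
theorem Tree.none_notMem_interp {orc : Data → OptionT PMF Data} {T : Tree}
    (hh : ∀ c x o, o ∈ (h c x).support → o ∈ (orc x).run.support)
    (hT : none ∉ (T.eval orc).support) : none ∉ (T.interp h c).support := by
  induction T generalizing c with
  | fail => simp [Tree.eval] at hT
  | ret y t => simp [Tree.interp]
  | rand k f ih =>
    intro hc
    obtain ⟨i, hi, hc⟩ := (PMF.mem_support_bind_iff _ _ _).1 hc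
    exact ih i (fun h0 => hT ((PMF.mem_support_bind_iff _ _ _).2 ⟨i, hi, h0⟩)) hc
  | query x f ih =>
    intro hc
    obtain ⟨o, ho, hc⟩ := (PMF.mem_support_bind_iff _ _ _).1 hc
    have ho' := hh _ _ _ ho
    cases o with
    | none => exact hT ((PMF.mem_support_bind_iff _ _ _).2 ⟨none, ho', by simp⟩)
    | some y =>
      exact ih y (fun h0 => hT ((PMF.mem_support_bind_iff _ _ _).2 ⟨some y, ho', h0⟩)) hc

end StateEval

theorem Data.ofList_injective : Function.Injective Data.ofList := by
  intro l l' h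
  induction l generalizing l' with
  | nil => cases l' <;> simp_all [Data.ofList]
  | cons a l ih =>
    cases l' with
    | nil => simp [Data.ofList] at h
    | cons b l' =>
      simp only [Data.ofList, Data.cons.injEq] at h
      rw [h.1, ih h.2]

theorem encVec_injective {S : Type} [Fintype S] {n : ℕ} :
    Function.Injective (encVec : (Fin n → S) → Data) := fun _ _ h =>
  List.ofFn_injective (encSym_injective.list_map (Data.ofList_injective h))

/-! ### Families of distributions that can be sampled in polynomial time -/

/-- From `e i` one randomized program samples `P i` in time polynomial in the size of `e i`. -/
def SampleableFrom {ι : Type*} (e : ι → Data) (P : ι → PMF Data) : Prop :=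
  ∃ (p : Prog) (c : ι → ℕ), PolyBdd (fun i => (e i).size) c ∧ ∀ i, Samples p (e i) (P i) (c i)

namespace SampleableFrom

variable {ι : Type*} {e f : ι → Data} {P : ι → PMF Data}

theorem of_ptf (h : PTF e f) : SampleableFrom e fun i => PMF.pure (f i) :=
  let ⟨p, c, hc, hr⟩ := h
  ⟨p, c, hc, fun i => .of_runs (hr i)⟩

/-- By injectivity of `u` the intermediate tree determines `x`, so the distribution of the second
program is a function of that tree. -/
theorem bind {X : ι → Type} {μ : ∀ i, PMF (X i)} {u : ∀ i, X i → Data}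
    {Q : (Σ i, X i) → PMF Data} (hu : ∀ i, (u i).Injective)
    (h : SampleableFrom e fun i => (μ i).map (u i))
    (h' : SampleableFrom (fun j : Σ i, X i => u j.1 j.2) Q) :
    SampleableFrom e fun i => (μ i).bind fun x => Q ⟨i, x⟩ := by
  classical
  obtain ⟨p, c, hc, hp⟩ := h
  obtain ⟨p', c', ⟨q, hc'⟩, hp'⟩ := h'
  refine ⟨.comp p' p, _, ((PolyBdd.self _).add hc).add (hc.eval q), fun i => ?_⟩
  let F : Data → PMF Data := fun y =>
    if hy : ∃ x, u i x = y then Q ⟨i, hy.choose⟩ else PMF.pure .nil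
  have hF : ∀ x, F (u i x) = Q ⟨i, x⟩ := fun x => by
    have hx : ∃ x', u i x' = u i x := ⟨x, rfl⟩
    simp only [F, dif_pos hx, hu i hx.choose_spec]
  have h1 := (hp i).comp (F := F) (p := p') (d := q.eval (c i)) fun y hy => by
    have h6 := (hp i).size_le hy
    obtain ⟨x, -, rfl⟩ := (PMF.mem_support_map_iff _ _ _).1 hy
    rw [hF]
    exact (hp' ⟨i, x⟩).mono ((hc' ⟨i, x⟩).trans (eval_mono q h6))
  rw [PMF.bind_map] at h1
  simp only [Function.comp_def, hF] at h1
  exact h1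

theorem pair_id (h : SampleableFrom e P) :
    SampleableFrom e fun i => (P i).map fun y => .cons y (e i) := by
  obtain ⟨p, c, hc, hp⟩ := h
  refine ⟨.pair p .id, _, ((PolyBdd.self _).add hc).add (PolyBdd.self _), fun i => ?_⟩
  have h1 := (hp i).pair (Samples.of_runs (Runs.id (e i)))
  simp only [PMF.pure_map] at h1
  exact h1

theorem comp (h : PTF e f) (h' : SampleableFrom f P) : SampleableFrom e P := by
  obtain ⟨p, c, hc, hp⟩ := h
  obtain ⟨p', c', ⟨q, hc'⟩, hp'⟩ := h'
  refine ⟨.comp p' p, _, ((PolyBdd.self _).add hc).add (hc.eval q), fun i => ?_⟩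
  have h1 := (Samples.of_runs (hp i)).comp (F := fun _ => P i) (d := c' i) (p := p')
    (by simpa using hp' i)
  rw [PMF.pure_bind] at h1
  refine h1.mono ?_
  have h2 := (hc' i).trans (eval_mono q (hp i).size_le)
  omega

theorem reindex {κ : Type*} (h : SampleableFrom e P) (v : κ → ι) :
    SampleableFrom (fun k => e (v k)) fun k => P (v k) :=
  let ⟨p, _, hc, hr⟩ := h
  ⟨p, _, hc.reindex v, fun k => hr (v k)⟩

theorem congr {P' : ι → PMF Data} (h : SampleableFrom e P) (hP : ∀ i, P i = P' i) :
    SampleableFrom e P' := by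
  obtain rfl : P = P' := funext hP
  exact h

/-- A uniform word can be sampled and passed on to another program. -/
theorem uniform_bind {S : Type} [Fintype S] [Nonempty S] {m : ι → ℕ}
    (hm : PTF e fun i => Data.num (m i)) {Q : ∀ i, (Fin (m i) → S) → PMF Data}
    (h : SampleableFrom (fun j : Σ i, (Fin (m i) → S) => Data.cons (encVec j.2) (e j.1))
      fun j => Q j.1 j.2) :
    SampleableFrom e fun i => (PMF.uniformOfFintype (Fin (m i) → S)).bind (Q i) := by
  have h1 : SampleableFrom (fun i => Data.num (m i)) fun i =>
      (PMF.uniformOfFintype (Fin (m i) → S)).map encVec := by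
    refine ⟨_, _, ?_, fun i => samples_sampler (S := S) (m i)⟩
    have h2 : PolyBdd (fun i => (Data.num (m i)).size) fun i => m i + 2 := by
      refine ((PolyBdd.self _).add (.const 1)).of_le fun i => ?_
      rw [Data.size_num]; omega
    exact h2.mul (((PolyBdd.const 40).mul h2).mul (.const _))
  have h3 := (comp hm h1).pair_id
  simp only [PMF.map_comp] at h3
  refine bind (fun i a b hab => ?_) h3 h
  simp only [Function.comp, Data.cons.injEq] at hab
  exact encVec_injective hab.1

end SampleableFrom

end PayloadCode

/-! ### Sampling the outcome of a computation with a stateful oracle -/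

namespace PayloadCode

open Data

/-- The result of a computation. -/
def outcome (o : Option (Data × ℕ)) : Data := o.elim .nil Prod.fst

/-- `J` indexes the admissible queries together with the counter. The initial state is the largest
one, so the cost `q` of one answer is bounded once and for all and enters the factor `φ`. -/
theorem SampleableFrom.withState {ι J : Type*} (D : Prog) {X : ι → Data} {st : ι → ℕ → Data}
    {h : ι → ℕ → Data → PMF (Option Data)} {T c₀ : ι → ℕ} {idx : J → ι} {cnt : J → ℕ}
    {x : J → Data} {P : J → PMF Data}
    (hq : SampleableFrom (fun j => .cons (x j) (st (idx j) (cnt j)))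
      fun j => (P j).map fun y => .cons y (st (idx j) (cnt j - 1)))
    (hh : ∀ i c y, h i c y = PMF.pure none ∨
      ∃ j, idx j = i ∧ cnt j = c ∧ x j = y ∧ h i c y = (P j).map some)
    (hst : ∀ i c c', c ≤ c' → (st i c).size ≤ (st i c').size)
    (hT : PolyBdd (fun i => (Data.cons (X i) (st i (c₀ i))).size) T)
    (hfail : ∀ i, none ∉ ((D.tree (X i) (T i)).interp (h i) (c₀ i)).support) :
    SampleableFrom (fun i => .cons (X i) (st i (c₀ i)))
      fun i => ((D.tree (X i) (T i)).stateEval (h i) (c₀ i)).map outcome := by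
  obtain ⟨p, c, ⟨q, hc⟩, hp⟩ := hq
  have hW : PolyBdd (fun i => (Data.cons (X i) (st i (c₀ i))).size)
      fun i => (st i (c₀ i)).size :=
    (PolyBdd.self _).of_le fun i => by simp only [Data.size]; omega
  have hTW : PolyBdd (fun i => (Data.cons (X i) (st i (c₀ i))).size)
      fun i => T i + (st i (c₀ i)).size + 1 := (hT.add hW).add (.const 1)
  have hφ := ((PolyBdd.const 100).mul hTW).add (hTW.eval q)
  have hφT := hφ.mul hT
  refine ⟨.comp .fst (D.withState p), _, ((PolyBdd.self _).add hφT).add hφT, fun i => ?_⟩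
  set φ := 100 * (T i + (st i (c₀ i)).size + 1) + q.eval (T i + (st i (c₀ i)).size + 1) with hφ_def
  have H : Simulates (h i) p (st i) φ (T i) (st i (c₀ i)).size (c₀ i) := by
    refine ⟨fun c hc => hst i _ _ hc, by omega, fun c' hc' y hy => ?_⟩
    obtain h1 | ⟨j, rfl, rfl, rfl, h1⟩ := hh i c' y
    · exact .inl h1
    · refine .inr ⟨P j, h1, (hp j).mono ((hc j).trans ?_)⟩
      have h2 := hst (idx j) _ _ hc'
      refine (eval_mono q ?_).trans (Nat.le_add_left _ _)
      simp only [Data.size]; omega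
  have h1 : Samples (D.withState p) (.cons (X i) (st i (c₀ i)))
      (((D.tree (X i) (T i)).interp (h i) (c₀ i)).map fun u =>
        .cons (outcome (u.map Prod.fst)) (st i (u.elim 0 Prod.snd))) (φ * T i) := by
    intro t ht
    have h2 := isSimulation_withState H D (X i) (T i) t (t - φ * T i) (c₀ i) le_rfl le_rfl
      (by omega)
    have h3 := h2.and_support.map (f := fun u => Data.cons (outcome (u.map Prod.fst))
      (st i (u.elim 0 Prod.snd))) (g := fun o => o) (R' := fun y o =>
        ∃ t', o = some (y, t') ∧ t ≤ t' + φ * T i ∧ t' + y.size ≤ t) ?_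
    · rwa [show PMF.map (fun o => o) _ = _ from PMF.map_id _] at h3
    · rintro (_ | ⟨⟨y, t₁⟩, c₁⟩) o ⟨hu, hs, hs'⟩
      · exact absurd hs (hfail i)
      · obtain ⟨-, -, t', rfl, h4⟩ := hu y t₁ c₁ rfl
        exact ⟨t', rfl, by omega, ((D.withState p).clocked _ _).eval hs'⟩
  have h2 := h1.comp (p := .fst) (F := fun y => PMF.pure y.fst) (d := φ * T i) fun y hy =>
    (Samples.of_runs (Runs.fst y)).mono (h1.size_le hy)
  have h3 : ((D.tree (X i) (T i)).stateEval (h i) (c₀ i)).map outcome =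
      ((D.tree (X i) (T i)).interp (h i) (c₀ i)).bind fun u =>
        PMF.pure (outcome (u.map Prod.fst)) := PMF.map_comp _ _ _
  rw [PMF.bind_map] at h2
  dsimp only
  rw [h3]
  exact h2

/-! ### Random indices -/

/-- The binary length is the number of halvings until zero. -/
theorem PTF.num_size {ι : Type*} {e : ι → Data} {N : ι → ℕ} (h : PTF e fun i => num (N i)) :
    PTF e fun i => num (N i).size := by
  have key : PTF (fun i => Data.cons (num (N i)) .nil) fun i =>
      Data.cons (num (N i / 2 ^ (N i).size)) (num (N i).size) := by
    refine (PTF.iterate (st := fun i j => .cons (num (N i / 2 ^ j)) (num j))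
      (N := fun i => (N i).size) ?_ ?_ (B := fun i => 1 + (2 * N i + 1) + (2 * N i + 1)) ?_ ?_ ?_
      ?_).congr ?_ ?_
    · intro i j hj
      have h1 : 0 < N i / 2 ^ j := Nat.div_pos (Nat.lt_size.1 hj) (by positivity)
      obtain ⟨a, ha⟩ : ∃ a, N i / 2 ^ j = a + 1 := ⟨N i / 2 ^ j - 1, by omega⟩
      simp only [ha]; rfl
    · intro i
      simp only [Nat.div_eq_of_lt (Nat.lt_size_self (N i))]; rfl
    · refine (PolyBdd.self _).of_le fun i => ?_
      have : (N i).size ≤ N i := Nat.size_le.2 Nat.lt_two_pow_self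
      simp only [size, size_num, pow_zero, Nat.div_one]; omega
    · refine (((PolyBdd.const 1).add (PolyBdd.self _)).add (PolyBdd.self _)).of_le fun i => ?_
      simp only [size, size_num, pow_zero, Nat.div_one]; omega
    · intro i j hj
      have h1 : (N i).size ≤ N i := Nat.size_le.2 Nat.lt_two_pow_self
      have h2 : N i / 2 ^ j ≤ N i := Nat.div_le_self _ _
      simp only [size, size_num]; omega
    · have h1 := PTF.num_half (e := fun k : (i : ι) × Fin (N i).size =>
        Data.cons (num (N k.1 / 2 ^ (k.2 : ℕ))) (num k.2)) (PTF.refl _).fst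
      refine (h1.pair (PTF.nil.pair (PTF.refl _).snd)).congr (fun _ => rfl) fun k => ?_
      simp only [pow_succ, ← Nat.div_div_eq_div_mul]
      rfl
    · intro i; simp [num]
    · intro i; rfl
  exact ((h.pair .nil).comp key).snd

theorem ofDigits_ofFn {n : ℕ} (f : Fin n → Fin 2) :
    Nat.ofDigits 2 (List.ofFn fun i => (f i : ℕ)) = (finFunctionFinEquiv f : ℕ) := by
  rw [finFunctionFinEquiv_apply]
  induction n with
  | zero => simp
  | succ n ih =>
    rw [List.ofFn_succ, Nat.ofDigits_cons, ih fun i => f i.succ, Fin.sum_univ_succ, Finset.mul_sum]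
    simp only [Fin.val_zero, pow_zero, mul_one, Fin.val_succ, pow_succ]
    congr 1
    exact Finset.sum_congr rfl fun i _ => by ring

/-- The number is written in unary, so the bound is needed for `2 ^ m i` and not only for `m i`. -/
theorem PTF.ofDigits {ι : Type*} {e : ι → Data} {m B : ι → ℕ} {f : ∀ i, Fin (m i) → Fin 2}
    (h : PTF e fun i => encVec (f i)) (hB : PolyBdd (fun i => (e i).size) B)
    (hm : ∀ i, 2 ^ m i ≤ B i) : PTF e fun i => num (finFunctionFinEquiv (f i) : ℕ) := by
  have h1 := PTF.foldr (e := e) (l := fun i => List.ofFn (f i)) (fun _ b _ => encSym b)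
    (fun _ l' => num (Nat.ofDigits 2 (l'.map Fin.val))) ?_ (PTF.const (num 0)) ?_
    (B := fun i => 2 * B i + 1) (((PolyBdd.const 2).mul hB).add (.const 1)) ?_
  · refine h1.congr (fun _ => rfl) fun i => ?_
    rw [List.map_ofFn, ← ofDigits_ofFn]; rfl
  · simp only [suffixMap_const]
    exact h
  · have hb : PTF (fun k : {k : ι × Fin 2 × List (Fin 2) // k.2.1 :: k.2.2 <:+ List.ofFn (f k.1)} =>
        Data.cons (encSym k.1.2.1) (.cons (num (Nat.ofDigits 2 (k.1.2.2.map Fin.val))) (e k.1.1)))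
        fun k => num (k.1.2.1 : ℕ) :=
      PTF.table (encSym (S := Fin 2)) (fun b : Fin 2 => num (b : ℕ)) encSym_injective
        _ (PTF.refl _).fst
    refine (hb.num_add (PTF.num_add (PTF.refl _).snd.fst (PTF.refl _).snd.fst)).congr
      (fun _ => rfl) fun k => ?_
    rw [List.map_cons, Nat.ofDigits_cons, two_mul]
  · intro i l' hl
    have h2 := Nat.ofDigits_lt_base_pow_length (b := 2) (l := l'.map Fin.val) (by norm_num)
      (fun x hx => by obtain ⟨b, -, rfl⟩ := List.mem_map.1 hx; exact b.2)
    have h3 : 2 ^ l'.length ≤ 2 ^ m i :=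
      Nat.pow_le_pow_right (by norm_num) (by simpa using hl.length_le)
    have h4 := hm i
    rw [List.length_map] at h2
    rw [size_num]; omega

/-- An index below a power of two can be drawn and passed on to another program. -/
theorem SampleableFrom.index_bind {ι : Type*} {e : ι → Data} {N : ι → ℕ}
    (hN : PTF e fun i => num (N i)) {Q : ι → ℕ → PMF Data}
    (h : SampleableFrom (fun j : Σ i, Fin (2 ^ (N i).size) => Data.cons (num j.2) (e j.1))
      fun j => Q j.1 j.2) :
    SampleableFrom e fun i =>
      (PMF.uniformOfFintype (Fin (2 ^ (N i).size))).bind fun c => Q i c := by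
  have h1 : PTF (fun j : Σ i, (Fin (N i).size → Fin 2) => Data.cons (encVec j.2) (e j.1))
      fun j => Data.cons (num (finFunctionFinEquiv j.2 : ℕ)) (e j.1) := by
    have h0 : PTF (fun j : Σ i, (Fin (N i).size → Fin 2) => Data.cons (encVec j.2) (e j.1))
        fun j => encVec j.2 := (PTF.refl _).fst
    -- The instruction `rand` has a fixed range, so an index of variable range is assembled from
    -- coins; the range `2 ^ (N i).size` exceeds `N i` by at most a factor two, up to one.
    refine PTF.pair (PTF.ofDigits h0 (B := fun j => 2 * N j.1 + 1) ?_ fun j => ?_)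
      (PTF.refl _).snd
    · have h2 := (PTF.call (e := fun j : Σ i, (Fin (N i).size → Fin 2) =>
        Data.cons (encVec j.2) (e j.1)) hN (fun j => j.1) (PTF.refl _).snd).size_polyBdd
      simpa only [size_num] using h2
    · rcases Nat.eq_zero_or_pos (N j.1) with h0 | h0
      · simp [h0]
      · have h2 : 0 < (N j.1).size := Nat.size_pos.2 h0
        have h3 : 2 ^ ((N j.1).size - 1) ≤ N j.1 := Nat.lt_size.1 (by omega)
        have h4 : 2 ^ (N j.1).size = 2 * 2 ^ ((N j.1).size - 1) := by
          rw [← pow_succ', Nat.sub_add_cancel h2]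
        omega
  refine (SampleableFrom.uniform_bind (S := Fin 2) hN.num_size (Q := fun i f =>
    Q i (finFunctionFinEquiv f : ℕ)) (SampleableFrom.comp h1 (h.reindex
      fun j : Σ i, (Fin (N i).size → Fin 2) => ⟨j.1, finFunctionFinEquiv j.2⟩))).congr fun i => ?_
  rw [← uniform_map_equiv (finFunctionFinEquiv (m := 2) (n := (N i).size)), PMF.bind_map]
  rfl

end PayloadCode

namespace PayloadCode

open Data

/-! ## The hybrid argument -/

section Game

variable {W B : Type} [Fintype B] [Nonempty B] {Z : Type} [Fintype Z] {M n : ℕ}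

/-- The distribution of `F ρ w`, where `w` has the distribution `μ` and `ρ` is uniform. -/
noncomputable def answerDist {Y : Type} (F : B → W → Y) (μ : PMF W) : PMF Y :=
  μ.bind fun w => (PMF.uniformOfFintype B).map fun ρ => F ρ w

/-- The oracle that answers with `answerDist`, where the distribution depends on the state. -/
noncomputable def stateOracle (F : Fin M → B → W → Fin n → Z) (κ : ℕ → PMF W) (c : ℕ) (x : Data) :
    PMF (Option Data) := (msgOracle (fun a => answerDist (F a) (κ c)) x).run

open Classical in
theorem run_msgOracle (P : Fin M → PMF (Fin n → Z)) (x : Data) : (msgOracle P x).run =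
    if h : ∃ a : Fin M, x = encMsg a then ((P h.choose).map encVec).map some
    else PMF.pure none := by
  unfold msgOracle
  split_ifs <;> rfl

theorem bind_stateOracle {Q : Type} (F : Fin M → B → W → Fin n → Z) (μ : PMF Q) (κ : ℕ → PMF W)
    (κ' : Q → ℕ → PMF W) (c : ℕ) (h : (μ.bind fun z => κ' z c) = κ c) (x : Data) :
    (μ.bind fun z => stateOracle F (κ' z) c x) = stateOracle F κ c x := by
  classical
  simp only [stateOracle, run_msgOracle]
  split_ifs
  · simp only [answerDist, ← h, PMF.map_bind, PMF.bind_bind]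
  · exact PMF.bind_const _ _

/-- The hybrids: `μG` in state `0`, `μ` in state `1`, and `μU` in all other states. -/
def hybrid (μG μU μ : PMF W) (c : ℕ) : PMF W := if c = 0 then μG else if c = 1 then μ else μU

variable (F : Fin M → B → W → Fin n → Z) (μG μU : PMF W) (T : Tree)

/-- A challenge fixed in advance, as a distinguisher receives it, has the same effect as one drawn
at the query with state `1`. -/
theorem bind_stateEval_hybrid (μ : PMF W) (c : ℕ) :
    (μ.bind fun z => T.stateEval (stateOracle F (hybrid μG μU (PMF.pure z))) c) =
      T.stateEval (stateOracle F (hybrid μG μU μ)) c := by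
  refine (Tree.bind_stateEval μ _ (fun x => bind_stateOracle F μ _ _ 1 ?_ x) ?_ T).2 c
  · exact PMF.bind_pure μ
  · intro z c hc
    funext x
    simp only [stateOracle, hybrid, if_neg hc]

/-- With a challenge from `μG`, states `0` and `1` answer alike, so the counter can be lowered by
one. This makes neighbouring hybrids telescope. -/
theorem stateEval_hybrid_succ (c : ℕ) :
    T.stateEval (stateOracle F (hybrid μG μU μG)) (c + 1) =
      T.stateEval (stateOracle F (hybrid μG μU μU)) c := by
  refine (Tree.stateEval_succ (by funext x; simp [stateOracle, hybrid]) (fun c => ?_) T).2 c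
  funext x
  by_cases hc : c = 0 <;> simp [stateOracle, hybrid, hc]

theorem stateEval_hybrid_zero {N : ℕ} (hT : T.Clocked N) :
    T.stateEval (stateOracle F (hybrid μG μU μU)) 0 =
      T.eval (msgOracle fun a => answerDist (F a) μG) := by
  refine Tree.stateEval_eq_eval hT fun c hc _ x => ?_
  obtain rfl : c = 0 := by omega
  rfl

/-- Fewer queries are made than the clock has units, so the counter does not reach `0` before the
end. -/
theorem stateEval_hybrid_of_le {N c : ℕ} (hT : T.Clocked N) (hc : N ≤ c) :
    T.stateEval (stateOracle F (hybrid μG μU μU)) c =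
      T.eval (msgOracle fun a => answerDist (F a) μU) := by
  refine Tree.stateEval_eq_eval hT fun c' hc' hN x => ?_
  have : c' ≠ 0 := by omega
  simp [stateOracle, hybrid, this]

end Game

theorem accepts_eq : accepts = outcome ⁻¹' {num 1} := by
  ext o
  cases o with
  | none => simp [accepts, outcome, num]
  | some y =>
    change Option.map Prod.fst (some y) = some (num 1) ↔ y.1 = num 1
    simp

theorem prob_bind_uniform {α β : Type} [Fintype α] [Nonempty α] (f : α → PMF β) (E : Set β) :
    prob ((PMF.uniformOfFintype α).bind f) E = (∑ a, prob (f a) E) / Fintype.card α := by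
  rw [prob, PMF.toOuterMeasure_bind_apply, tsum_fintype, ENNReal.toReal_sum fun a _ =>
    ENNReal.mul_ne_top (PMF.apply_ne_top _ _) (prob_ne_top _ _), Finset.sum_div]
  refine Finset.sum_congr rfl fun a _ => ?_
  rw [ENNReal.toReal_mul, PMF.uniformOfFintype_apply, ENNReal.toReal_inv, ENNReal.toReal_natCast,
    prob, div_eq_inv_mul]

theorem Samples.prob_accepts {α : Type} {μ : PMF α} {p : Prog} {e : α → Data} {P : α → PMF Data}
    {c t : ℕ} (h : ∀ a, Samples p (e a) (P a) c) (ht : c ≤ t) :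
    prob (μ.bind fun a => p.evalProb noOracle (e a) t) accepts = prob (μ.bind P) {num 1} := by
  symm
  refine Coupled.prob_eq ((Coupled.refl (R := Eq) fun _ _ => rfl).bind (fun a _ b hab => ?_))
    (R := fun y o => outcome o = y) fun y o hy => ?_
  · subst hab
    rw [Prog.evalProb_eq]
    refine (h a t ht).mono ?_
    rintro y _ ⟨t', rfl, -⟩
    rfl
  · rw [accepts_eq, ← hy]; rfl

theorem Samples.none_notMem {p : Prog} {x : Data} {P : PMF Data} {c t : ℕ}
    (h : Samples p x P c) (ht : c ≤ t) : none ∉ (p.evalProb noOracle x t).support := by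
  rw [Prog.evalProb_eq]
  intro hn
  obtain ⟨y, -, t', h', -⟩ := (h t ht).exists_of_mem_support hn
  simp at h'

section Hybrid

variable {S A B Z : Type} [Fintype S] [Nonempty S] [Fintype A] [Nonempty A] [Fintype B]
  [Nonempty B] [Fintype Z] [Nonempty Z] {M d n r m : ℕ → ℕ}

/-- The generator is run on the zero seed and the length of its output is measured. -/
theorem IsPRG.ptf_length {G : ∀ k, (Fin (d k) → Bool) → Fin (n k) → S} (hG : IsPRG G) :
    PTF num fun k => num (n k) := by
  have h1 : PTF num fun k => encVec (n := d k) fun _ => false :=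
    PTF.vecConst hG.polyTime_length.ptf false
  exact (PTF.call (e := num) hG.polyTime_gen.ptf (fun k => ⟨k, fun _ => false⟩)
    ((PTF.refl _).pair h1)).vecLength

theorem PTF.answer {G : ∀ k, (Fin (d k) → Bool) → Fin (n k) → S} (hG : IsPRG G)
    {F : ∀ k, (Fin (r k) → A) → Fin (M k) → (Fin (m k) → B) → (Fin (n k) → S) → Fin (n k) → Z}
    (hF : PTF (fun i : (k : ℕ) × ((Fin (r k) → A) × Fin (M k) × (Fin (m k) → B) ×
          (Fin (n k) → S)) => Data.cons (num i.1) (.cons (encVec i.2.1) (.cons (encMsg i.2.2.1)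
            (.cons (encVec i.2.2.2.1) (encVec i.2.2.2.2)))))
        fun i => encVec (F i.1 i.2.1 i.2.2.1 i.2.2.2.1 i.2.2.2.2))
    {ι : Type*} (k : ι → ℕ) (sh : ∀ i, Fin (r (k i)) → A) (z u : ∀ i, Fin (n (k i)) → S)
    (c : ι → ℕ) (a : ∀ i, Fin (M (k i))) (s : ∀ i, Fin (d (k i)) → Bool)
    (ρ : ∀ i, Fin (m (k i)) → B) :
    PTF (fun i => Data.cons (encVec (ρ i)) (.cons (encVec (u i)) (.cons (encVec (s i))
      (.cons (encMsg (a i)) (.cons (.cons (num (k i)) (.cons (encVec (sh i)) (encVec (z i))))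
        (num (c i)))))))
      fun i => Data.cons (encVec (F (k i) (sh i) (a i) (ρ i) (if c i = 0 then G (k i) (s i) else
        if c i = 1 then z i else u i))) (.cons (.cons (num (k i)) (.cons (encVec (sh i))
          (encVec (z i)))) (num (c i - 1))) := by
  set e := fun i => Data.cons (encVec (ρ i)) (.cons (encVec (u i)) (.cons (encVec (s i))
      (.cons (encMsg (a i)) (.cons (.cons (num (k i)) (.cons (encVec (sh i)) (encVec (z i))))
        (num (c i)))))) with he
  have hρ : PTF e fun i => encVec (ρ i) := (PTF.refl e).fst
  have hu : PTF e fun i => encVec (u i) := (PTF.refl e).snd.fst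
  have hs : PTF e fun i => encVec (s i) := (PTF.refl e).snd.snd.fst
  have ha : PTF e fun i => encMsg (a i) := (PTF.refl e).snd.snd.snd.fst
  have hctx : PTF e fun i => Data.cons (num (k i)) (.cons (encVec (sh i)) (encVec (z i))) :=
    (PTF.refl e).snd.snd.snd.snd.fst
  have hk : PTF e fun i => num (k i) := hctx.fst
  have hsh : PTF e fun i => encVec (sh i) := hctx.snd.fst
  have hz : PTF e fun i => encVec (z i) := hctx.snd.snd
  have hc : PTF e fun i => num (c i) := (PTF.refl e).snd.snd.snd.snd.snd
  have hc' : PTF e fun i => num (c i - 1) := hc.snd.congr (fun _ => rfl) fun i => by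
    cases c i <;> rfl
  have hg : PTF e fun i => encVec (G (k i) (s i)) :=
    PTF.call hG.polyTime_gen.ptf (fun i => ⟨k i, s i⟩) (hk.pair hs)
  have hnil : ∀ b, (num b).isNil = decide (b = 0) := fun b => by
    cases b <;> simp [num, Data.isNil]
  have hpick : PTF e fun i => encVec (if c i = 0 then G (k i) (s i) else
      if c i = 1 then z i else u i) := by
    have h1 : PTF e fun i => if (num (c i - 1)).isNil then encVec (z i) else encVec (u i) :=
      PTF.ite hc' (hu.reindex _) (hz.reindex _)
    refine (PTF.ite (f := fun i => if (num (c i - 1)).isNil then encVec (z i) else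
      encVec (u i)) (g := fun i => encVec (G (k i) (s i))) hc (h1.reindex _) (hg.reindex _)).congr (fun _ => rfl) fun i => ?_
    simp only [hnil, decide_eq_true_eq]
    by_cases h0 : c i = 0
    · simp only [h0, if_true]
    · by_cases h1 : c i = 1
      · simp [h1]
      · have h2 : c i - 1 ≠ 0 := by omega
        simp only [h0, h1, h2, if_false]
  exact (PTF.call hF (fun i => ⟨k i, sh i, a i, ρ i, _⟩)
    (hk.pair (hsh.pair (ha.pair (hρ.pair hpick))))).pair (hctx.pair hc')

/-- A seed, a uniform word and `ρ` are drawn at every query whatever the counter is. Draws that are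
not used drop out of the distribution by `PMF.bind_const`. -/
theorem SampleableFrom.answers {G : ∀ k, (Fin (d k) → Bool) → Fin (n k) → S} (hG : IsPRG G)
    (hm : PolyTimeLength m)
    {F : ∀ k, (Fin (r k) → A) → Fin (M k) → (Fin (m k) → B) → (Fin (n k) → S) → Fin (n k) → Z}
    (hF : PTF (fun i : (k : ℕ) × ((Fin (r k) → A) × Fin (M k) × (Fin (m k) → B) ×
          (Fin (n k) → S)) => Data.cons (num i.1) (.cons (encVec i.2.1) (.cons (encMsg i.2.2.1)
            (.cons (encVec i.2.2.2.1) (encVec i.2.2.2.2)))))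
        fun i => encVec (F i.1 i.2.1 i.2.2.1 i.2.2.2.1 i.2.2.2.2)) :
    SampleableFrom (fun j : (k : ℕ) × ((Fin (r k) → A) × (Fin (n k) → S) × ℕ × Fin (M k)) =>
        Data.cons (encMsg j.2.2.2.2) (.cons (.cons (num j.1) (.cons (encVec j.2.1)
          (encVec j.2.2.1))) (num j.2.2.2.1)))
      fun j => ((answerDist (F j.1 j.2.1 j.2.2.2.2) (hybrid ((PMF.uniformOfFintype _).map (G j.1))
        (PMF.uniformOfFintype _) (PMF.pure j.2.2.1) j.2.2.2.1)).map encVec).map fun y =>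
          .cons y (.cons (.cons (num j.1) (.cons (encVec j.2.1) (encVec j.2.2.1)))
            (num (j.2.2.2.1 - 1))) := by
  set e := fun j : (k : ℕ) × ((Fin (r k) → A) × (Fin (n k) → S) × ℕ × Fin (M k)) =>
        Data.cons (encMsg j.2.2.2.2) (.cons (.cons (num j.1) (.cons (encVec j.2.1)
          (encVec j.2.2.1))) (num j.2.2.2.1)) with he
  have hk : PTF e fun j => num j.1 := (PTF.refl e).snd.fst.fst
  refine (SampleableFrom.uniform_bind (S := Bool) (m := fun j => d j.1)
    (Q := fun j s => (PMF.uniformOfFintype (Fin (n j.1) → S)).bind fun u =>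
      (PMF.uniformOfFintype (Fin (m j.1) → B)).bind fun ρ => PMF.pure
        (.cons (encVec (F j.1 j.2.1 j.2.2.2.2 ρ (if j.2.2.2.1 = 0 then G j.1 s else
          if j.2.2.2.1 = 1 then j.2.2.1 else u))) (.cons (.cons (num j.1) (.cons (encVec j.2.1)
            (encVec j.2.2.1))) (num (j.2.2.2.1 - 1)))))
    (PTF.call (e := e) hG.polyTime_length.ptf (fun j => j.1) hk) ?_).congr ?_
  · refine SampleableFrom.uniform_bind ?_ ?_
    · let e' := fun j : (j0 : (k : ℕ) × ((Fin (r k) → A) × (Fin (n k) → S) × ℕ ×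
          Fin (M k))) × (Fin (d j0.1) → Bool) => Data.cons (encVec j.2) (e j.1)
      exact PTF.call (e := e') hG.ptf_length (fun j => j.1.1) (PTF.refl e').snd.snd.fst.fst
    refine SampleableFrom.uniform_bind ?_ ?_
    · let e' := fun j : (j1 : (j0 : (k : ℕ) × ((Fin (r k) → A) × (Fin (n k) → S) × ℕ ×
          Fin (M k))) × (Fin (d j0.1) → Bool)) × (Fin (n j1.1.1) → S) =>
        Data.cons (encVec j.2) (.cons (encVec j.1.2) (e j.1.1))
      exact PTF.call (e := e') hm.ptf (fun j => j.1.1.1) (PTF.refl e').snd.snd.snd.fst.fst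
    refine SampleableFrom.of_ptf ?_
    exact (PTF.answer hG hF (fun j : (j2 : (j1 : (j0 : (k : ℕ) × ((Fin (r k) → A) ×
      (Fin (n k) → S) × ℕ × Fin (M k))) × (Fin (d j0.1) → Bool)) × (Fin (n j1.1.1) → S)) ×
        (Fin (m j2.1.1.1) → B) => j.1.1.1.1) (fun j => j.1.1.1.2.1)
      (fun j => j.1.1.1.2.2.1) (fun j => j.1.2) (fun j => j.1.1.1.2.2.2.1)
      (fun j => j.1.1.1.2.2.2.2) (fun j => j.1.1.2) (fun j => j.2))
  · rintro ⟨k, sh, z, c, a⟩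
    simp only [PMF.map_comp, answerDist, PMF.map_bind, hybrid]
    by_cases h0 : c = 0
    · simp only [h0, if_true, PMF.bind_const, PMF.bind_map]
      rfl
    · by_cases h1 : c = 1
      · simp only [h1, if_true, one_ne_zero, if_false, PMF.bind_const, PMF.pure_bind]
        rfl
      · simp only [h0, h1, if_false, PMF.bind_const]
        rfl

end Hybrid

end PayloadCode

/-! ### Reduction of oracle indistinguishability to the security of the generator -/

namespace PayloadCode

open Data

section Hybrid

variable {S A B Z : Type} [Fintype S] [Nonempty S] [Fintype A] [Nonempty A] [Fintype B]
  [Nonempty B] [Fintype Z] [Nonempty Z] {M d n r m : ℕ → ℕ}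

/-- Uniform answers have full support. Hence an adversary that never fails with the uniform oracle
never fails in a hybrid. -/
theorem mem_support_uniformOracle {M n : ℕ} {P : Fin M → PMF (Fin n → Z)} {x : Data}
    {o : Option Data} (h : o ∈ (msgOracle P x).run.support) :
    o ∈ (uniformOracle Z M n x).run.support := by
  classical
  rw [uniformOracle, run_msgOracle]
  rw [run_msgOracle] at h
  split_ifs with hx
  · rw [dif_pos hx, PMF.map_comp] at h
    obtain ⟨w, -, rfl⟩ := (PMF.mem_support_map_iff _ _ _).1 h
    rw [PMF.map_comp]
    exact (PMF.mem_support_map_iff _ _ _).2 ⟨w, by simp, rfl⟩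
  · rwa [dif_neg hx] at h

theorem SampleableFrom.adversary {G : ∀ k, (Fin (d k) → Bool) → Fin (n k) → S} (hG : IsPRG G)
    (hm : PolyTimeLength m)
    {F : ∀ k, (Fin (r k) → A) → Fin (M k) → (Fin (m k) → B) → (Fin (n k) → S) → Fin (n k) → Z}
    (hF : PTF (fun i : (k : ℕ) × ((Fin (r k) → A) × Fin (M k) × (Fin (m k) → B) ×
          (Fin (n k) → S)) => Data.cons (num i.1) (.cons (encVec i.2.1) (.cons (encMsg i.2.2.1)
            (.cons (encVec i.2.2.2.1) (encVec i.2.2.2.2)))))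
        fun i => encVec (F i.1 i.2.1 i.2.2.1 i.2.2.2.1 i.2.2.2.2))
    {D : Prog} {q : Polynomial ℕ} (hD : ∀ k (shift : Fin (r k) → A),
      none ∉ (D.evalProb (uniformOracle Z (M k) (n k)) (.cons (num k) (encVec shift))
        (q.eval k)).support) :
    SampleableFrom (fun i : (k : ℕ) × ((Fin (r k) → A) × (Fin (n k) → S) × ℕ) =>
        Data.cons (.cons (num i.1) (encVec i.2.1)) (.cons (.cons (num i.1) (.cons (encVec i.2.1)
          (encVec i.2.2.1))) (num i.2.2.2)))
      fun i => ((D.tree (.cons (num i.1) (encVec i.2.1)) (q.eval i.1)).stateEval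
        (stateOracle (F i.1 i.2.1) (hybrid ((PMF.uniformOfFintype _).map (G i.1))
          (PMF.uniformOfFintype _) (PMF.pure i.2.2.1))) i.2.2.2).map outcome := by
  classical
  have hq := (SampleableFrom.answers hG hm hF).reindex
    fun j : (i : (k : ℕ) × ((Fin (r k) → A) × (Fin (n k) → S) × ℕ)) × (ℕ × Fin (M i.1)) =>
      ⟨j.1.1, j.1.2.1, j.1.2.2.1, j.2.1, j.2.2⟩
  refine SampleableFrom.withState D
    (X := fun i : (k : ℕ) × ((Fin (r k) → A) × (Fin (n k) → S) × ℕ) =>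
      .cons (num i.1) (encVec i.2.1))
    (st := fun i c => .cons (.cons (num i.1) (.cons (encVec i.2.1) (encVec i.2.2.1))) (num c))
    (T := fun i => q.eval i.1) (c₀ := fun i => i.2.2.2)
    (h := fun i => stateOracle (F i.1 i.2.1) (hybrid ((PMF.uniformOfFintype _).map (G i.1))
          (PMF.uniformOfFintype _) (PMF.pure i.2.2.1)))
    (idx := fun j : (i : (k : ℕ) × ((Fin (r k) → A) × (Fin (n k) → S) × ℕ)) × (ℕ × Fin (M i.1)) =>
      j.1) (cnt := fun j => j.2.1) (x := fun j => encMsg j.2.2)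
    (P := fun j => (answerDist (F j.1.1 j.1.2.1 j.2.2) (hybrid ((PMF.uniformOfFintype _).map
      (G j.1.1)) (PMF.uniformOfFintype _) (PMF.pure j.1.2.2.1) j.2.1)).map encVec) hq ?_ ?_ ?_ ?_
  · intro i c y
    simp only [stateOracle, run_msgOracle]
    split_ifs with hy
    · exact .inr ⟨⟨i, c, hy.choose⟩, rfl, rfl, hy.choose_spec.symm, rfl⟩
    · exact .inl rfl
  · intro i c c' hc
    simp only [size, size_num]; omega
  · refine PolyBdd.eval q ((PolyBdd.self _).of_le fun i => ?_)
    simp only [size, size_num]; omega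
  · intro i
    refine Tree.none_notMem_interp (orc := uniformOracle Z (M i.1) (n i.1)) ?_ ?_
    · intro c x o ho
      exact mem_support_uniformOracle ho
    · rw [← Prog.evalProb_eq]
      exact hD _ _

/-- The distinguisher draws a hybrid and a shift, and runs the adversary with counter `c + 1` and
its own input as the challenge. -/
theorem SampleableFrom.distinguisher {G : ∀ k, (Fin (d k) → Bool) → Fin (n k) → S} (hG : IsPRG G)
    (hr : PolyTimeLength r) (hm : PolyTimeLength m)
    {F : ∀ k, (Fin (r k) → A) → Fin (M k) → (Fin (m k) → B) → (Fin (n k) → S) → Fin (n k) → Z}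
    (hF : PTF (fun i : (k : ℕ) × ((Fin (r k) → A) × Fin (M k) × (Fin (m k) → B) ×
          (Fin (n k) → S)) => Data.cons (num i.1) (.cons (encVec i.2.1) (.cons (encMsg i.2.2.1)
            (.cons (encVec i.2.2.2.1) (encVec i.2.2.2.2)))))
        fun i => encVec (F i.1 i.2.1 i.2.2.1 i.2.2.2.1 i.2.2.2.2))
    {D : Prog} {q : Polynomial ℕ} (hD : ∀ k (shift : Fin (r k) → A),
      none ∉ (D.evalProb (uniformOracle Z (M k) (n k)) (.cons (num k) (encVec shift))
        (q.eval k)).support) :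
    SampleableFrom (fun i : (k : ℕ) × (Fin (n k) → S) => Data.cons (num i.1) (encVec i.2))
      fun i => (PMF.uniformOfFintype (Fin (2 ^ (q.eval i.1).size))).bind fun c =>
        (PMF.uniformOfFintype (Fin (r i.1) → A)).bind fun sh =>
          ((D.tree (.cons (num i.1) (encVec sh)) (q.eval i.1)).stateEval
            (stateOracle (F i.1 sh) (hybrid ((PMF.uniformOfFintype _).map (G i.1))
              (PMF.uniformOfFintype _) (PMF.pure i.2))) (c + 1)).map outcome := by
  set e := fun i : (k : ℕ) × (Fin (n k) → S) => Data.cons (num i.1) (encVec i.2) with he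
  refine SampleableFrom.index_bind (N := fun i : (k : ℕ) × (Fin (n k) → S) => q.eval i.1)
    (Q := fun i c => (PMF.uniformOfFintype (Fin (r i.1) → A)).bind fun sh =>
          ((D.tree (.cons (num i.1) (encVec sh)) (q.eval i.1)).stateEval
            (stateOracle (F i.1 sh) (hybrid ((PMF.uniformOfFintype _).map (G i.1))
              (PMF.uniformOfFintype _) (PMF.pure i.2))) (c + 1)).map outcome)
    ((PTF.refl e).fst.num_eval q) ?_
  refine SampleableFrom.uniform_bind ?_ ?_
  · let e' := fun j : (i : (k : ℕ) × (Fin (n k) → S)) × Fin (2 ^ (q.eval i.1).size) =>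
      Data.cons (num j.2) (e j.1)
    exact PTF.call (e := e') hr.ptf (fun j => j.1.1) (PTF.refl e').snd.fst
  · refine SampleableFrom.comp ?_ ((SampleableFrom.adversary hG hm hF hD).reindex
      fun j : (j1 : (i : (k : ℕ) × (Fin (n k) → S)) × Fin (2 ^ (q.eval i.1).size)) ×
        (Fin (r j1.1.1) → A) => ⟨j.1.1.1, j.2, j.1.1.2, j.1.2 + 1⟩)
    have h0 := PTF.refl fun j : (j1 : (i : (k : ℕ) × (Fin (n k) → S)) ×
      Fin (2 ^ (q.eval i.1).size)) × (Fin (r j1.1.1) → A) =>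
        Data.cons (encVec j.2) (.cons (num j.1.2) (e j.1.1))
    exact (h0.snd.snd.fst.pair h0.fst).pair ((h0.snd.snd.fst.pair (h0.fst.pair
      h0.snd.snd.snd)).pair (PTF.nil.pair h0.snd.fst))

/-- The advantage of a distinguisher that runs a random hybrid. -/
theorem abs_sub_prob_hybrid {W H : Type} [Fintype H] [Nonempty H] {M n N Q : ℕ} [NeZero N]
    (F : H → Fin M → B → W → Fin n → Z) (T : H → Tree) (μG μU : PMF W) (P : W → PMF Data)
    (hT : ∀ s, (T s).Clocked Q) (hN : Q ≤ N)
    (hP : ∀ z, P z = (PMF.uniformOfFintype (Fin N)).bind fun c =>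
      (PMF.uniformOfFintype H).bind fun s =>
        ((T s).stateEval (stateOracle (F s) (hybrid μG μU (PMF.pure z))) (c + 1)).map outcome) :
    |prob ((PMF.uniformOfFintype H).bind fun s =>
        (T s).eval (msgOracle fun a => answerDist (F s a) μG)) accepts -
      prob ((PMF.uniformOfFintype H).bind fun s =>
        (T s).eval (msgOracle fun a => answerDist (F s a) μU)) accepts| =
      N * |prob (μG.bind P) {num 1} - prob (μU.bind P) {num 1}| := by
  set pr : ℕ → ℝ := fun c => prob ((PMF.uniformOfFintype H).bind fun s =>
    ((T s).stateEval (stateOracle (F s) (hybrid μG μU μU)) c).map outcome) {num 1} with hpr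
  have hμ : ∀ μ : PMF W, prob (μ.bind P) {num 1} = (∑ c : Fin N,
      prob ((PMF.uniformOfFintype H).bind fun s => ((T s).stateEval
        (stateOracle (F s) (hybrid μG μU μ)) (c + 1)).map outcome) {num 1}) / N := by
    intro μ
    rw [funext hP, PMF.bind_comm, prob_bind_uniform, Fintype.card_fin]
    congr 1
    refine Finset.sum_congr rfl fun c _ => ?_
    rw [PMF.bind_comm]
    simp only [← PMF.map_bind, bind_stateEval_hybrid]
  have h0 : pr 0 = prob ((PMF.uniformOfFintype H).bind fun s =>
      (T s).eval (msgOracle fun a => answerDist (F s a) μG)) accepts := by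
    simp only [hpr, fun s => stateEval_hybrid_zero (F s) μG μU (T s) (hT s)]
    rw [← PMF.map_bind, prob_map, accepts_eq]
  have h1 : pr N = prob ((PMF.uniformOfFintype H).bind fun s =>
      (T s).eval (msgOracle fun a => answerDist (F s a) μU)) accepts := by
    simp only [hpr, fun s => stateEval_hybrid_of_le (F s) μG μU (T s) (hT s) hN]
    rw [← PMF.map_bind, prob_map, accepts_eq]
  have hpos : (0 : ℝ) < N := Nat.cast_pos.2 (NeZero.pos N)
  rw [← h0, ← h1, hμ, hμ]
  -- The challenge `μG` with counter `c + 1` is hybrid `c`, the challenge `μU` is hybrid `c + 1`;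
  -- the sum of the differences telescopes.
  simp only [stateEval_hybrid_succ]
  rw [← sub_div, ← Finset.sum_sub_distrib, abs_div, abs_of_pos hpos, mul_div_cancel₀ _ hpos.ne',
    ← Finset.sum_range_sub' pr N, ← Fin.sum_univ_eq_sum_range (fun i => pr i - pr (i + 1))]

/-- The hybrid argument: in the answers of an oracle a word of a pseudorandom generator can be
replaced by a uniform word. -/
theorem negligible_of_isPRG {G : ∀ k, (Fin (d k) → Bool) → Fin (n k) → S} (hG : IsPRG G)
    (hr : PolyTimeLength r) (hm : PolyTimeLength m)
    {F : ∀ k, (Fin (r k) → A) → Fin (M k) → (Fin (m k) → B) → (Fin (n k) → S) → Fin (n k) → Z}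
    (hF : PTF (fun i : (k : ℕ) × ((Fin (r k) → A) × Fin (M k) × (Fin (m k) → B) ×
          (Fin (n k) → S)) => Data.cons (num i.1) (.cons (encVec i.2.1) (.cons (encMsg i.2.2.1)
            (.cons (encVec i.2.2.2.1) (encVec i.2.2.2.2)))))
        fun i => encVec (F i.1 i.2.1 i.2.2.1 i.2.2.2.1 i.2.2.2.2))
    {D : Prog} {q : Polynomial ℕ} (hD : ∀ k (shift : Fin (r k) → A),
      none ∉ (D.evalProb (uniformOracle Z (M k) (n k)) (.cons (num k) (encVec shift))
        (q.eval k)).support) :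
    Negligible fun k =>
      |prob ((PMF.uniformOfFintype (Fin (r k) → A)).bind fun shift =>
          D.evalProb (msgOracle fun a => answerDist (F k shift a)
            ((PMF.uniformOfFintype (Fin (d k) → Bool)).map (G k)))
              (.cons (num k) (encVec shift)) (q.eval k)) accepts -
        prob ((PMF.uniformOfFintype (Fin (r k) → A)).bind fun shift =>
          D.evalProb (msgOracle fun a => answerDist (F k shift a)
            (PMF.uniformOfFintype (Fin (n k) → S)))
              (.cons (num k) (encVec shift)) (q.eval k)) accepts| := by
  obtain ⟨p, c, hc, hp⟩ := SampleableFrom.distinguisher hG hr hm hF hD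
  have hn : PolyBdd (fun i : (k : ℕ) × (Fin (n k) → S) => i.1) fun i => n i.1 := by
    have h1 : PolyBdd (fun k : ℕ => k) fun k => (num k).size :=
      (((PolyBdd.const 2).mul (PolyBdd.self _)).add (.const 1)).of_le fun k => (size_num k).le
    refine ((h1.trans hG.ptf_length.size_polyBdd).of_le fun k => ?_).reindex Sigma.fst
    rw [size_num]; omega
  have he : PolyBdd (fun i : (k : ℕ) × (Fin (n k) → S) => i.1)
      fun i => (Data.cons (num i.1) (encVec i.2)).size := by
    refine (((PolyBdd.const 3).add ((PolyBdd.const 2).mul (PolyBdd.self _))).add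
      (hn.mul (.const (2 * Fintype.card S + 2)))).of_le fun i => ?_
    have h1 := size_encList_le (List.ofFn i.2)
    rw [List.length_ofFn] at h1
    simp only [size, size_num, encVec]; omega
  obtain ⟨q', hq'⟩ := he.trans hc
  have hsec := hG.secure p q' fun k z => (hp ⟨k, z⟩).none_notMem (hq' ⟨k, z⟩)
  have hadv := fun k => abs_sub_prob_hybrid (F k)
    (fun sh : Fin (r k) → A => D.tree (.cons (num k) (encVec sh)) (q.eval k))
    ((PMF.uniformOfFintype (Fin (d k) → Bool)).map (G k)) (PMF.uniformOfFintype (Fin (n k) → S)) _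
    (fun sh => D.clocked _ _) (Nat.lt_size_self _).le fun z => rfl
  have e1 := fun k => Samples.prob_accepts (μ := PMF.uniformOfFintype (Fin (d k) → Bool)) (p := p)
    (e := fun s => Data.cons (num k) (encVec (G k s)))
    (c := q'.eval k) (fun s => (hp ⟨k, G k s⟩).mono (hq' ⟨k, G k s⟩)) le_rfl
  have e2 := fun k => Samples.prob_accepts (μ := PMF.uniformOfFintype (Fin (n k) → S)) (p := p)
    (e := fun z => Data.cons (num k) (encVec z))
    (c := q'.eval k) (fun z => (hp ⟨k, z⟩).mono (hq' ⟨k, z⟩)) le_rfl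
  simp only [e1, e2] at hsec
  simp only [Prog.evalProb_eq, hadv, PMF.bind_map]
  -- The loss is the number `2 ^ (q.eval k).size` of hybrids, at most `2 q + 1`.
  have hpoly := hsec.polynomial_mul ((2 * q + 1).map (Nat.castRingHom ℝ))
  refine hpoly.trans_abs_le fun k => ?_
  rw [abs_mul, abs_mul]
  refine mul_le_mul_of_nonneg_right ?_ (abs_nonneg _)
  have h4 : 2 ^ (q.eval k).size ≤ 2 * q.eval k + 1 := by
    rcases Nat.eq_zero_or_pos (q.eval k) with h0 | h0
    · simp [h0]
    · have h2 : 0 < (q.eval k).size := Nat.size_pos.2 h0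
      have h3 : 2 ^ ((q.eval k).size - 1) ≤ q.eval k := Nat.lt_size.1 (by omega)
      have h4 : 2 ^ (q.eval k).size = 2 * 2 ^ ((q.eval k).size - 1) := by
        rw [← pow_succ', Nat.sub_add_cancel h2]
      omega
  have h5 : (((2 * q + 1).map (Nat.castRingHom ℝ)).eval (k : ℝ)) = ((2 * q.eval k + 1 : ℕ) : ℝ) := by
    rw [Polynomial.eval_natCast_map]
    simp
  rw [h5, abs_of_nonneg (Nat.cast_nonneg _), abs_of_nonneg (Nat.cast_nonneg _)]
  exact_mod_cast h4

end Hybrid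

end PayloadCode

/-! ### Pseudorandomness of the payload code -/

namespace PayloadCode

open Data

theorem bind_map_comm {α β γ : Type} (P : PMF α) (Q : PMF β) (f : α → β → γ) :
    (P.bind fun a => Q.map (f a)) = Q.bind fun b => P.map fun a => f a b := by
  simp only [← PMF.bind_pure_comp]
  exact PMF.bind_comm _ _ _

section Pseudorandom

variable {Smsg Ssyn A : Type} [AddCommGroup Smsg] [Fintype Smsg] [AddCommGroup Ssyn]
  [Fintype Ssyn] [Fintype A] [Nonempty A] {M d₁ d₂ r n : ℕ → ℕ}
  {enc : ∀ k, Fin (M k) → Fin (n k) → Smsg}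
  {Gsyn : ∀ k, (Fin (d₁ k) → Bool) → Fin (n k) → Ssyn}
  {Gmsg : ∀ k, (Fin (d₂ k) → Bool) → Fin (n k) → Smsg}
  {parse : ∀ k, (Fin (r k) → A) → Fin (n k) → Smsg × Ssyn}

/-- The code word with the words `τ` and `w` in place of the pseudorandom words. -/
def maskedCode (enc : ∀ k, Fin (M k) → Fin (n k) → Smsg)
    (parse : ∀ k, (Fin (r k) → A) → Fin (n k) → Smsg × Ssyn) (k : ℕ) (shift : Fin (r k) → A)
    (a : Fin (M k)) (τ : Fin (n k) → Ssyn) (w : Fin (n k) → Smsg) : Fin (n k) → Smsg × Ssyn :=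
  fun i => (enc k a i + w i + (parse k shift i).1, τ i + (parse k shift i).2)

/-- A uniform word and the masked word `τ`. -/
def randomCode (parse : ∀ k, (Fin (r k) → A) → Fin (n k) → Smsg × Ssyn) (k : ℕ)
    (shift : Fin (r k) → A) (ρ : Fin (n k) → Smsg) (τ : Fin (n k) → Ssyn) :
    Fin (n k) → Smsg × Ssyn :=
  fun i => (ρ i, τ i + (parse k shift i).2)

theorem uniform_map_seeds {d d' : ℕ} :
    (PMF.uniformOfFintype (Fin (d + d') → Bool)).map (fun s => (seedSyn s, seedMsg s)) =
      PMF.uniformOfFintype ((Fin d → Bool) × (Fin d' → Bool)) :=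
  uniform_map_equiv (Fin.appendEquiv d d').symm

/-- The two parts of a uniform seed are independent: the first is the auxiliary randomness `ρ`, the
second feeds the generator under attack. -/
theorem realOracle_loadCode (k : ℕ) (shift : Fin (r k) → A) :
    realOracle (loadCode enc Gsyn Gmsg parse k) shift =
      msgOracle fun a => answerDist (fun s => maskedCode enc parse k shift a (Gsyn k s))
        ((PMF.uniformOfFintype (Fin (d₂ k) → Bool)).map (Gmsg k)) := by
  unfold realOracle
  congr 1
  funext a
  have h : (fun s => loadCode enc Gsyn Gmsg parse k a s shift) =
      (fun x : (Fin (d₁ k) → Bool) × (Fin (d₂ k) → Bool) =>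
        maskedCode enc parse k shift a (Gsyn k x.1) (Gmsg k x.2)) ∘
          fun s => (seedSyn s, seedMsg s) := rfl
  rw [h, ← PMF.map_comp, uniform_map_seeds, uniform_prod, answerDist, PMF.map_bind, PMF.bind_map]
  simp only [PMF.map_comp]
  exact bind_map_comm _ _ _

/-- The two replacements meet here. A uniform mask absorbs the code word and the shift, and the
message disappears from the answer. -/
theorem answerDist_maskedCode (k : ℕ) (shift : Fin (r k) → A) (a : Fin (M k)) :
    answerDist (fun s => maskedCode enc parse k shift a (Gsyn k s))
        (PMF.uniformOfFintype (Fin (n k) → Smsg)) =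
      answerDist (randomCode parse k shift)
        ((PMF.uniformOfFintype (Fin (d₁ k) → Bool)).map (Gsyn k)) := by
  have h := uniform_map_equiv (Equiv.addLeft (fun i => enc k a i + (parse k shift i).1))
  rw [answerDist, answerDist, PMF.bind_map, bind_map_comm]
  congr 1; funext s
  simp only [Function.comp]
  conv_rhs => rw [← h, PMF.map_comp]
  congr 1; funext w i
  simp only [maskedCode, randomCode, Function.comp, Equiv.coe_addLeft, Pi.add_apply]
  rw [add_right_comm]

theorem answerDist_randomCode (k : ℕ) (shift : Fin (r k) → A) :
    answerDist (randomCode parse k shift) (PMF.uniformOfFintype (Fin (n k) → Ssyn)) =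
      PMF.uniformOfFintype (Fin (n k) → Smsg × Ssyn) := by
  have h := uniform_map_equiv (Equiv.addRight (fun i => (parse k shift i).2))
  have h2 := uniform_map_equiv
    (Equiv.arrowProdEquivProdArrow (Fin (n k)) (fun _ => Smsg) (fun _ => Ssyn)).symm
  rw [answerDist, ← h2, uniform_prod, bind_map_comm, PMF.map_bind]
  congr 1; funext ρ
  conv_rhs => rw [PMF.map_comp, ← h, PMF.map_comp]
  rfl

theorem PTF.randomCode (hparse : PolyTime (fun _ => encVec) (fun _ => encVec) parse) :
    PTF (fun i : (k : ℕ) × ((Fin (r k) → A) × Fin (M k) × (Fin (n k) → Smsg) ×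
        (Fin (n k) → Ssyn)) => Data.cons (num i.1) (Data.cons (encVec i.2.1)
          (Data.cons (encMsg i.2.2.1) (Data.cons (encVec i.2.2.2.1) (encVec i.2.2.2.2)))))
      fun i => encVec (PayloadCode.randomCode parse i.1 i.2.1 i.2.2.2.1 i.2.2.2.2) := by
  set e := fun i : (k : ℕ) × ((Fin (r k) → A) × Fin (M k) × (Fin (n k) → Smsg) ×
        (Fin (n k) → Ssyn)) => Data.cons (num i.1) (Data.cons (encVec i.2.1)
          (Data.cons (encMsg i.2.2.1) (Data.cons (encVec i.2.2.2.1) (encVec i.2.2.2.2))))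
  have hk : PTF e fun i => num i.1 := (PTF.refl _).fst
  have hρ : PTF e fun i => encVec i.2.2.2.1 := (PTF.refl _).snd.snd.snd.fst
  have hτ : PTF e fun i => encVec i.2.2.2.2 := (PTF.refl _).snd.snd.snd.snd
  have hw : PTF e fun i => encVec (parse i.1 i.2.1) :=
    PTF.call (e := e) hparse.ptf (fun i => ⟨i.1, i.2.1⟩) (hk.pair (PTF.refl _).snd.fst)
  exact PTF.vecMap₂ (fun a b => (a, b)) hρ (PTF.vecMap₂ (fun a b => a + b.2) hτ hw)

theorem PTF.maskedCode (henc : PolyTime (fun _ => encMsg) (fun _ => encVec) enc)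
    (hsyn : PolyTime (fun _ => encVec) (fun _ => encVec) Gsyn)
    (hparse : PolyTime (fun _ => encVec) (fun _ => encVec) parse) :
    PTF (fun i : (k : ℕ) × ((Fin (r k) → A) × Fin (M k) × (Fin (d₁ k) → Bool) ×
        (Fin (n k) → Smsg)) => Data.cons (num i.1) (Data.cons (encVec i.2.1)
          (Data.cons (encMsg i.2.2.1) (Data.cons (encVec i.2.2.2.1) (encVec i.2.2.2.2)))))
      fun i => encVec (PayloadCode.maskedCode enc parse i.1 i.2.1 i.2.2.1 (Gsyn i.1 i.2.2.2.1)
        i.2.2.2.2) := by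
  set e := fun i : (k : ℕ) × ((Fin (r k) → A) × Fin (M k) × (Fin (d₁ k) → Bool) ×
        (Fin (n k) → Smsg)) => Data.cons (num i.1) (Data.cons (encVec i.2.1)
          (Data.cons (encMsg i.2.2.1) (Data.cons (encVec i.2.2.2.1) (encVec i.2.2.2.2))))
  have hk : PTF e fun i => num i.1 := (PTF.refl _).fst
  have hρ : PTF e fun i => encVec i.2.2.2.2 := (PTF.refl _).snd.snd.snd.snd
  have ha : PTF e fun i => encVec (enc i.1 i.2.2.1) :=
    PTF.call (e := e) henc.ptf (fun i => ⟨i.1, i.2.2.1⟩) (hk.pair (PTF.refl _).snd.snd.fst)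
  have hτ : PTF e fun i => encVec (Gsyn i.1 i.2.2.2.1) :=
    PTF.call (e := e) hsyn.ptf (fun i => ⟨i.1, i.2.2.2.1⟩)
      (hk.pair (PTF.refl _).snd.snd.snd.fst)
  have hw : PTF e fun i => encVec (parse i.1 i.2.1) :=
    PTF.call (e := e) hparse.ptf (fun i => ⟨i.1, i.2.1⟩) (hk.pair (PTF.refl _).snd.fst)
  exact PTF.vecMap₂ (fun a b => (a + b.1.1, b.2 + b.1.2)) ha
    (PTF.vecMap₂ (fun a b => (a, b)) (PTF.vecMap₂ (fun a b => (a + b.1, b.2)) hρ hw) hτ) |>.congr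
    (fun _ => rfl) fun i => congrArg encVec (funext fun j => by
      simp only [PayloadCode.maskedCode, add_assoc])

/-- The pseudorandomness of the code. -/
theorem loadCode_pseudorandom (henc : PolyTime (fun _ => encMsg) (fun _ => encVec) enc)
    (hsyn : IsPRG Gsyn) (hmsg : IsPRG Gmsg) (hparse : IsShiftParser parse) (D : Prog)
    (q : Polynomial ℕ) (hD : ∀ k (shift : Fin (r k) → A),
      none ∉ (D.evalProb (uniformOracle (Smsg × Ssyn) (M k) (n k))
        (Data.cons (Data.num k) (encVec shift)) (q.eval k)).support) :
    Negligible fun k =>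
      |prob ((PMF.uniformOfFintype (Fin (r k) → A)).bind fun shift =>
          D.evalProb (realOracle (loadCode enc Gsyn Gmsg parse k) shift)
            (Data.cons (Data.num k) (encVec shift)) (q.eval k)) accepts -
        prob ((PMF.uniformOfFintype (Fin (r k) → A)).bind fun shift =>
          D.evalProb (uniformOracle (Smsg × Ssyn) (M k) (n k))
            (Data.cons (Data.num k) (encVec shift)) (q.eval k)) accepts| := by
  -- First `Gmsg` is replaced, with the seed of `Gsyn` as auxiliary randomness; then `Gsyn`, with
  -- the uniform payload word, of length `n`, in this role.
  have h1 := negligible_of_isPRG hmsg hparse.polyTime_length hsyn.polyTime_length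
    (F := fun k shift a s => maskedCode enc parse k shift a (Gsyn k s)) ?_ hD
  have h2 := negligible_of_isPRG (M := M) hsyn hparse.polyTime_length (m := n) ?_
    (F := fun k shift _ => randomCode parse k shift) ?_ hD
  · simp only [answerDist_maskedCode, ← realOracle_loadCode] at h1
    simp only [answerDist_randomCode] at h2
    refine (h1.add h2).trans_abs_le fun k => ?_
    rw [abs_abs]
    exact (abs_sub_le _ _ _).trans (le_abs_self _)
  · exact PTF.polyTime (PTF.call (e := fun i : (_ : ℕ) × Unit => Data.cons (num i.1) .nil)
      hsyn.ptf_length (fun i => i.1) (PTF.refl _).fst)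
  · exact PTF.randomCode hparse.polyTime_parse
  · exact PTF.maskedCode henc hsyn.polyTime_gen hparse.polyTime_parse

end Pseudorandom

end PayloadCode

theorem mainTheorem4 :
    ∃ C : ℝ, 0 < C ∧
      ∀ (Smsg Ssyn A : Type) [AddCommGroup Smsg] [Fintype Smsg] [AddCommGroup Ssyn] [Fintype Ssyn]
        [Fintype A] [Nonempty A] (M d₁ d₂ r n : ℕ → ℕ)
        (enc : ∀ k, Fin (M k) → Fin (n k) → Smsg)
        (Gsyn : ∀ k, (Fin (d₁ k) → Bool) → Fin (n k) → Ssyn)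
        (Gmsg : ∀ k, (Fin (d₂ k) → Bool) → Fin (n k) → Smsg)
        (parse : ∀ k, (Fin (r k) → A) → Fin (n k) → Smsg × Ssyn)
        (pmsg pload δ : ℝ),
        PayloadCode.IsHalfErrorCode enc pmsg →
        PayloadCode.IsPRG Gsyn →
        PayloadCode.IsPRG Gmsg →
        PayloadCode.IsShiftParser parse →
        Asymptotics.IsBigO Filter.atTop (fun k : ℕ => (k : ℝ)) (fun k : ℕ => (n k : ℝ)) →
        0 < δ →
        pload ≤ pmsg - δ →
        (Fintype.card Smsg : ℝ) * (C * δ⁻¹ ^ 4) ≤ (Fintype.card (Smsg × Ssyn) : ℝ) →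
        PayloadCode.IsSeededPayloadCode (d := fun k => d₁ k + d₂ k)
          (PayloadCode.loadCode enc Gsyn Gmsg parse) pload := by
  -- `6400 = 16 · 20²`, from `16/ε²` with `ε = δ²/20`.
  refine ⟨6400, by norm_num, ?_⟩
  intro Smsg Ssyn A _ _ _ _ _ _ M d₁ d₂ r n enc Gsyn Gmsg parse pmsg pload δ henc hsyn hmsg hparse
    hn hδ hp hcard
  have hK : 6400 * δ⁻¹ ^ 4 ≤ (Fintype.card Ssyn : ℝ) := by
    rw [Fintype.card_prod, Nat.cast_mul] at hcard
    exact le_of_mul_le_mul_left hcard (Nat.cast_pos.2 Fintype.card_pos)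
  exact ⟨PayloadCode.loadCode_polyTime henc.polyTime_enc hsyn.polyTime_length hsyn.polyTime_gen
      hmsg.polyTime_gen hparse.polyTime_parse,
    PayloadCode.exists_decoder henc hsyn.polyTime_length hsyn.polyTime_gen hmsg.polyTime_gen hparse
      hn hδ hp hK,
    PayloadCode.loadCode_uniform hparse.uniform,
    PayloadCode.loadCode_pseudorandom henc.polyTime_enc hsyn hmsg hparse⟩
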